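/- For $k,n\ge 0$ let a block cipher with key length $k$ and block length $n$ be a family of permutations $E_K:\{0,1\}^n\to\{0,1\}^n$, $K\in\{0,1\}^k$. A quantum circuit (over the gates NOT, Hadamard, $T$, $T^{-1}$, CNOT, Toffoli) with input wires for a key and a plaintext, $n$ output wires and further ancillas is said to evaluate $E$ if, for every key $K$ and plaintext $x$ on the input wires and zeros on all other wires, measuring the output wires of the final state yields $E_K(x)$ with certainty; its size is its number of wires plus its number of gates. For a secret key $s\in\{0,1\}^k$, the bit-flip related-key oracle is the unitary $|L\rangle|x\rangle|y\rangle\mapsto|L\rangle|x\rangle|y\oplus E_{s\oplus L}(x)\rangle$ with $L\in\{0,1\}^k$, $x,y\in\{0,1\}^n$. There is a single quantum algorithm $A$ (a fixed program for a classical random access machine that controls a quantum memory by means of the above gates, measurements, and oracle queries, each step having unit cost) such that for every polynomial $q$ there is a polynomial $p$ with the following property. Let $k\ge 0$, $n\ge 1$ and $r>\lceil k/n\rceil$, let $E$ be a block cipher with key length $k$ and block length $n$, let $C$ be a quantum circuit that evaluates $E$, and suppose that $r$ and the size of $C$ are at most $q(k)$. Let $m_1,\dots,m_r\in\{0,1\}^n$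 be plaintexts that determine the key: for every key $K$, the key $K$ is the only $K'\in\{0,1\}^k$ with $(E_{K'}(m_1),\dots,E_{K'}(m_r))=(E_K(m_1),\dots,E_K(m_r))$. Then for every secret key $s\in\{0,1\}^k$, the algorithm $A$, given $k,n,r$, the description of $C$, the plaintexts $m_1,\dots,m_r$, the ciphertexts $E_s(m_1),\dots,E_s(m_r)$, and access to the related-key oracle for $s$, halts with output $s$ with probability $1$, and its expected running time is at most $p(k)$. -/

import Mathlib

open scoped ENNReal

namespace RelatedKey

noncomputable section

/-! ## Bit strings and block ciphers -/

/-- Bit strings of length `k`. -/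
abbrev Bits (k : ℕ) : Type := Fin k → Bool

/-- Bitwise exclusive or. -/
def xorBits {k : ℕ} (x y : Bits k) : Bits k := fun i => Bool.xor (x i) (y i)

/-- A block cipher with key length `k` and block length `n`: a permutation of the blocks for
every key. -/
abbrev BlockCipher (k n : ℕ) : Type := Bits k → Equiv.Perm (Bits n)

/-- The plaintexts `m` determine the key: whatever the key `K` is, it is the only key that is
consistent with the plaintext-ciphertext pairs `(m i, E K (m i))`. -/
def DeterminesKey {k n r : ℕ} (E : BlockCipher k n) (m : Fin r → Bits n) : Prop :=
  ∀ K : Bits k, ∃! K' : Bits k, ∀ i, E K' (m i) = E K (m i)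

/-- The bit-flip related-key oracle for the secret key `s`: a bitmask `L` and a block `x` are
answered by the encryption of `x` under the key `s ⊕ L`. -/
def relatedKeyOracle {k n : ℕ} (E : BlockCipher k n) (s L : Bits k) (x : Bits n) : Bits n :=
  E (xorBits s L) x

/-! ## Quantum states and gates -/

/-- A vector of amplitudes for qubits labelled by `α`. A computational basis state is the finite
set of the qubits that have the value `1`. -/
abbrev QState (α : Type) : Type := Finset α → ℂ

/-- The computational basis state `S`. -/
def ket {α : Type} [DecidableEq α] (S : Finset α) : QState α := fun S' => if S' = S then 1 else 0

/-- The squared norm. -/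
def weight {α : Type} (ψ : QState α) : ℝ≥0∞ := ∑' S, ‖ψ S‖ₑ ^ 2

/-- Flip the value of the qubit `t` in a basis state. -/
def flipQubit {α : Type} [DecidableEq α] (t : α) (S : Finset α) : Finset α := symmDiff S {t}

/-- The gates: NOT, Hadamard, `T = diag(1, exp(iπ/4))`, the inverse of `T`, CNOT (control, target)
and Toffoli (two controls, target). -/
inductive Gate (α : Type) : Type
  | X (t : α)
  | H (t : α)
  | T (t : α)
  | Tinv (t : α)
  | CX (c t : α)
  | CCX (c d t : α)

/-- Relabelling of the qubits of a gate. -/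
def Gate.map {α β : Type} (f : α → β) : Gate α → Gate β
  | X t => X (f t)
  | H t => H (f t)
  | T t => T (f t)
  | Tinv t => Tinv (f t)
  | CX c t => CX (f c) (f t)
  | CCX c d t => CCX (f c) (f d) (f t)

/-- The unitary of a gate. A controlled gate whose target is one of its controls does nothing. -/
def Gate.apply {α : Type} [DecidableEq α] : Gate α → QState α → QState α
  | X t, ψ => fun S => ψ (flipQubit t S)
  | H t, ψ => fun S =>
      if t ∈ S then (ψ (S.erase t) - ψ S) / (Real.sqrt 2 : ℂ)
      else (ψ S + ψ (insert t S)) / (Real.sqrt 2 : ℂ)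
  | T t, ψ => fun S => if t ∈ S then Complex.exp (Complex.I * Real.pi / 4) * ψ S else ψ S
  | Tinv t, ψ => fun S => if t ∈ S then Complex.exp (-(Complex.I * Real.pi / 4)) * ψ S else ψ S
  | CX c t, ψ => fun S => if c ≠ t ∧ c ∈ S then ψ (flipQubit t S) else ψ S
  | CCX c d t, ψ => fun S =>
      if c ≠ t ∧ d ≠ t ∧ c ∈ S ∧ d ∈ S then ψ (flipQubit t S) else ψ S

/-- Apply a list of gates, the head first. -/
def applyGates {α : Type} [DecidableEq α] (gs : List (Gate α)) (ψ : QState α) : QState α :=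
  gs.foldl (fun φ g => g.apply φ) ψ

/-! ## Quantum circuits for a block cipher -/

/-- A circuit on `k + n + n + a` wires, in this order: `k` wires for the key, `n` wires for the
plaintext, `n` wires for the ciphertext, `a` ancillas. -/
structure Circuit (k n a : ℕ) : Type where
  gates : List (Gate (Fin (k + n + n + a)))

/-- The size of a circuit: the number of wires plus the number of gates. -/
def Circuit.size {k n a : ℕ} (C : Circuit k n a) : ℕ := (k + n + n + a) + C.gates.length

/-- The basis state with the key `K` and the plaintext `x` on the input wires and `0` on all
the other wires. -/
def Circuit.input {k n : ℕ} (a : ℕ) (K : Bits k) (x : Bits n) : Finset (Fin (k + n + n + a)) :=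
  Finset.univ.filter fun w =>
    (∃ i : Fin k, w.val = i.val ∧ K i = true) ∨ (∃ j : Fin n, w.val = k + j.val ∧ x j = true)

/-- The ciphertext wire number `j`. -/
def Circuit.outWire {k n : ℕ} (a : ℕ) (j : Fin n) : Fin (k + n + n + a) :=
  ⟨k + n + j.val, by omega⟩

/-- The circuit evaluates the cipher `E`: for every key `K` and plaintext `x` on the input wires
and zeros elsewhere, a measurement of the ciphertext wires of the final state yields `E K x` with
certainty, that is, every basis state that occurs in the final state has `E K x` on these wires.
Nothing is required of the other wires. -/
def Circuit.Evaluates {k n a : ℕ} (C : Circuit k n a) (E : BlockCipher k n) : Prop :=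
  ∀ (K : Bits k) (x : Bits n) (S : Finset (Fin (k + n + n + a))),
    applyGates C.gates (ket (Circuit.input a K x)) S ≠ 0 →
      ∀ j : Fin n, (Circuit.outWire a j ∈ S ↔ E K x j = true)

/-! ## The machine model

A random access machine that controls a quantum memory. The classical memory consists of arrays of
natural numbers, `mem b i` being cell `i` of array `b`. The quantum memory consists of registers
of qubits, `(b, i)` being qubit `i` of register `b`. A program is one fixed finite text: the names
of arrays and registers in it are constants, the indices are computed. Each elementary step costs
one unit of time; the only arithmetic is addition and truncated subtraction, so that unit-cost time
is polynomially related to bit operations. -/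

/-- Arithmetic expressions. -/
inductive Expr : Type
  | lit (c : ℕ)
  | get (b : ℕ) (i : Expr)
  | add (e f : Expr)
  | sub (e f : Expr)

/-- The classical memory. -/
abbrev Mem : Type := ℕ → ℕ → ℕ

/-- The value of an expression. -/
def Expr.eval (mem : Mem) : Expr → ℕ
  | lit c => c
  | get b i => mem b (i.eval mem)
  | add e f => e.eval mem + f.eval mem
  | sub e f => e.eval mem - f.eval mem

/-- Write `v` into cell `i` of array `b`. -/
def Mem.set (mem : Mem) (b i v : ℕ) : Mem :=
  fun b' i' => if b' = b ∧ i' = i then v else mem b' i'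

/-- Qubit `i` of register `b` is `(b, i)`. -/
abbrev Qubit : Type := ℕ × ℕ

/-- A qubit address in a program: a register and an index to be computed. -/
abbrev QAddr : Type := ℕ × Expr

/-- The qubit at an address. -/
def QAddr.eval (mem : Mem) (q : QAddr) : Qubit := (q.1, q.2.eval mem)

/-- Programs. -/
inductive Cmd : Type
  /-- Write the value of `e` into cell `i` of array `b`. -/
  | assign (b : ℕ) (i e : Expr)
  /-- Apply a gate. -/
  | gate (g : Gate QAddr)
  /-- Measure the qubit `q` and write the outcome into cell `i` of array `b`. -/
  | measure (q : QAddr) (b : ℕ) (i : Expr)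
  /-- Query the oracle on the blocks of qubits that start at the addresses `L`, `x` and `y`. -/
  | query (L x y : QAddr)
  /-- Sequential composition. -/
  | seq (c d : Cmd)
  /-- Execute `c` if `e` is not zero, and `d` otherwise. -/
  | ite (e : Expr) (c d : Cmd)
  /-- Repeat `c` as long as `e` is not zero. -/
  | loop (e : Expr) (c : Cmd)

/-- The block of `len` qubits that starts at `q`. -/
def block (q : Qubit) (len : ℕ) : Finset Qubit := (Finset.range len).image fun i => (q.1, q.2 + i)

/-- The content of the block of `len` qubits that starts at `q`, in the basis state `S`. -/
def readBlock (S : Finset Qubit) (q : Qubit) (len : ℕ) : Bits len :=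
  fun i => decide ((q.1, q.2 + i.val) ∈ S)

/-- The set of the qubits of the block starting at `q` at which `v` has a `1`. -/
def blockSupport (q : Qubit) {len : ℕ} (v : Bits len) : Finset Qubit :=
  (Finset.univ.filter fun i : Fin len => v i = true).image fun i => (q.1, q.2 + i.val)

/-- The oracle unitary `|L⟩|x⟩|y⟩ ↦ |L⟩|x⟩|y ⊕ O L x⟩` on the blocks that start at `qL`, `qx`
and `qy`. It does nothing if the target block meets one of the other two. -/
def applyOracle {k n : ℕ} (O : Bits k → Bits n → Bits n) (qL qx qy : Qubit) (ψ : QState Qubit) :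
    QState Qubit :=
  if Disjoint (block qy n) (block qL k ∪ block qx n) then
    fun S => ψ (symmDiff S (blockSupport qy (O (readBlock S qL k) (readBlock S qx n))))
  else ψ

/-- The projection of a state onto the outcome `v` of a measurement of the qubit `q`. -/
def project (q : Qubit) (v : Bool) (ψ : QState Qubit) : QState Qubit :=
  fun S => if decide (q ∈ S) = v then ψ S else 0

/-- A configuration: the commands still to be executed, the classical memory and the quantum
state. The quantum state is not renormalized after measurements, so that its squared norm is the
probability of the measurement outcomes seen so far. -/
structure Config : Type where
  todo : List Cmd
  mem : Mem
  state : QState Qubit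

/-- One step. The result lists the possible successors: two for a measurement, one for every other
command, and a halted configuration stays as it is. -/
def step {k n : ℕ} (O : Bits k → Bits n → Bits n) : Config → List Config
  | ⟨[], mem, ψ⟩ => [⟨[], mem, ψ⟩]
  | ⟨.assign b i e :: cs, mem, ψ⟩ => [⟨cs, mem.set b (i.eval mem) (e.eval mem), ψ⟩]
  | ⟨.gate g :: cs, mem, ψ⟩ => [⟨cs, mem, (g.map (QAddr.eval mem)).apply ψ⟩]
  | ⟨.measure q b i :: cs, mem, ψ⟩ =>
      [⟨cs, mem.set b (i.eval mem) 0, project (q.eval mem) false ψ⟩,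
       ⟨cs, mem.set b (i.eval mem) 1, project (q.eval mem) true ψ⟩]
  | ⟨.query L x y :: cs, mem, ψ⟩ =>
      [⟨cs, mem, applyOracle O (L.eval mem) (x.eval mem) (y.eval mem) ψ⟩]
  | ⟨.seq c d :: cs, mem, ψ⟩ => [⟨c :: d :: cs, mem, ψ⟩]
  | ⟨.ite e c d :: cs, mem, ψ⟩ => [⟨(if e.eval mem ≠ 0 then c else d) :: cs, mem, ψ⟩]
  | ⟨.loop e c :: cs, mem, ψ⟩ =>
      [⟨if e.eval mem ≠ 0 then c :: .loop e c :: cs else cs, mem, ψ⟩]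

/-- The possible configurations after `t` steps. -/
def after {k n : ℕ} (O : Bits k → Bits n → Bits n) : ℕ → Config → List Config
  | 0, c => [c]
  | t + 1, c => (step O c).flatMap (after O t)

open Classical in
/-- The probability that the configuration after `t` steps has the property `P`. -/
def probAfter {k n : ℕ} (O : Bits k → Bits n → Bits n) (c : Config) (t : ℕ) (P : Config → Prop) :
    ℝ≥0∞ :=
  ((after O t c).map fun d => if P d then weight d.state else 0).sum

/-- The machine has halted. -/
def Config.Halted (c : Config) : Prop := c.todo = []

/-- The expected running time `∑ t, Pr[running time > t]`. -/
def expectedTime {k n : ℕ} (O : Bits k → Bits n → Bits n) (c : Config) : ℝ≥0∞ :=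
  ∑' t : ℕ, probAfter O c t fun d => ¬ d.Halted

/-! ## Input and output of the attack -/

/-- The number of a gate type in the description of a circuit. -/
def Gate.opcode {α : Type} : Gate α → ℕ
  | X _ => 0
  | H _ => 1
  | T _ => 2
  | Tinv _ => 3
  | CX _ _ => 4
  | CCX _ _ _ => 5

/-- The wires of a gate, in order. -/
def Gate.operands {α : Type} : Gate α → List α
  | X t => [t]
  | H t => [t]
  | T t => [t]
  | Tinv t => [t]
  | CX c t => [c, t]
  | CCX c d t => [c, d, t]

/-- Operand number `j` of a gate, as a natural number (`0` if there is none). -/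
def Gate.operand {w : ℕ} (g : Gate (Fin w)) (j : ℕ) : ℕ := (g.operands.map Fin.val).getD j 0

/-- A tuple of blocks as a list of `0`s and `1`s: bit `j` of block `i` is entry `i * n + j`. -/
def blockList {r n : ℕ} (v : Fin r → Bits n) : List ℕ :=
  (List.ofFn fun i => List.ofFn fun j => (v i j).toNat).flatten

/-- The input of the attack. Array `0`: the numbers `k, n, r, a` and the number of gates of the
circuit. Arrays `1` to `4`: the type and the wires of each gate. Array `5`: the plaintexts.
Array `6`: the ciphertexts. Everything else is `0`. -/
def inputMem {k n r a : ℕ} (C : Circuit k n a) (m c : Fin r → Bits n) : Mem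
  | 0, i => [k, n, r, a, C.gates.length].getD i 0
  | 1, i => (C.gates.map Gate.opcode).getD i 0
  | 2, i => (C.gates.map fun g => g.operand 0).getD i 0
  | 3, i => (C.gates.map fun g => g.operand 1).getD i 0
  | 4, i => (C.gates.map fun g => g.operand 2).getD i 0
  | 5, i => (blockList m).getD i 0
  | 6, i => (blockList c).getD i 0
  | _, _ => 0

/-- The initial configuration: all qubits are `0`. -/
def start {k n r a : ℕ} (A : Cmd) (C : Circuit k n a) (m c : Fin r → Bits n) : Config :=
  ⟨[A], inputMem C m c, ket ∅⟩

/-- The machine has halted with the bit string `s` in array `7`. -/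
def Config.HaltedWith {k : ℕ} (s : Bits k) (c : Config) : Prop :=
  c.Halted ∧ ∀ i : Fin k, c.mem 7 i.val = (s i).toNat

/-- The probability that the machine halts with the output `s`. -/
def probOutput {k n : ℕ} (O : Bits k → Bits n → Bits n) (c : Config) (s : Bits k) : ℝ≥0∞ :=
  ⨆ t : ℕ, probAfter O c t (Config.HaltedWith s)

end

end RelatedKey

open RelatedKey

set_option linter.unusedSectionVars false

namespace RelatedKey

noncomputable section

/-! ## Gates and oracle queries as linear isometries -/

/-! The attack reduces key recovery to Simon's problem. Write `p = (1, s)` in `F₂^(k+1)`, and let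
`f(1, K)` be the tuple of all `E_K(m_i)` and `f(0, K)` the tuple of all `E_{s⊕K}(m_i)`. Adding `p`
swaps the two cases and cancels the mask, so `f(x + p) = f(x)`. Since the plaintexts determine the
key, `f` is injective for a fixed control bit, and its nonempty fibres are exactly the pairs `{x, x
+ p}` (`cipherPair_period`, `cipherPair_injective`).

The circuit may leave garbage on its wires, and neither it nor the oracle is available in controlled
form. Both obstacles vanish by computing, copying the ciphertext with Toffoli gates controlled by
the control qubit, and uncomputing: with the inverse gates for the circuit, with a second query for
the oracle (`runOps_stage`). Hadamard gates before and after this evaluation give a state in which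
every string `y` with nonzero amplitude satisfies `y·p = 0` (`period_orthogonal`), and in which `y`
and `y + e` are equally likely whenever `e·p = 0` (`period_shift`). Nothing else about the
distribution is needed.

The classical part keeps rows `u_0, …, u_d`, unitriangular, with `p = ∑ p_j u_j` over `j ≤ d`; the
coefficients are the coordinates of `p` itself. At the start the rows are the unit vectors and `d =
k`. If a sample has `y·u_d = 1`, then `y·p = 0` expresses `p_d` through the other `p_j`, and row `d`
is eliminated (`span_eliminate`); otherwise a new sample is taken. Let `e` be the unit vector at `d`
plus `p_d` times the unit vector at `0`. For `d > 0` it satisfies `e·p = 0` and `e·u_d = 1`, so a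
round succeeds with probability exactly one half (`dot_symmDiff_shift`, `tsum_half`). After an
expected `2k` rounds `d = 0` and `p = u_0`, from which `s` is read off. The output is never wrong;
only the running time is random.

Both conclusions follow from one quantity, `penalizedTime`: the expected time truncated at `N`
steps, with an infinite penalty for a wrong output. A finite bound independent of `N` bounds the
expected time and forces the right output with probability one (`expectedTime_le`,
`probOutput_eq_one`). The truncation also makes the analysis of the unbounded loop an induction on
`N` (`loop_bound`). -/

theorem mem_flipQubit {α : Type} [DecidableEq α] {t q : α} {S : Finset α} :
    q ∈ flipQubit t S ↔ if q = t then q ∉ S else q ∈ S := by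
  by_cases h : q = t <;> simp [flipQubit, Finset.mem_symmDiff, h]

theorem flipQubit_involutive {α : Type} [DecidableEq α] (t : α) :
    Function.Involutive (flipQubit t) := fun S => by
  simp [flipQubit]

theorem flipQubit_of_notMem {α : Type} [DecidableEq α] {t : α} {S : Finset α} (h : t ∉ S) :
    flipQubit t S = insert t S := by
  ext q
  rw [mem_flipQubit]
  by_cases hq : q = t <;> simp [hq, h]

theorem flipQubit_of_mem {α : Type} [DecidableEq α] {t : α} {S : Finset α} (h : t ∈ S) :
    flipQubit t S = S.erase t := by
  ext q
  rw [mem_flipQubit]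
  by_cases hq : q = t <;> simp [hq, h]

theorem weight_comp {α : Type} (ψ : QState α) {f : Finset α → Finset α}
    (hf : Function.Involutive f) : weight (fun S => ψ (f S)) = weight ψ :=
  (hf.toPerm).tsum_eq fun S => ‖ψ S‖ₑ ^ 2

theorem weight_zero {α : Type} : weight (0 : QState α) = 0 := by simp [weight]

theorem weight_smul {α : Type} (c : ℂ) (ψ : QState α) : weight (c • ψ) = ‖c‖ₑ ^ 2 * weight ψ := by
  simp only [weight, Pi.smul_apply, smul_eq_mul, enorm_mul, mul_pow, ENNReal.tsum_mul_left]

theorem weight_ket {α : Type} [DecidableEq α] (S : Finset α) : weight (ket S) = 1 := by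
  rw [weight, tsum_eq_single S]
  · simp [ket]
  · intro b hb
    simp [ket, hb]

/-- Group the basis states into pairs that differ in the qubit `t` only. -/
theorem tsum_pair {α : Type} [DecidableEq α] (t : α) (f : Finset α → ℝ≥0∞) :
    ∑' S, f S = ∑' S, if t ∈ S then 0 else f S + f (insert t S) := by
  have h1 : ∀ S, f S = (if t ∈ S then 0 else f S) + (if t ∈ S then f S else 0) := by
    intro S; split_ifs <;> simp
  rw [tsum_congr h1, ENNReal.tsum_add,
    ← (flipQubit_involutive t).toPerm.tsum_eq (fun S => if t ∈ S then f S else 0),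
    ← ENNReal.tsum_add]
  refine tsum_congr fun S => ?_
  by_cases h : t ∈ S
  · simp [h, flipQubit_of_mem]
  · simp [h, flipQubit_of_notMem]

theorem Gate.apply_H_notMem {α : Type} [DecidableEq α] {t : α} {S : Finset α} (h : t ∉ S)
    (ψ : QState α) : (Gate.H t).apply ψ S = (ψ S + ψ (insert t S)) / (Real.sqrt 2 : ℂ) := by
  simp [Gate.apply, h]

theorem Gate.apply_H_insert {α : Type} [DecidableEq α] {t : α} {S : Finset α} (h : t ∉ S)
    (ψ : QState α) :
    (Gate.H t).apply ψ (insert t S) = (ψ S - ψ (insert t S)) / (Real.sqrt 2 : ℂ) := by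
  simp [Gate.apply, h]

/-- This is the parallelogram law. Applied to each pair of basis states from `tsum_pair`, it shows
that a Hadamard gate preserves the norm. -/
theorem enorm_sq_hadamard (x y : ℂ) :
    ‖(x + y) / (Real.sqrt 2 : ℂ)‖ₑ ^ 2 + ‖(x - y) / (Real.sqrt 2 : ℂ)‖ₑ ^ 2 =
      ‖x‖ₑ ^ 2 + ‖y‖ₑ ^ 2 := by
  have key : ‖(x + y) / (Real.sqrt 2 : ℂ)‖ ^ 2 + ‖(x - y) / (Real.sqrt 2 : ℂ)‖ ^ 2 =
      ‖x‖ ^ 2 + ‖y‖ ^ 2 := by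
    have h := parallelogram_law_with_norm ℝ x y
    rw [norm_div, norm_div, div_pow, div_pow, Complex.norm_real, Real.norm_eq_abs, sq_abs,
      Real.sq_sqrt (by norm_num)]
    linarith
  simp only [← ofReal_norm]
  rw [← ENNReal.ofReal_pow (norm_nonneg _), ← ENNReal.ofReal_pow (norm_nonneg _),
    ← ENNReal.ofReal_pow (norm_nonneg _), ← ENNReal.ofReal_pow (norm_nonneg _),
    ← ENNReal.ofReal_add (by positivity) (by positivity),
    ← ENNReal.ofReal_add (by positivity) (by positivity), key]

theorem involutive_flip_if {α : Type} [DecidableEq α] (t : α) (P : Finset α → Prop)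
    [DecidablePred P] (hP : ∀ S, P (flipQubit t S) ↔ P S) :
    Function.Involutive fun S => if P S then flipQubit t S else S := by
  intro S
  by_cases h : P S
  · simp [h, hP, flipQubit_involutive t S]
  · simp [h]

theorem control_flip {α : Type} [DecidableEq α] (c t : α) (S : Finset α) :
    (c ≠ t ∧ c ∈ flipQubit t S) ↔ (c ≠ t ∧ c ∈ S) := by
  rw [mem_flipQubit]
  by_cases h : c = t <;> simp [h]

theorem control_control_flip {α : Type} [DecidableEq α] (c d t : α) (S : Finset α) :
    (c ≠ t ∧ d ≠ t ∧ c ∈ flipQubit t S ∧ d ∈ flipQubit t S) ↔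
      (c ≠ t ∧ d ≠ t ∧ c ∈ S ∧ d ∈ S) := by
  rw [mem_flipQubit, mem_flipQubit]
  by_cases h : c = t <;> by_cases h' : d = t <;> simp [h, h']

theorem Gate.apply_CX_eq {α : Type} [DecidableEq α] (c t : α) (ψ : QState α) :
    (Gate.CX c t).apply ψ = fun S => ψ (if c ≠ t ∧ c ∈ S then flipQubit t S else S) := by
  funext S
  rw [apply_ite ψ]; rfl

theorem Gate.apply_CCX_eq {α : Type} [DecidableEq α] (c d t : α) (ψ : QState α) :
    (Gate.CCX c d t).apply ψ = fun S =>
      ψ (if c ≠ t ∧ d ≠ t ∧ c ∈ S ∧ d ∈ S then flipQubit t S else S) := by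
  funext S
  rw [apply_ite ψ]; rfl

theorem norm_exp_quarter : ‖Complex.exp (Complex.I * Real.pi / 4)‖ = 1 := by
  rw [Complex.norm_exp]; simp [Complex.mul_re]

theorem norm_exp_neg_quarter : ‖Complex.exp (-(Complex.I * Real.pi / 4))‖ = 1 := by
  rw [Complex.norm_exp]; simp [Complex.mul_re]

theorem Gate.weight_apply {α : Type} [DecidableEq α] (g : Gate α) (ψ : QState α) :
    weight (g.apply ψ) = weight ψ := by
  cases g with
  | X t => exact weight_comp ψ (flipQubit_involutive t)
  | H t =>
    rw [weight, weight, tsum_pair t, tsum_pair t fun S => ‖ψ S‖ₑ ^ 2]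
    refine tsum_congr fun S => ?_
    split_ifs with h
    · rfl
    · rw [Gate.apply_H_notMem h, Gate.apply_H_insert h, enorm_sq_hadamard]
  | T t =>
    refine tsum_congr fun S => ?_
    simp only [Gate.apply]
    split_ifs
    · rw [enorm_mul, ← ofReal_norm (Complex.exp _), norm_exp_quarter]; simp
    · rfl
  | Tinv t =>
    refine tsum_congr fun S => ?_
    simp only [Gate.apply]
    split_ifs
    · rw [enorm_mul, ← ofReal_norm (Complex.exp _), norm_exp_neg_quarter]; simp
    · rfl
  | CX c t =>
    rw [Gate.apply_CX_eq]
    exact weight_comp ψ (involutive_flip_if t _ (control_flip c t))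
  | CCX c d t =>
    rw [Gate.apply_CCX_eq]
    exact weight_comp ψ (involutive_flip_if t _ (control_control_flip c d t))

/-- The unitary of a gate as a linear map. -/
def Gate.lin {α : Type} [DecidableEq α] (g : Gate α) : QState α →ₗ[ℂ] QState α where
  toFun := g.apply
  map_add' φ ψ := by
    funext S
    cases g <;> simp only [Gate.apply, Pi.add_apply] <;> split_ifs <;> ring
  map_smul' c ψ := by
    funext S
    cases g <;> simp only [Gate.apply, Pi.smul_apply, smul_eq_mul, RingHom.id_apply] <;>
      split_ifs <;> ring

/-! ### The oracle as a permutation of basis states -/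

theorem mem_block {q p : Qubit} {len : ℕ} :
    p ∈ block q len ↔ ∃ i < len, p = (q.1, q.2 + i) := by
  simp [block, eq_comm]

theorem mem_blockSupport {q p : Qubit} {len : ℕ} {v : Bits len} :
    p ∈ blockSupport q v ↔ ∃ i : Fin len, v i = true ∧ p = (q.1, q.2 + i.val) := by
  simp only [blockSupport, Finset.mem_image, Finset.mem_filter, Finset.mem_univ, true_and,
    @eq_comm _ p]

theorem blockSupport_subset_block (q : Qubit) {len : ℕ} (v : Bits len) :
    blockSupport q v ⊆ block q len := by
  intro p hp
  obtain ⟨i, -, rfl⟩ := mem_blockSupport.1 hp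
  exact mem_block.2 ⟨i, i.2, rfl⟩

theorem readBlock_symmDiff {S A : Finset Qubit} {q : Qubit} {len : ℕ}
    (h : Disjoint A (block q len)) : readBlock (symmDiff S A) q len = readBlock S q len := by
  funext i
  have : ((q.1, q.2 + i.val) : Qubit) ∉ A := fun hA =>
    Finset.disjoint_left.1 h hA (mem_block.2 ⟨i, i.2, rfl⟩)
  simp [readBlock, Finset.mem_symmDiff, this]

/-- The permutation of the basis states performed by the oracle. -/
def oraclePerm {k n : ℕ} (O : Bits k → Bits n → Bits n) (qL qx qy : Qubit) (S : Finset Qubit) :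
    Finset Qubit :=
  symmDiff S (blockSupport qy (O (readBlock S qL k) (readBlock S qx n)))

/-- The target block is disjoint from the blocks that are read, so the second application reads the
same mask and plaintext and adds the same block again. -/
theorem oraclePerm_involutive {k n : ℕ} (O : Bits k → Bits n → Bits n) {qL qx qy : Qubit}
    (h : Disjoint (block qy n) (block qL k ∪ block qx n)) :
    Function.Involutive (oraclePerm O qL qx qy) := by
  intro S
  rw [Finset.disjoint_union_right] at h
  have hd := fun v : Bits n => blockSupport_subset_block qy v
  simp only [oraclePerm]
  rw [readBlock_symmDiff (h.1.mono_left (hd _)), readBlock_symmDiff (h.2.mono_left (hd _)),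
    symmDiff_assoc, symmDiff_self, symmDiff_bot]

theorem applyOracle_eq {k n : ℕ} (O : Bits k → Bits n → Bits n) {qL qx qy : Qubit}
    (h : Disjoint (block qy n) (block qL k ∪ block qx n)) (ψ : QState Qubit) :
    applyOracle O qL qx qy ψ = fun S => ψ (oraclePerm O qL qx qy S) := by
  rw [applyOracle, if_pos h]; rfl

theorem applyOracle_ket {k n : ℕ} (O : Bits k → Bits n → Bits n) {qL qx qy : Qubit}
    (h : Disjoint (block qy n) (block qL k ∪ block qx n)) (S : Finset Qubit) :
    applyOracle O qL qx qy (ket S) = ket (oraclePerm O qL qx qy S) := by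
  rw [applyOracle_eq O h]
  funext S'
  simp only [ket, (oraclePerm_involutive O h).eq_iff]

theorem applyOracle_applyOracle {k n : ℕ} (O : Bits k → Bits n → Bits n) (qL qx qy : Qubit)
    (ψ : QState Qubit) : applyOracle O qL qx qy (applyOracle O qL qx qy ψ) = ψ := by
  by_cases h : Disjoint (block qy n) (block qL k ∪ block qx n)
  · rw [applyOracle_eq O h, applyOracle_eq O h]
    funext S
    exact congrArg ψ (oraclePerm_involutive O h S)
  · rw [applyOracle, if_neg h, applyOracle, if_neg h]

theorem weight_applyOracle {k n : ℕ} (O : Bits k → Bits n → Bits n) (qL qx qy : Qubit)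
    (ψ : QState Qubit) : weight (applyOracle O qL qx qy ψ) = weight ψ := by
  by_cases h : Disjoint (block qy n) (block qL k ∪ block qx n)
  · rw [applyOracle_eq O h]
    exact weight_comp ψ (oraclePerm_involutive O h)
  · rw [applyOracle, if_neg h]

/-- The unitary operations of the machine on concrete qubits. -/
inductive Op : Type
  | gate (g : Gate Qubit)
  | query (qL qx qy : Qubit)

/-- A unitary operation as a linear map. -/
def Op.lin {k n : ℕ} (O : Bits k → Bits n → Bits n) : Op → QState Qubit →ₗ[ℂ] QState Qubit
  | gate g => g.lin
  | query qL qx qy =>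
    { toFun := applyOracle O qL qx qy
      map_add' := fun φ ψ => by
        funext S
        simp only [applyOracle]
        split_ifs <;> simp
      map_smul' := fun c ψ => by
        funext S
        simp only [applyOracle]
        split_ifs <;> simp }

theorem Op.weight_lin {k n : ℕ} (O : Bits k → Bits n → Bits n) (o : Op) (ψ : QState Qubit) :
    weight (o.lin O ψ) = weight ψ := by
  cases o with
  | gate g => exact g.weight_apply ψ
  | query qL qx qy => exact weight_applyOracle O qL qx qy ψ

/-- Apply a list of operations, the head first. -/
def runOps {k n : ℕ} (O : Bits k → Bits n → Bits n) : List Op → QState Qubit →ₗ[ℂ] QState Qubit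
  | [] => LinearMap.id
  | o :: os => (runOps O os).comp (o.lin O)

theorem runOps_nil {k n : ℕ} (O : Bits k → Bits n → Bits n) (ψ : QState Qubit) :
    runOps O [] ψ = ψ := rfl

theorem runOps_cons {k n : ℕ} (O : Bits k → Bits n → Bits n) (o : Op) (os : List Op)
    (ψ : QState Qubit) : runOps O (o :: os) ψ = runOps O os (o.lin O ψ) := rfl

theorem runOps_append {k n : ℕ} (O : Bits k → Bits n → Bits n) (l₁ l₂ : List Op)
    (ψ : QState Qubit) : runOps O (l₁ ++ l₂) ψ = runOps O l₂ (runOps O l₁ ψ) := by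
  induction l₁ generalizing ψ with
  | nil => rfl
  | cons o os ih => exact ih _

theorem weight_runOps {k n : ℕ} (O : Bits k → Bits n → Bits n) (l : List Op) (ψ : QState Qubit) :
    weight (runOps O l ψ) = weight ψ := by
  induction l generalizing ψ with
  | nil => rfl
  | cons o os ih => rw [runOps_cons, ih, Op.weight_lin]

theorem weight_project (q : Qubit) (ψ : QState Qubit) :
    weight (project q false ψ) + weight (project q true ψ) = weight ψ := by
  rw [weight, weight, weight, ← ENNReal.tsum_add]
  refine tsum_congr fun S => ?_
  by_cases h : q ∈ S <;> simp [project, h]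

/-! ## Truncated expected cost -/

open Classical in
/-- The expected number of steps within the first `N` steps, plus an infinite penalty for halting
with an output other than `s`. -/
def penalizedTime {k n : ℕ} (O : Bits k → Bits n → Bits n) (s : Bits k) : ℕ → Config → ℝ≥0∞
  | 0, _ => 0
  | N + 1, c =>
    if c.todo = [] then (if c.HaltedWith s then 0 else ⊤ * weight c.state)
    else weight c.state + ((step O c).map (penalizedTime O s N)).sum

section
variable {k n : ℕ} {O : Bits k → Bits n → Bits n} {s : Bits k}

theorem penalizedTime_of_haltedWith {N : ℕ} {c : Config} (h : c.HaltedWith s) :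
    penalizedTime O s N c = 0 := by
  cases N with
  | zero => rfl
  | succ N => rw [penalizedTime, if_pos (show c.todo = [] from h.1), if_pos h]

theorem penalizedTime_succ {N : ℕ} {c : Config} (h : c.todo ≠ []) :
    penalizedTime O s (N + 1) c =
      weight c.state + ((step O c).map (penalizedTime O s N)).sum := by
  rw [penalizedTime, if_neg h]

/-- Monotonicity in the truncation allows the same `N` before and after a step. Program parts then
compose without tracking how many steps remain. -/
theorem penalizedTime_le_succ (N : ℕ) (c : Config) :
    penalizedTime O s N c ≤ penalizedTime O s (N + 1) c := by
  induction N generalizing c with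
  | zero => exact zero_le
  | succ N ih =>
    by_cases h : c.todo = []
    · rw [penalizedTime, penalizedTime, if_pos h, if_pos h]
    · rw [penalizedTime_succ h, penalizedTime_succ h]
      gcongr
      exact List.sum_le_sum fun d _ => ih d

/-- A step with a single successor. -/
theorem penalizedTime_le_of_step {c d : Config} (h : c.todo ≠ []) (hs : step O c = [d]) (N : ℕ) :
    penalizedTime O s N c ≤ weight c.state + penalizedTime O s N d := by
  cases N with
  | zero => exact zero_le
  | succ N =>
    rw [penalizedTime_succ h, hs]
    simp only [List.map_cons, List.map_nil, List.sum_cons, List.sum_nil, add_zero]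
    gcongr
    exact penalizedTime_le_succ N d

/-- A step with two successors. -/
theorem penalizedTime_le_of_step_pair {c d d' : Config} (h : c.todo ≠ [])
    (hs : step O c = [d, d']) (N : ℕ) :
    penalizedTime O s N c ≤
      weight c.state + (penalizedTime O s N d + penalizedTime O s N d') := by
  cases N with
  | zero => exact zero_le
  | succ N =>
    rw [penalizedTime_succ h, hs]
    simp only [List.map_cons, List.map_nil, List.sum_cons, List.sum_nil, add_zero]
    gcongr
    · exact penalizedTime_le_succ N d
    · exact penalizedTime_le_succ N d'

theorem step_of_halted {c : Config} (h : c.todo = []) : step O c = [c] := by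
  obtain ⟨todo, mem, ψ⟩ := c
  subst h
  rfl

theorem weight_step (c : Config) : ((step O c).map fun d => weight d.state).sum = weight c.state := by
  obtain ⟨todo, mem, ψ⟩ := c
  cases todo with
  | nil => simp [step]
  | cons c cs =>
    cases c <;> simp [step, Gate.weight_apply, weight_applyOracle, weight_project]

theorem project_zero (q : Qubit) (v : Bool) : project q v 0 = 0 := by
  funext S; simp [project]

theorem step_zero {c : Config} (hc : c.state = 0) : ∀ d ∈ step O c, d.state = 0 := by
  obtain ⟨todo, mem, ψ⟩ := c
  obtain rfl : ψ = 0 := hc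
  cases todo with
  | nil => simp [step]
  | cons c cs =>
    cases c with
    | gate g =>
      simp only [step, List.mem_singleton, forall_eq]
      exact (g.map (QAddr.eval mem)).lin.map_zero
    | query L x y =>
      simp only [step, List.mem_singleton, forall_eq]
      exact ((Op.query (L.eval mem) (x.eval mem) (y.eval mem)).lin O).map_zero
    | measure q b i => simp [step, project_zero]
    | _ => simp [step]

/-- A measurement always lists both outcomes, so branches of probability zero stay in the tree. They
cost nothing even when their output is wrong, since `⊤ * 0 = 0`. -/
theorem penalizedTime_zero_state (N : ℕ) {c : Config} (hc : c.state = 0) :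
    penalizedTime O s N c = 0 := by
  induction N generalizing c with
  | zero => rfl
  | succ N ih =>
    rw [penalizedTime, hc, weight_zero]
    split_ifs
    · rfl
    · simp
    · rw [zero_add]
      refine List.sum_eq_zero fun x hx => ?_
      obtain ⟨d, hd, rfl⟩ := List.mem_map.1 hx
      exact ih (step_zero hc d hd)

/-! ## Relation to the running time and the output -/

theorem probAfter_succ (c : Config) (t : ℕ) (P : Config → Prop) :
    probAfter O c (t + 1) P = ((step O c).map fun d => probAfter O d t P).sum := by
  simp only [probAfter, after]
  induction step O c with
  | nil => rfl
  | cons d l ih => simp [ih]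

theorem probAfter_of_halted {c : Config} (h : c.todo = []) (t : ℕ) (P : Config → Prop) :
    probAfter O c t P = probAfter O c 0 P := by
  induction t with
  | zero => rfl
  | succ t ih => rw [probAfter_succ, step_of_halted h]; simpa using ih

/-- Before halting, the term `t = 0` is the weight charged for the current step and the remaining
terms belong to the successors; after halting all terms vanish. -/
theorem sum_probAfter_le (N : ℕ) (c : Config) :
    ∑ t ∈ Finset.range N, probAfter O c t (fun d => ¬ d.Halted) ≤ penalizedTime O s N c := by
  induction N generalizing c with
  | zero => simp
  | succ N ih =>
    by_cases h : c.todo = []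
    · rw [Finset.sum_eq_zero]
      · exact zero_le
      · intro t _
        rw [probAfter_of_halted h]
        simp [probAfter, after, Config.Halted, h]
    · rw [penalizedTime_succ h, Finset.sum_range_succ', add_comm]
      gcongr
      · simp [probAfter, after, Config.Halted, h]
      · simp only [probAfter_succ]
        induction step O c with
        | nil => simp
        | cons d l ihl =>
          simp only [List.map_cons, List.sum_cons, Finset.sum_add_distrib]
          gcongr
          exact ih d

theorem expectedTime_le {c : Config} {B : ℝ≥0∞} (h : ∀ N, penalizedTime O s N c ≤ B) :
    expectedTime O c ≤ B :=
  ENNReal.tsum_le_of_sum_range_le fun N => (sum_probAfter_le N c).trans (h N)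

/-- The truncation has to be `t + 1`: at truncation `0` nothing is charged, so a halted
configuration is penalized only if one further step is allowed. -/
theorem top_mul_probAfter_le (t : ℕ) (c : Config) :
    ⊤ * probAfter O c t (fun d => d.Halted ∧ ¬ d.HaltedWith s) ≤
      penalizedTime O s (t + 1) c := by
  have halted : ∀ (c : Config) (t : ℕ), c.todo = [] →
      ⊤ * probAfter O c t (fun d => d.Halted ∧ ¬ d.HaltedWith s) ≤
        penalizedTime O s (t + 1) c := by
    intro c t h
    rw [probAfter_of_halted h, penalizedTime, if_pos h]
    by_cases hs : c.HaltedWith s <;> simp [probAfter, after, Config.Halted, h, hs]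
  induction t generalizing c with
  | zero =>
    by_cases h : c.todo = []
    · exact halted c 0 h
    · simp [probAfter, after, Config.Halted, h]
  | succ t ih =>
    by_cases h : c.todo = []
    · exact halted c _ h
    · rw [penalizedTime_succ h, probAfter_succ]
      refine le_trans ?_ le_add_self
      induction step O c with
      | nil => simp
      | cons d l ihl =>
        simp only [List.map_cons, List.sum_cons, mul_add]
        exact add_le_add (ih d) ihl

theorem probAfter_true (t : ℕ) (c : Config) :
    probAfter O c t (fun _ => True) = weight c.state := by
  induction t generalizing c with
  | zero => simp [probAfter, after]
  | succ t ih => simp only [probAfter_succ, ih, weight_step]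

theorem probAfter_split (t : ℕ) (c : Config) :
    probAfter O c t (Config.HaltedWith s) + probAfter O c t (fun d => ¬ d.Halted) +
      probAfter O c t (fun d => d.Halted ∧ ¬ d.HaltedWith s) = weight c.state := by
  rw [← probAfter_true t c]
  simp only [probAfter]
  induction after O t c with
  | nil => simp
  | cons d l ih =>
    simp only [List.map_cons, List.sum_cons] at ih ⊢
    rw [← ih]
    have : ∀ d : Config, d.HaltedWith s → d.Halted := fun d h => h.1
    by_cases h1 : d.Halted <;> by_cases h2 : d.HaltedWith s
    · simp [h1, h2]; ring
    · simp [h1, h2]; ring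
    · exact absurd (this d h2) h1
    · simp [h1, h2]; ring

/-- A finite bound leaves no room for the infinite penalty, so a wrong output has probability zero
at every time. The probabilities of not having halted have a finite sum and therefore tend to zero;
the remaining probability belongs to the output `s`. -/
theorem probOutput_eq_one {c : Config} (hc : weight c.state = 1) {B : ℝ≥0∞} (hB : B ≠ ⊤)
    (h : ∀ N, penalizedTime O s N c ≤ B) : probOutput O c s = 1 := by
  have wrong : ∀ t, probAfter O c t (fun d => d.Halted ∧ ¬ d.HaltedWith s) = 0 := by
    intro t
    by_contra hne
    have := (top_mul_probAfter_le (s := s) t c).trans (h _)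
    rw [ENNReal.top_mul hne] at this
    exact hB (top_le_iff.1 this)
  have split : ∀ t, probAfter O c t (Config.HaltedWith s) +
      probAfter O c t (fun d => ¬ d.Halted) = 1 := by
    intro t
    have := probAfter_split (O := O) (s := s) t c
    rwa [wrong, add_zero, hc] at this
  refine le_antisymm (iSup_le fun t => ?_) ?_
  · rw [← split t]; exact le_self_add
  · have ht : Filter.Tendsto (fun t => probAfter O c t fun d => ¬ d.Halted) Filter.atTop
        (nhds 0) := by
      apply ENNReal.tendsto_atTop_zero_of_tsum_ne_top
      exact ((expectedTime_le h).trans_lt hB.lt_top).ne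
    have : Filter.Tendsto (fun t => probOutput O c s + probAfter O c t fun d => ¬ d.Halted)
        Filter.atTop (nhds (probOutput O c s + 0)) := tendsto_const_nhds.add ht
    rw [add_zero] at this
    refine ge_of_tendsto' this fun t => ?_
    rw [← split t]
    gcongr
    exact le_iSup (fun t => probAfter O c t (Config.HaltedWith s)) t

end

/-! ## Deterministic program parts -/

/-- Started with the memory `mem`, the command `c` performs the operations `ops` and terminates
after at most `T` steps with a memory that satisfies `Q`. -/
def Runs {k n : ℕ} (O : Bits k → Bits n → Bits n) (c : Cmd) (mem : Mem) (ops : List Op) (T : ℕ)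
    (Q : Mem → Prop) : Prop :=
  ∃ mem', Q mem' ∧ ∀ (s : Bits k) (N : ℕ) (cs : List Cmd) (ψ : QState Qubit),
    penalizedTime O s N ⟨c :: cs, mem, ψ⟩ ≤
      T * weight ψ + penalizedTime O s N ⟨cs, mem', runOps O ops ψ⟩

section
variable {k n : ℕ} {O : Bits k → Bits n → Bits n} {mem : Mem} {Q : Mem → Prop}

theorem Runs.mono {c : Cmd} {ops : List Op} {T T' : ℕ} {Q' : Mem → Prop}
    (h : Runs O c mem ops T Q) (hT : T ≤ T') (hQ : ∀ m, Q m → Q' m) :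
    Runs O c mem ops T' Q' := by
  obtain ⟨m, hm, h⟩ := h
  refine ⟨m, hQ m hm, fun s N cs ψ => (h s N cs ψ).trans ?_⟩
  gcongr

theorem Runs.assign {b : ℕ} {i e : Expr} (h : Q (mem.set b (i.eval mem) (e.eval mem))) :
    Runs O (.assign b i e) mem [] 1 Q :=
  ⟨_, h, fun s N cs ψ => by
    simpa [runOps_nil] using
      penalizedTime_le_of_step (s := s) (c := ⟨.assign b i e :: cs, mem, ψ⟩) (by simp) rfl N⟩

theorem Runs.gate {g : Gate QAddr} (h : Q mem) :
    Runs O (.gate g) mem [.gate (g.map (QAddr.eval mem))] 1 Q :=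
  ⟨_, h, fun s N cs ψ => by
    rw [Nat.cast_one, one_mul]
    exact penalizedTime_le_of_step (s := s) (c := ⟨.gate g :: cs, mem, ψ⟩) (by simp) rfl N⟩

theorem Runs.query {L x y : QAddr} (h : Q mem) :
    Runs O (.query L x y) mem [.query (L.eval mem) (x.eval mem) (y.eval mem)] 1 Q :=
  ⟨_, h, fun s N cs ψ => by
    rw [Nat.cast_one, one_mul]
    exact penalizedTime_le_of_step (s := s) (c := ⟨.query L x y :: cs, mem, ψ⟩) (by simp) rfl N⟩

theorem Runs.seq {c d : Cmd} {o₁ o₂ : List Op} {T₁ T₂ : ℕ}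
    (h : Runs O c mem o₁ T₁ fun m => Runs O d m o₂ T₂ Q) :
    Runs O (.seq c d) mem (o₁ ++ o₂) (T₁ + T₂ + 1) Q := by
  obtain ⟨m₁, ⟨m₂, hQ, h₂⟩, h₁⟩ := h
  refine ⟨m₂, hQ, fun s N cs ψ => ?_⟩
  refine (penalizedTime_le_of_step (s := s) (c := ⟨.seq c d :: cs, mem, ψ⟩) (by simp) rfl N).trans
    ?_
  refine (add_le_add_right ((h₁ s N _ ψ).trans (add_le_add_right (h₂ s N _ _) _)) _).trans ?_
  -- The first part preserves the norm, so the time of the second part is charged at the initial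
  -- weight as well.
  rw [weight_runOps, runOps_append]
  push_cast
  apply le_of_eq
  ring

theorem Runs.ite {e : Expr} {c d : Cmd} {ops : List Op} {T : ℕ}
    (h : Runs O (if e.eval mem ≠ 0 then c else d) mem ops T Q) :
    Runs O (.ite e c d) mem ops (T + 1) Q := by
  obtain ⟨m, hQ, h⟩ := h
  refine ⟨m, hQ, fun s N cs ψ => ?_⟩
  refine (penalizedTime_le_of_step (s := s) (c := ⟨.ite e c d :: cs, mem, ψ⟩) (by simp) rfl
    N).trans ?_
  refine (add_le_add_right (h s N _ ψ) _).trans ?_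
  push_cast
  apply le_of_eq
  ring

theorem Runs.loop_exit {e : Expr} {c : Cmd} (he : e.eval mem = 0) (h : Q mem) :
    Runs O (.loop e c) mem [] 1 Q :=
  ⟨_, h, fun s N cs ψ => by
    simpa [runOps_nil] using
      penalizedTime_le_of_step (s := s) (c := ⟨.loop e c :: cs, mem, ψ⟩) (d := ⟨cs, mem, ψ⟩)
        (by simp) (by simp [step, he]) N⟩

theorem Runs.loop_next {e : Expr} {c : Cmd} {o₁ o₂ : List Op} {T₁ T₂ : ℕ} (he : e.eval mem ≠ 0)
    (h : Runs O c mem o₁ T₁ fun m => Runs O (.loop e c) m o₂ T₂ Q) :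
    Runs O (.loop e c) mem (o₁ ++ o₂) (T₁ + T₂ + 1) Q := by
  obtain ⟨m₁, ⟨m₂, hQ, h₂⟩, h₁⟩ := h
  refine ⟨m₂, hQ, fun s N cs ψ => ?_⟩
  refine (penalizedTime_le_of_step (s := s) (c := ⟨.loop e c :: cs, mem, ψ⟩)
    (d := ⟨c :: .loop e c :: cs, mem, ψ⟩) (by simp) (by simp [step, he]) N).trans ?_
  refine (add_le_add_right ((h₁ s N _ ψ).trans (add_le_add_right (h₂ s N _ _) _)) _).trans ?_
  rw [weight_runOps, runOps_append]
  push_cast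
  apply le_of_eq
  ring

end

/-- Cell `0` of an array, used as a variable. -/
def var (v : ℕ) : Expr := .get v (.lit 0)

/-- Execute `c` with the variable `v` running from `0` to the value of `len`. -/
def countLoop (v : ℕ) (len : Expr) (c : Cmd) : Cmd :=
  .loop (.sub len (var v)) (.seq c (.assign v (.lit 0) (.add (var v) (.lit 1))))

/-- Execute `c` with the variable `v` running from `0` to the value of `len`. -/
def forLoop (v : ℕ) (len : Expr) (c : Cmd) : Cmd :=
  .seq (.assign v (.lit 0) (.lit 0)) (countLoop v len c)

/-- Assign a value to a variable. -/
def setVar (v : ℕ) (e : Expr) : Cmd := .assign v (.lit 0) e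

/-- Do nothing. -/
def skip : Cmd := setVar 20 (.lit 0)

/-! ### Updates of the classical memory -/

theorem Mem.set_same (mem : Mem) (b i v : ℕ) : mem.set b i v b i = v := by simp [Mem.set]

theorem Mem.set_array_ne (mem : Mem) {b b' : ℕ} (i v : ℕ) (h : b' ≠ b) :
    mem.set b i v b' = mem b' := by
  funext j; simp [Mem.set, h]

theorem Mem.set_index_ne (mem : Mem) {b i j : ℕ} (v : ℕ) (h : j ≠ i) :
    mem.set b i v b j = mem b j := by
  simp [Mem.set, h]

/-- Two memories that agree outside of the arrays in `A`. -/
def Agree (A : List ℕ) (m m' : Mem) : Prop := ∀ b, b ∉ A → m b = m' b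

theorem Agree.refl (A : List ℕ) (m : Mem) : Agree A m m := fun _ _ => rfl

theorem Agree.trans {A : List ℕ} {m m' m'' : Mem} (h : Agree A m m') (h' : Agree A m' m'') :
    Agree A m m'' := fun b hb => (h b hb).trans (h' b hb)

theorem Agree.mono {A B : List ℕ} {m m' : Mem} (h : Agree A m m') (hAB : A ⊆ B) :
    Agree B m m' := fun b hb => h b fun hA => hb (hAB hA)

theorem Agree.set {A : List ℕ} {m m' : Mem} (h : Agree A m m') {b i v : ℕ} (hb : b ∈ A) :
    Agree A (m.set b i v) m' := fun b' hb' => by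
  have hne : b' ≠ b := fun e => hb' (e ▸ hb)
  rw [Mem.set_array_ne m i v hne, h b' hb']

section
variable {k n : ℕ} {O : Bits k → Bits n → Bits n} {mem : Mem}

theorem Runs.skip {Q : Mem → Prop} (h : Q (mem.set 20 0 0)) : Runs O skip mem [] 1 Q :=
  Runs.assign h

/-- An iteration costs the body plus three steps: the loop test, the unfolding of the sequence and
the increment. The final `+ 1` is the failing test. The body has to leave the counter alone and to
establish the invariant as it will hold after the increment. -/
theorem Runs.countLoop {v : ℕ} {len : Expr} {c : Cmd} (I : ℕ → Mem → Prop) (ops : ℕ → List Op)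
    (l T : ℕ) (hlen : ∀ i ≤ l, ∀ m, I i m → len.eval m = l)
    (hc : ∀ i < l, ∀ m, I i m → m v 0 = i →
      Runs O c m (ops i) T fun m' => m' v 0 = i ∧ I (i + 1) (m'.set v 0 (i + 1)))
    (j i : ℕ) (hij : i + j = l) (h0 : I i mem) (hv : mem v 0 = i) :
    Runs O (countLoop v len c) mem ((List.range' i j).flatMap ops) (j * (T + 3) + 1)
      fun m => I l m ∧ m v 0 = l := by
  induction j generalizing i mem with
  | zero =>
    obtain rfl : i = l := by omega
    refine (Runs.loop_exit ?_ ⟨h0, hv⟩).mono (by omega) fun _ h => h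
    simp [Expr.eval, hlen i le_rfl mem h0, hv, var]
  | succ j ih =>
    have hne : (Expr.sub len (var v)).eval mem ≠ 0 := by
      simp only [Expr.eval, hlen i (by omega) mem h0, hv, var]; omega
    rw [List.range'_succ, List.flatMap_cons]
    have body := (hc i (by omega) mem h0 hv)
    have := Runs.loop_next (O := O) (mem := mem) (o₁ := ops i)
      (o₂ := (List.range' (i + 1) j).flatMap ops) (T₁ := T + 2) (T₂ := j * (T + 3) + 1)
      (Q := fun m => I l m ∧ m v 0 = l) (c := .seq c (.assign v (.lit 0) (.add (var v) (.lit 1))))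
      hne ?_
    · refine this.mono ?_ fun _ h => h
      rw [Nat.succ_mul]; omega
    · rw [← List.append_nil (ops i)]
      refine (Runs.seq (T₁ := T) (T₂ := 1) (body.mono le_rfl fun m' hm' => ?_)).mono (by omega)
        fun _ h => h
      refine Runs.assign ?_
      have e : (Expr.add (var v) (.lit 1)).eval m' = i + 1 := by
        simp [Expr.eval, var, hm'.1]
      rw [e]
      exact ih (i + 1) (by omega) hm'.2 (Mem.set_same _ _ _ _)

/-- The invariant rule for counting loops. -/
theorem Runs.forLoop {v : ℕ} {len : Expr} {c : Cmd} (I : ℕ → Mem → Prop) (ops : ℕ → List Op)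
    (l T : ℕ) (h0 : I 0 (mem.set v 0 0)) (hlen : ∀ i ≤ l, ∀ m, I i m → len.eval m = l)
    (hc : ∀ i < l, ∀ m, I i m → m v 0 = i →
      Runs O c m (ops i) T fun m' => m' v 0 = i ∧ I (i + 1) (m'.set v 0 (i + 1))) :
    Runs O (forLoop v len c) mem ((List.range l).flatMap ops) (l * (T + 3) + 3)
      fun m => I l m := by
  rw [← List.nil_append ((List.range l).flatMap ops), List.range_eq_range']
  refine (Runs.seq (T₁ := 1) (T₂ := l * (T + 3) + 1) (Runs.assign ?_)).mono (by omega)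
    fun _ h => h
  refine (Runs.countLoop I ops l T hlen hc l 0 (by omega) h0 (Mem.set_same _ _ _ _)).mono le_rfl
    fun _ h => h.1

end

/-! ## Inverse circuits -/

/-- The inverse gate. -/
def Gate.inv {α : Type} : Gate α → Gate α
  | T t => Tinv t
  | Tinv t => T t
  | g => g

theorem Gate.inv_apply_apply {α : Type} [DecidableEq α] (g : Gate α) (ψ : QState α) :
    g.inv.apply (g.apply ψ) = ψ := by
  funext S
  cases g with
  | X t => exact congrArg ψ (flipQubit_involutive t S)
  | H t =>
    have h2 : (Real.sqrt 2 : ℂ) * (Real.sqrt 2 : ℂ) = 2 := by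
      rw [← Complex.ofReal_mul, Real.mul_self_sqrt (by norm_num)]; norm_num
    have h0 : (Real.sqrt 2 : ℂ) ≠ 0 := by
      intro h; rw [h] at h2; norm_num at h2
    simp only [Gate.inv]
    by_cases h : t ∈ S
    · obtain ⟨S', hS', rfl⟩ : ∃ S', t ∉ S' ∧ insert t S' = S :=
        ⟨S.erase t, Finset.notMem_erase t S, Finset.insert_erase h⟩
      rw [Gate.apply_H_insert hS', Gate.apply_H_insert hS', Gate.apply_H_notMem hS']
      field_simp
      rw [pow_two, h2]; ring
    · rw [Gate.apply_H_notMem h, Gate.apply_H_insert h, Gate.apply_H_notMem h]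
      field_simp
      rw [pow_two, h2]; ring
  | T t =>
    simp only [Gate.inv, Gate.apply]
    split_ifs
    · rw [← mul_assoc, ← Complex.exp_add]; simp
    · rfl
  | Tinv t =>
    simp only [Gate.inv, Gate.apply]
    split_ifs
    · rw [← mul_assoc, ← Complex.exp_add]; simp
    · rfl
  | CX c t =>
    simp only [Gate.inv]
    rw [Gate.apply_CX_eq, Gate.apply_CX_eq]
    exact congrArg ψ (involutive_flip_if t (fun S => c ≠ t ∧ c ∈ S) (control_flip c t) S)
  | CCX c d t =>
    simp only [Gate.inv]
    rw [Gate.apply_CCX_eq, Gate.apply_CCX_eq]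
    exact congrArg ψ (involutive_flip_if t (fun S => c ≠ t ∧ d ≠ t ∧ c ∈ S ∧ d ∈ S)
      (control_control_flip c d t) S)

theorem applyGates_append {α : Type} [DecidableEq α] (l₁ l₂ : List (Gate α)) (ψ : QState α) :
    applyGates (l₁ ++ l₂) ψ = applyGates l₂ (applyGates l₁ ψ) := by
  simp [applyGates]

theorem applyGates_inverse {α : Type} [DecidableEq α] (l : List (Gate α)) (ψ : QState α) :
    applyGates (l.reverse.map Gate.inv) (applyGates l ψ) = ψ := by
  induction l generalizing ψ with
  | nil => rfl
  | cons g l ih =>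
    rw [List.reverse_cons, List.map_append, applyGates_append]
    have : applyGates (g :: l) ψ = applyGates l (g.apply ψ) := rfl
    rw [this, ih]
    exact g.inv_apply_apply ψ

/-! ## Embedding a group of qubits into a larger memory -/

section
variable {α β : Type} [DecidableEq α] [DecidableEq β] (ι : β ↪ α)

/-- The qubits of `S` that come from `ι`. -/
def pull (S : Finset α) : Finset β := S.preimage ι ι.injective.injOn

/-- `S` and `Z` have the same elements outside of the range of `ι`. -/
def SameOutside (S Z : Finset α) : Prop := ∀ q, q ∉ Set.range ι → (q ∈ S ↔ q ∈ Z)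

open Classical in
/-- The state that is `φ` on the qubits in the range of `ι`, and the basis state `Z` elsewhere. -/
def embState (Z : Finset α) (φ : QState β) : QState α := fun S =>
  if SameOutside ι S Z then φ (pull ι S) else 0

variable {ι}

theorem mem_pull {S : Finset α} {t : β} : t ∈ pull ι S ↔ ι t ∈ S := Finset.mem_preimage

theorem pull_flip (t : β) (S : Finset α) : pull ι (flipQubit (ι t) S) = flipQubit t (pull ι S) := by
  ext q
  simp [mem_pull, mem_flipQubit]

theorem pull_insert (t : β) (S : Finset α) : pull ι (insert (ι t) S) = insert t (pull ι S) := by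
  ext q; simp [mem_pull]

theorem pull_erase (t : β) (S : Finset α) : pull ι (S.erase (ι t)) = (pull ι S).erase t := by
  ext q; simp [mem_pull]

theorem pull_flip_outside {q : α} (hq : q ∉ Set.range ι) (S : Finset α) :
    pull ι (flipQubit q S) = pull ι S := by
  ext t
  have : ι t ≠ q := fun h => hq ⟨t, h⟩
  simp [mem_pull, mem_flipQubit, this]

theorem sameOutside_flip (t : β) (S Z : Finset α) :
    SameOutside ι (flipQubit (ι t) S) Z ↔ SameOutside ι S Z := by
  refine forall₂_congr fun q hq => ?_
  have : q ≠ ι t := fun h => hq ⟨t, h.symm⟩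
  simp [mem_flipQubit, this]

theorem sameOutside_insert (t : β) (S Z : Finset α) :
    SameOutside ι (insert (ι t) S) Z ↔ SameOutside ι S Z := by
  refine forall₂_congr fun q hq => ?_
  have : q ≠ ι t := fun h => hq ⟨t, h.symm⟩
  simp [this]

theorem sameOutside_erase (t : β) (S Z : Finset α) :
    SameOutside ι (S.erase (ι t)) Z ↔ SameOutside ι S Z := by
  refine forall₂_congr fun q hq => ?_
  have : q ≠ ι t := fun h => hq ⟨t, h.symm⟩
  simp [this]

theorem sameOutside_flip_flip (q : α) (S Z : Finset α) :
    SameOutside ι (flipQubit q S) Z ↔ SameOutside ι S (flipQubit q Z) := by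
  refine forall₂_congr fun p _ => ?_
  rw [mem_flipQubit, mem_flipQubit]
  split_ifs <;> tauto

theorem embState_pos {S Z : Finset α} (h : SameOutside ι S Z) (φ : QState β) :
    embState ι Z φ S = φ (pull ι S) := if_pos h

theorem embState_neg {S Z : Finset α} (h : ¬ SameOutside ι S Z) (φ : QState β) :
    embState ι Z φ S = 0 := if_neg h

theorem embState_flip_outside {q : α} (hq : q ∉ Set.range ι) (S Z : Finset α) (φ : QState β) :
    embState ι Z φ (flipQubit q S) = embState ι (flipQubit q Z) φ S := by
  by_cases h : SameOutside ι S (flipQubit q Z)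
  · rw [embState_pos h, embState_pos ((sameOutside_flip_flip q S Z).2 h), pull_flip_outside hq]
  · rw [embState_neg h, embState_neg fun h' => h ((sameOutside_flip_flip q S Z).1 h')]

/-- A product of two basis states is a basis state. This is the bridge between the wire picture, in
which the circuit acts, and the basis states of the whole memory, on which the oracle acts. -/
theorem embState_of_iff {Z S' : Finset α} {T : Finset β} (hT : ∀ t, ι t ∈ S' ↔ t ∈ T)
    (hZ : SameOutside ι S' Z) : embState ι Z (ket T) = ket S' := by
  funext S
  simp only [embState, ket]
  by_cases h : S = S'
  · subst h
    have : pull ι S = T := by ext t; rw [mem_pull, hT]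
    simp [this, hZ]
  · rw [if_neg h]
    split_ifs with h1 h2
    · refine absurd ?_ h
      ext q
      by_cases hq : q ∈ Set.range ι
      · obtain ⟨t, rfl⟩ := hq
        rw [← mem_pull, h2, hT]
      · rw [h1 q hq, hZ q hq]
    · rfl
    · rfl

/-- A relabelled gate changes basis states only inside the range of `ι`. It therefore preserves the
condition `SameOutside` and acts on the pulled back set as the original gate does. -/
theorem Gate.map_apply_embState (g : Gate β) (Z : Finset α) (φ : QState β) :
    (g.map ι).apply (embState ι Z φ) = embState ι Z (g.apply φ) := by
  funext S
  by_cases h : SameOutside ι S Z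
  · have hf := fun t => (sameOutside_flip t S Z).2 h
    have hi := fun t => (sameOutside_insert t S Z).2 h
    have he := fun t => (sameOutside_erase t S Z).2 h
    rw [embState_pos h]
    cases g <;>
      simp only [Gate.map, Gate.apply, embState_pos h, embState_pos (hf _), embState_pos (hi _),
        embState_pos (he _), pull_flip, pull_insert, pull_erase, mem_pull, ι.injective.ne_iff]
  · have hf := fun t h' => h ((sameOutside_flip t S Z).1 h')
    have hi := fun t h' => h ((sameOutside_insert t S Z).1 h')
    have he := fun t h' => h ((sameOutside_erase t S Z).1 h')
    rw [embState_neg h]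
    cases g <;>
      simp [Gate.map, Gate.apply, embState_neg h, embState_neg (hf _), embState_neg (hi _),
        embState_neg (he _)]

theorem X_apply_embState_outside {q : α} (hq : q ∉ Set.range ι) (Z : Finset α) (φ : QState β) :
    (Gate.X q).apply (embState ι Z φ) = embState ι (flipQubit q Z) φ :=
  funext fun S => embState_flip_outside hq S Z φ

/-- A Toffoli gate with one control and the target outside of the embedded qubits, when the
control inside has a definite value. -/
theorem CCX_apply_embState {b r : α} {o : β} (hb : b ∉ Set.range ι) (hr : r ∉ Set.range ι)
    (hbr : b ≠ r) (Z : Finset α) (φ : QState β) (e : Prop) [Decidable e]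
    (hφ : ∀ S, φ S ≠ 0 → (o ∈ S ↔ e)) :
    (Gate.CCX b (ι o) r).apply (embState ι Z φ) =
      embState ι (if b ∈ Z ∧ e then flipQubit r Z else Z) φ := by
  funext S
  have hor : ι o ≠ r := fun h => hr ⟨o, h⟩
  simp only [Gate.apply, embState_flip_outside hr]
  -- Where the inner amplitude vanishes both sides are zero; elsewhere the inner control has the
  -- definite value `e`.
  by_cases h0 : φ (pull ι S) = 0
  · have : ∀ Z', embState ι Z' φ S = 0 := fun Z' => by simp [embState, h0]
    simp [this]
  have ho := hφ _ h0
  rw [mem_pull] at ho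
  have hbf : b ∈ flipQubit r Z ↔ b ∈ Z := by simp [mem_flipQubit, hbr]
  -- The outer control is not an embedded qubit and is not flipped, so a basis state that disagrees
  -- with `Z` there has amplitude zero on both sides.
  by_cases hS : b ∈ S ↔ b ∈ Z
  · simp only [hbr, hor, hS, ho, ne_eq, not_false_eq_true, true_and]
    split_ifs <;> rfl
  · have h1 : ¬ SameOutside ι S Z := fun h => hS (h b hb)
    have h2 : ¬ SameOutside ι S (flipQubit r Z) := fun h => hS ((h b hb).trans hbf)
    split_ifs <;> simp [embState_neg h1, embState_neg h2]

end

theorem runOps_map_embState {k n : ℕ} (O : Bits k → Bits n → Bits n) {β : Type} [DecidableEq β]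
    (ι : β ↪ Qubit) (l : List (Gate β)) (Z : Finset Qubit) (φ : QState β) :
    runOps O (l.map fun g => Op.gate (g.map ι)) (embState ι Z φ) =
      embState ι Z (applyGates l φ) := by
  induction l generalizing φ with
  | nil => rfl
  | cons g l ih =>
    rw [List.map_cons, runOps_cons]
    have : (Op.gate (g.map ι)).lin O (embState ι Z φ) = embState ι Z (g.apply φ) :=
      Gate.map_apply_embState g Z φ
    rw [this, ih]
    rfl

/-! ## Hadamard gates on a set of qubits -/

theorem Gate.apply_H_eq {α : Type} [DecidableEq α] (t : α) (ψ : QState α) (S : Finset α) :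
    (Gate.H t).apply ψ S =
      (ψ (S.erase t) + (if t ∈ S then -1 else 1) * ψ (insert t S)) / (Real.sqrt 2 : ℂ) := by
  by_cases h : t ∈ S
  · simp [Gate.apply, h, sub_eq_add_neg]
  · simp [Gate.apply, h]

/-- Induction on the qubits: a Hadamard gate on `q` sums over the two values of `q`, with sign `-1`
exactly when `q` is set both in the summation index and in `S`. Splitting the power set at `q`
matches the two sums. -/
theorem applyGates_hadamard {α : Type} [DecidableEq α] (l : List α) (hl : l.Nodup)
    (ψ : QState α) (S : Finset α) :
    applyGates (l.map Gate.H) ψ S = ((Real.sqrt 2 : ℂ)⁻¹) ^ l.length *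
      ∑ U ∈ l.toFinset.powerset, (-1) ^ (U ∩ S).card * ψ (U ∪ (S \ l.toFinset)) := by
  induction l generalizing ψ S with
  | nil => simp [applyGates]
  | cons q l ih =>
    have hq : q ∉ l.toFinset := by simpa using (List.nodup_cons.1 hl).1
    have hstep : applyGates ((q :: l).map Gate.H) ψ =
        applyGates (l.map Gate.H) ((Gate.H q).apply ψ) := rfl
    rw [hstep, ih (List.nodup_cons.1 hl).2, List.toFinset_cons, Finset.sum_powerset_insert hq,
      ← Finset.sum_add_distrib, List.length_cons, pow_succ, mul_assoc, Finset.mul_sum _ _ _⁻¹]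
    congr 1
    refine Finset.sum_congr rfl fun U hU => ?_
    have hqU : q ∉ U := fun h => hq (Finset.mem_powerset.1 hU h)
    rw [Gate.apply_H_eq]
    have e1 : (U ∪ S \ l.toFinset).erase q = U ∪ S \ insert q l.toFinset := by
      ext p
      by_cases hp : p = q
      · subst hp; simp [hqU]
      · simp [hp]
    have e2 : insert q (U ∪ S \ l.toFinset) = insert q U ∪ S \ insert q l.toFinset := by
      ext p
      by_cases hp : p = q
      · subst hp; simp
      · simp [hp]
    have e3 : (q ∈ U ∪ S \ l.toFinset) ↔ q ∈ S := by
      have : q ∉ l := by simpa using hq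
      simp [hqU, this]
    rw [e1, e2]
    simp only [e3]
    by_cases hS : q ∈ S
    · rw [Finset.insert_inter_of_mem hS, Finset.card_insert_of_notMem (by simp [hqU])]
      simp only [hS, if_true, pow_succ]
      ring
    · rw [Finset.insert_inter_of_notMem hS]
      simp only [hS, if_false]
      ring

theorem runOps_gates {k n : ℕ} (O : Bits k → Bits n → Bits n) (l : List (Gate Qubit))
    (ψ : QState Qubit) : runOps O (l.map Op.gate) ψ = applyGates l ψ := by
  induction l generalizing ψ with
  | nil => rfl
  | cons g l ih =>
    rw [List.map_cons, runOps_cons, ih]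
    rfl

/-! ## Period finding -/

section
variable {k n : ℕ} {O : Bits k → Bits n → Bits n}

/-- The signs are characters of the group of finite sets under symmetric difference, because the
common part of `A` and `B` is counted twice. -/
theorem sign_symmDiff {α : Type} [DecidableEq α] (A B S : Finset α) :
    ((-1 : ℂ)) ^ (symmDiff A B ∩ S).card = (-1) ^ (A ∩ S).card * (-1) ^ (B ∩ S).card := by
  have h : (symmDiff A B ∩ S).card + 2 * (A ∩ B ∩ S).card = (A ∩ S).card + (B ∩ S).card := by
    have h1 : (A ∩ S).card = ((A \ B) ∩ S).card + (A ∩ B ∩ S).card := by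
      rw [← Finset.card_union_of_disjoint]
      · congr 1; ext p; simp only [Finset.mem_union, Finset.mem_inter, Finset.mem_sdiff]; tauto
      · rw [Finset.disjoint_left]; intro p; simp only [Finset.mem_inter, Finset.mem_sdiff]; tauto
    have h2 : (B ∩ S).card = ((B \ A) ∩ S).card + (A ∩ B ∩ S).card := by
      rw [← Finset.card_union_of_disjoint]
      · congr 1; ext p; simp only [Finset.mem_union, Finset.mem_inter, Finset.mem_sdiff]; tauto
      · rw [Finset.disjoint_left]; intro p; simp only [Finset.mem_inter, Finset.mem_sdiff]; tauto
    have h3 : (symmDiff A B ∩ S).card = ((A \ B) ∩ S).card + ((B \ A) ∩ S).card := by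
      rw [← Finset.card_union_of_disjoint]
      · congr 1; ext p
        simp only [Finset.mem_union, Finset.mem_inter, Finset.mem_sdiff, Finset.mem_symmDiff]
        tauto
      · rw [Finset.disjoint_left]; intro p; simp only [Finset.mem_inter, Finset.mem_sdiff]; tauto
    omega
  rw [← pow_add, ← h, pow_add, pow_mul]
  simp

/-- The state before the measurement in the period finding algorithm for the function `F`, when
the qubits in `l` hold the argument. -/
theorem period_amplitude {l : List Qubit} (hl : l.Nodup) {mid : List Op}
    {F : Finset Qubit → Finset Qubit} (hF : ∀ U ⊆ l.toFinset, Disjoint (F U) l.toFinset)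
    (hmid : ∀ U ⊆ l.toFinset, runOps O mid (ket U) = ket (U ∪ F U)) (S : Finset Qubit) :
    runOps O (l.map (Op.gate ∘ Gate.H) ++ mid ++ l.map (Op.gate ∘ Gate.H)) (ket ∅) S =
      ((Real.sqrt 2 : ℂ)⁻¹) ^ l.length * ((Real.sqrt 2 : ℂ)⁻¹) ^ l.length *
        ∑ U ∈ l.toFinset.powerset, if F U = S \ l.toFinset then (-1) ^ (U ∩ S).card else 0 := by
  set Q := l.toFinset with hQ
  set c := ((Real.sqrt 2 : ℂ)⁻¹) ^ l.length with hc
  have hH : ∀ ψ, runOps O (l.map (Op.gate ∘ Gate.H)) ψ = applyGates (l.map Gate.H) ψ := by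
    intro ψ
    rw [← List.map_map, runOps_gates]
  -- In the Hadamard formula applied to `ket ∅` only the index `∅` can contribute, with sign `1`:
  -- the result is the uniform superposition over the subsets of `Q`.
  have first : applyGates (l.map Gate.H) (ket ∅) = ∑ U ∈ Q.powerset, c • ket U := by
    funext S
    rw [applyGates_hadamard l hl, Finset.sum_apply, Finset.mul_sum]
    simp only [Pi.smul_apply, smul_eq_mul, ket, Finset.union_eq_empty, ← hQ, ← hc]
    by_cases hS : S ⊆ Q
    · rw [Finset.sum_eq_single ∅, Finset.sum_eq_single S]
      · simp [Finset.sdiff_eq_empty_iff_subset.2 hS]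
      · intro U _ hU; simp [Ne.symm hU]
      · intro h; exact absurd (Finset.mem_powerset.2 hS) h
      · intro U _ hU; simp [hU]
      · intro h; exact absurd (Finset.empty_mem_powerset Q) h
    · rw [Finset.sum_eq_zero, Finset.sum_eq_zero]
      · intro U hU
        have : S ≠ U := fun h => hS (h ▸ Finset.mem_powerset.1 hU)
        simp [this]
      · intro U hU
        have : S \ Q ≠ ∅ := fun h => hS (Finset.sdiff_eq_empty_iff_subset.1 h)
        simp [this]
  have second : runOps O mid (∑ U ∈ Q.powerset, c • ket U) =
      ∑ U ∈ Q.powerset, c • ket (U ∪ F U) := by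
    rw [map_sum]
    refine Finset.sum_congr rfl fun U hU => ?_
    rw [map_smul, hmid U (Finset.mem_powerset.1 hU)]
  rw [runOps_append, runOps_append, hH, hH, first, second, applyGates_hadamard l hl, mul_assoc]
  congr 1
  rw [Finset.mul_sum]
  refine Finset.sum_congr rfl fun U hU => ?_
  have hUQ := Finset.mem_powerset.1 hU
  -- Since `F V` avoids `Q`, the parts of `V ∪ F V` inside and outside `Q` are `V` and `F V`. The
  -- index `V = U` alone survives, and it requires `F U = S \ Q`.
  rw [Finset.sum_apply, Finset.sum_eq_single (M := ℂ) U]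
  · have : U ∪ S \ Q = U ∪ F U ↔ F U = S \ Q := by
      constructor
      · intro h
        ext p
        have hp := Finset.ext_iff.1 h p
        have hd : p ∈ F U → p ∉ Q := fun h1 h2 => Finset.disjoint_left.1 (hF U hUQ) h1 h2
        have := @hUQ p
        simp only [Finset.mem_union, Finset.mem_sdiff] at hp ⊢
        tauto
      · intro h; rw [h]
    simp only [Pi.smul_apply, smul_eq_mul, ket, ← hQ, this]
    split_ifs <;> ring
  · intro V hV hVU
    have hVQ := Finset.mem_powerset.1 hV
    have : U ∪ S \ Q ≠ V ∪ F V := by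
      intro h
      apply hVU
      ext p
      have hp := Finset.ext_iff.1 h p
      have hd : p ∈ F V → p ∉ Q := fun h1 h2 => Finset.disjoint_left.1 (hF V hVQ) h1 h2
      have h1 := @hUQ p
      have h2 := @hVQ p
      simp only [Finset.mem_union, Finset.mem_sdiff] at hp
      tauto
    simp [ket, this, ← hQ]
  · intro h; exact absurd hU h

/-- A measured string is orthogonal to the period. -/
theorem period_orthogonal {Q D S : Finset Qubit} {F : Finset Qubit → Finset Qubit} (hD : D ⊆ Q)
    (hF : ∀ U ⊆ Q, F (symmDiff U D) = F U)
    (h : (∑ U ∈ Q.powerset, if F U = S \ Q then ((-1 : ℂ)) ^ (U ∩ S).card else 0) ≠ 0) :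
    Even (D ∩ S).card := by
  by_contra hodd
  apply h
  have hsub : ∀ U ∈ Q.powerset, symmDiff U D ∈ Q.powerset := fun U hU =>
    Finset.mem_powerset.2 ((symmDiff_le_sup : symmDiff U D ≤ U ⊔ D).trans
      (sup_le (Finset.mem_powerset.1 hU) hD))
  -- Translation by the period permutes the summands and keeps the value of `F`, but multiplies
  -- every sign by `(-1) ^ |D ∩ S| = -1`. The sum equals its own negative.
  have key : (∑ U ∈ Q.powerset, if F U = S \ Q then ((-1 : ℂ)) ^ (U ∩ S).card else 0) =
      -(∑ U ∈ Q.powerset, if F U = S \ Q then ((-1 : ℂ)) ^ (U ∩ S).card else 0) := by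
    rw [← Finset.sum_neg_distrib]
    refine Finset.sum_bij' (fun U _ => symmDiff U D) (fun U _ => symmDiff U D) hsub hsub ?_ ?_ ?_
    · intro U _; simp
    · intro U _; simp
    · intro U hU
      rw [hF U (Finset.mem_powerset.1 hU), sign_symmDiff,
        (Nat.not_even_iff_odd.1 hodd).neg_one_pow]
      split_ifs <;> simp
  exact self_eq_neg.1 key

/-- Strings that differ by an element orthogonal to the period are measured with the same
probability. -/
theorem period_shift {Q D e S : Finset Qubit} {F : Finset Qubit → Finset Qubit} (he : e ⊆ Q)
    (hF : ∀ U ⊆ Q, ∀ V ⊆ Q, F U = F V → V = U ∨ V = symmDiff U D) (hDe : Even (D ∩ e).card) :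
    ‖∑ U ∈ Q.powerset, if F U = symmDiff S e \ Q then
        ((-1 : ℂ)) ^ (U ∩ symmDiff S e).card else 0‖ =
      ‖∑ U ∈ Q.powerset, if F U = S \ Q then ((-1 : ℂ)) ^ (U ∩ S).card else 0‖ := by
  have hS : symmDiff S e \ Q = S \ Q := by
    ext p
    have := @he p
    simp only [Finset.mem_sdiff, Finset.mem_symmDiff]
    tauto
  rw [hS]
  -- The fibre is contained in `{V, V + D}`, and the sign contributed by `e` is constant on it
  -- because `e` is orthogonal to `D`. That sign factors out and has norm one. If the fibre is
  -- empty, both sums vanish.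
  by_cases h : ∃ V ⊆ Q, F V = S \ Q
  · obtain ⟨V, hV, hVS⟩ := h
    have : ∀ U ∈ Q.powerset, (if F U = S \ Q then ((-1 : ℂ)) ^ (U ∩ symmDiff S e).card else 0) =
        (-1) ^ (V ∩ e).card * (if F U = S \ Q then (-1) ^ (U ∩ S).card else 0) := by
      intro U hU
      split_ifs with hUS
      · have h1 : ((-1 : ℂ)) ^ (U ∩ e).card = (-1) ^ (V ∩ e).card := by
          rcases hF V hV U (Finset.mem_powerset.1 hU) (hVS.trans hUS.symm) with rfl | rfl
          · rfl
          · rw [sign_symmDiff, hDe.neg_one_pow, mul_one]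
        rw [Finset.inter_comm, sign_symmDiff, Finset.inter_comm S, Finset.inter_comm e, h1,
          mul_comm]
      · simp
    rw [Finset.sum_congr rfl this, ← Finset.mul_sum, norm_mul]
    simp
  · rw [Finset.sum_eq_zero, Finset.sum_eq_zero]
    · intro U hU
      rw [if_neg fun hU' => h ⟨U, Finset.mem_powerset.1 hU, hU'⟩]
    · intro U hU
      rw [if_neg fun hU' => h ⟨U, Finset.mem_powerset.1 hU, hU'⟩]

end

/-! ## The operations of one sample

Qubit `0` is the control qubit, the wires of the circuit follow, and then the qubits that receive
the result. -/

/-- The control qubit. -/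
def ctrl : Qubit := (0, 0)

/-- The place of the wires of the circuit in the quantum memory. -/
def wire (w : ℕ) : Fin w ↪ Qubit :=
  ⟨fun i => (0, 1 + i.val), fun i j h => by
    have := congrArg Prod.snd h
    simp only at this
    exact Fin.ext (by omega)⟩

theorem wire_apply {w : ℕ} (i : Fin w) : wire w i = (0, 1 + i.val) := rfl

theorem ctrl_notMem_range (w : ℕ) : ctrl ∉ Set.range (wire w) := by
  rintro ⟨i, hi⟩
  have := congrArg Prod.snd hi
  simp only [wire_apply, ctrl] at this
  omega

theorem result_notMem_range (w j : ℕ) : ((0, 1 + w + j) : Qubit) ∉ Set.range (wire w) := by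
  rintro ⟨i, hi⟩
  have := congrArg Prod.snd hi
  simp only [wire_apply] at this
  omega

/-- Toggle the plaintext wires at which `v` is not zero. -/
def plainOps (k n : ℕ) (v : ℕ → ℕ) : List Op :=
  (List.range n).flatMap fun j => if v j ≠ 0 then [.gate (.X (0, 1 + (k + j)))] else []

/-- Copy the ciphertext wires to the qubits that start at `1 + w + p` if the control qubit is
set. -/
def copyOps (k n w p : ℕ) : List Op :=
  (List.range n).flatMap fun j => [.gate (.CCX ctrl (0, 1 + (k + n + j)) (0, 1 + w + p + j))]

/-- Execute a circuit. -/
def circuitOps {w : ℕ} (l : List (Gate (Fin w))) : List Op := l.map fun g => .gate (g.map (wire w))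

/-- Query the oracle on the wires of the circuit. -/
def queryOp (k n : ℕ) : Op := .query (0, 1) (0, 1 + k) (0, 1 + k + n)

/-- Evaluate the function whose period is to be found, for one plaintext. -/
def stageOps {k n a : ℕ} (C : Circuit k n a) (v : ℕ → ℕ) (p : ℕ) : List Op :=
  plainOps k n v ++ (circuitOps C.gates ++ (copyOps k n (k + n + n + a) p ++
    (circuitOps (C.gates.reverse.map Gate.inv) ++ ([.gate (.X ctrl)] ++ ([queryOp k n] ++
      (copyOps k n (k + n + n + a) p ++ ([queryOp k n] ++ ([.gate (.X ctrl)] ++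
        plainOps k n v))))))))

section
variable {k n a : ℕ} {O : Bits k → Bits n → Bits n}

/-! ### Basis states of the wires and their preparation -/

theorem X_apply_ket {α : Type} [DecidableEq α] (t : α) (S : Finset α) :
    (Gate.X t).apply (ket S) = ket (flipQubit t S) := by
  funext S'
  simp only [Gate.apply, ket, (flipQubit_involutive t).eq_iff]

theorem mem_input {K : Bits k} {x : Bits n} {t : Fin (k + n + n + a)} :
    t ∈ Circuit.input a K x ↔
      (∃ i : Fin k, t.val = i.val ∧ K i = true) ∨ (∃ j : Fin n, t.val = k + j.val ∧ x j = true) := by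
  simp [Circuit.input]

theorem mem_input_key {K : Bits k} {x : Bits n} {t : Fin (k + n + n + a)} (h : t.val < k) :
    t ∈ Circuit.input a K x ↔ K ⟨t, h⟩ = true := by
  rw [mem_input]
  constructor
  · rintro (⟨i, hi, hK⟩ | ⟨j, hj, -⟩)
    · have : (⟨t, h⟩ : Fin k) = i := Fin.ext hi
      rwa [this]
    · omega
  · exact fun hK => Or.inl ⟨_, rfl, hK⟩

theorem mem_input_plain {K : Bits k} {x : Bits n} {t : Fin (k + n + n + a)} {j : Fin n}
    (h : t.val = k + j.val) : t ∈ Circuit.input a K x ↔ x j = true := by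
  rw [mem_input]
  constructor
  · rintro (⟨i, hi, hK⟩ | ⟨j', hj, hx⟩)
    · omega
    · have : j = j' := Fin.ext (by omega)
      rwa [this]
  · exact fun hK => Or.inr ⟨j, h, hK⟩

theorem notMem_input {K : Bits k} {x : Bits n} {t : Fin (k + n + n + a)} (h : k + n ≤ t.val) :
    t ∉ Circuit.input a K x := by
  rw [mem_input]
  rintro (⟨i, hi, -⟩ | ⟨j', hj, -⟩) <;> omega

/-- The plaintext wires at which `v` is not zero. -/
def plainSet (k n a : ℕ) (v : ℕ → ℕ) (l : ℕ) : Finset (Fin (k + n + n + a)) :=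
  Finset.univ.filter fun t => k ≤ t.val ∧ t.val < k + l ∧ v (t.val - k) ≠ 0

theorem runOps_plain_aux (Z : Finset Qubit) (T : Finset (Fin (k + n + n + a))) (v : ℕ → ℕ)
    (l : ℕ) (hl : l ≤ n) :
    runOps O (plainOps k l v) (embState (wire _) Z (ket T)) =
      embState (wire _) Z (ket (symmDiff T (plainSet k n a v l))) := by
  induction l with
  | zero =>
    have : plainSet k n a v 0 = ∅ := by
      ext t; simp only [plainSet, Finset.mem_filter, Finset.mem_univ, true_and]
      constructor
      · rintro ⟨h1, h2, -⟩; omega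
      · simp
    rw [this, ← Finset.bot_eq_empty, symmDiff_bot]
    rfl
  | succ l ih =>
    have e : plainOps k (l + 1) v =
        plainOps k l v ++ if v l ≠ 0 then [.gate (.X (0, 1 + (k + l)))] else [] := by
      simp [plainOps, List.range_succ]
    rw [e, runOps_append, ih (by omega)]
    set t : Fin (k + n + n + a) := ⟨k + l, by omega⟩ with ht
    split_ifs with hv
    · rw [runOps_cons, runOps_nil]
      have h1 : (Op.gate (.X (0, 1 + (k + l)))).lin O
          (embState (wire _) Z (ket (symmDiff T (plainSet k n a v l)))) =
          embState (wire _) Z ((Gate.X t).apply (ket (symmDiff T (plainSet k n a v l)))) :=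
        Gate.map_apply_embState (Gate.X t) Z _
      rw [h1, X_apply_ket]
      congr 2
      have h2 : plainSet k n a v (l + 1) = symmDiff (plainSet k n a v l) {t} := by
        ext t'
        simp only [plainSet, Finset.mem_filter, Finset.mem_univ, true_and, Finset.mem_symmDiff,
          Finset.mem_singleton]
        by_cases h : t' = t
        · rw [h]
          simp [ht, hv]
        · have : t'.val ≠ k + l := fun h' => h (Fin.ext h')
          simp only [h, not_false_eq_true, and_true, false_and, or_false]
          constructor
          · rintro ⟨h1, h2, h3⟩; exact ⟨h1, by omega, h3⟩
          · rintro ⟨h1, h2, h3⟩; exact ⟨h1, by omega, h3⟩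
      rw [h2, flipQubit, symmDiff_assoc]
    · rw [runOps_nil]
      congr 3
      ext t'
      simp only [plainSet, Finset.mem_filter, Finset.mem_univ, true_and]
      constructor
      · rintro ⟨h1, h2, h3⟩; exact ⟨h1, by omega, h3⟩
      · rintro ⟨h1, h2, h3⟩
        refine ⟨h1, ?_, h3⟩
        by_contra h4
        have : t'.val - k = l := by omega
        rw [this] at h3
        exact h3 (not_not.1 hv)

theorem symmDiff_plainSet {v : ℕ → ℕ} {x : Bits n} (hv : ∀ j : Fin n, v j ≠ 0 ↔ x j = true)
    (K : Bits k) :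
    symmDiff (Circuit.input a K fun _ : Fin n => false) (plainSet k n a v n) = Circuit.input a K x := by
  ext t
  rw [Finset.mem_symmDiff]
  by_cases h1 : t.val < k
  · have : t ∉ plainSet k n a v n := by
      simp only [plainSet, Finset.mem_filter, Finset.mem_univ, true_and]; omega
    simp [mem_input_key h1, this]
  by_cases h2 : t.val < k + n
  · have h3 : t.val = k + (⟨t.val - k, by omega⟩ : Fin n).val := by simp only; omega
    rw [mem_input_plain h3, mem_input_plain h3]
    simp only [plainSet, Finset.mem_filter, Finset.mem_univ, true_and]
    have := hv ⟨t.val - k, by omega⟩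
    simp only at this
    rw [this]
    simp only [Bool.false_eq_true, not_false_eq_true, and_true, false_and, false_or]
    constructor
    · rintro ⟨-, -, h⟩; exact h
    · intro h; exact ⟨by omega, h2, h⟩
  · have : t ∉ plainSet k n a v n := by
      simp only [plainSet, Finset.mem_filter, Finset.mem_univ, true_and]; omega
    have h3 := fun x : Bits n => notMem_input (K := K) (x := x) (t := t) (by omega)
    simp [h3, this]

theorem runOps_plain {v : ℕ → ℕ} {x : Bits n} (hv : ∀ j : Fin n, v j ≠ 0 ↔ x j = true)
    (K : Bits k) (Z : Finset Qubit) :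
    runOps O (plainOps k n v) (embState (wire _) Z (ket (Circuit.input a K fun _ : Fin n => false))) =
      embState (wire _) Z (ket (Circuit.input a K x)) := by
  rw [runOps_plain_aux _ _ _ _ le_rfl, symmDiff_plainSet hv]

theorem runOps_plain_undo {v : ℕ → ℕ} {x : Bits n} (hv : ∀ j : Fin n, v j ≠ 0 ↔ x j = true)
    (K : Bits k) (Z : Finset Qubit) :
    runOps O (plainOps k n v) (embState (wire _) Z (ket (Circuit.input a K x))) =
      embState (wire _) Z (ket (Circuit.input a K fun _ : Fin n => false)) := by
  rw [runOps_plain_aux _ _ _ _ le_rfl, ← symmDiff_plainSet hv, symmDiff_assoc, symmDiff_self,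
    symmDiff_bot]

/-- The part of `blockSupport q e` that belongs to the first `l` bits. -/
def partSupport (q : Qubit) {n : ℕ} (e : Bits n) (l : ℕ) : Finset Qubit :=
  (Finset.univ.filter fun i : Fin n => i.val < l ∧ e i = true).image fun i => (q.1, q.2 + i.val)

theorem mem_partSupport {q p : Qubit} {e : Bits n} {l : ℕ} :
    p ∈ partSupport q e l ↔ ∃ i : Fin n, (i.val < l ∧ e i = true) ∧ p = (q.1, q.2 + i.val) := by
  simp only [partSupport, Finset.mem_image, Finset.mem_filter, Finset.mem_univ, true_and,
    @eq_comm _ p]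

theorem partSupport_succ (q : Qubit) (e : Bits n) (l : ℕ) (hl : l < n) :
    partSupport q e (l + 1) = if e ⟨l, hl⟩ = true then
      symmDiff (partSupport q e l) {(q.1, q.2 + l)} else partSupport q e l := by
  have hnot : ((q.1, q.2 + l) : Qubit) ∉ partSupport q e l := by
    rw [mem_partSupport]
    rintro ⟨i, ⟨h1, -⟩, h2⟩
    have := congrArg Prod.snd h2
    simp only at this
    omega
  ext p
  split_ifs with h
  · rw [Finset.mem_symmDiff, Finset.mem_singleton]
    by_cases hp : p = (q.1, q.2 + l)
    · subst hp
      simp only [hnot, not_false_eq_true, and_true, not_true_eq_false, and_false, or_true, iff_true]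
      exact mem_partSupport.2 ⟨⟨l, hl⟩, ⟨Nat.lt_succ_self l, h⟩, rfl⟩
    · simp only [hp, not_false_eq_true, and_true, false_and, or_false]
      rw [mem_partSupport, mem_partSupport]
      refine exists_congr fun i => ⟨?_, ?_⟩
      · rintro ⟨⟨h1, h2⟩, h3⟩
        refine ⟨⟨?_, h2⟩, h3⟩
        by_contra h4
        have : i.val = l := by omega
        exact hp (by rw [h3, this])
      · rintro ⟨⟨h1, h2⟩, h3⟩
        exact ⟨⟨by omega, h2⟩, h3⟩
  · rw [mem_partSupport, mem_partSupport]
    refine exists_congr fun i => ⟨?_, ?_⟩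
    · rintro ⟨⟨h1, h2⟩, h3⟩
      refine ⟨⟨?_, h2⟩, h3⟩
      by_contra h4
      have : i = ⟨l, hl⟩ := Fin.ext (by simp only; omega)
      exact h (this ▸ h2)
    · rintro ⟨⟨h1, h2⟩, h3⟩
      exact ⟨⟨by omega, h2⟩, h3⟩

theorem partSupport_full (q : Qubit) (e : Bits n) : partSupport q e n = blockSupport q e := by
  ext p
  rw [mem_partSupport, mem_blockSupport]
  simp

theorem ctrl_notMem_partSupport (w p : ℕ) (e : Bits n) (l : ℕ) :
    ctrl ∉ partSupport (0, 1 + w + p) e l := by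
  rw [mem_partSupport]
  rintro ⟨i, -, h⟩
  have := congrArg Prod.snd h
  simp only [ctrl] at this
  omega

/-- Only the ciphertext wires need definite values on the support of `φ`; the other wires may be in
any superposition. This is exactly what `Circuit.Evaluates` provides, garbage included. -/
theorem runOps_copy {e : Bits n} {φ : QState (Fin (k + n + n + a))}
    (hφ : ∀ S, φ S ≠ 0 → ∀ j : Fin n, (Circuit.outWire a j ∈ S ↔ e j = true))
    (Z : Finset Qubit) (p : ℕ) :
    runOps O (copyOps k n (k + n + n + a) p) (embState (wire _) Z φ) =
      embState (wire _)
        (if ctrl ∈ Z then symmDiff Z (blockSupport (0, 1 + (k + n + n + a) + p) e) else Z) φ := by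
  have key : ∀ l ≤ n, runOps O ((List.range l).flatMap fun j =>
        [Op.gate (.CCX ctrl (0, 1 + (k + n + j)) (0, 1 + (k + n + n + a) + p + j))]) (embState (wire _) Z φ) =
      embState (wire _)
        (if ctrl ∈ Z then symmDiff Z (partSupport (0, 1 + (k + n + n + a) + p) e l) else Z) φ := by
    intro l hl
    induction l with
    | zero =>
      have : partSupport (0, 1 + (k + n + n + a) + p) e 0 = ∅ := by
        ext q; simp [mem_partSupport]
      rw [this, ← Finset.bot_eq_empty, symmDiff_bot, ite_self]
      rfl
    | succ l ih =>
      rw [List.range_succ, List.flatMap_append, runOps_append, ih (by omega)]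
      simp only [List.flatMap_cons, List.flatMap_nil, List.append_nil]
      rw [runOps_cons, runOps_nil]
      set Z' := if ctrl ∈ Z then symmDiff Z (partSupport (0, 1 + (k + n + n + a) + p) e l) else Z with hZ'
      have hr : ((0, 1 + (k + n + n + a) + p + l) : Qubit) ∉ Set.range (wire (k + n + n + a)) := by
        have := result_notMem_range (k + n + n + a) (p + l)
        rwa [← add_assoc] at this
      have hbr : ctrl ≠ (0, 1 + (k + n + n + a) + p + l) := by
        intro h
        have := congrArg Prod.snd h
        simp only [ctrl] at this
        omega
      have h1 : (Op.gate (.CCX ctrl (0, 1 + (k + n + l)) (0, 1 + (k + n + n + a) + p + l))).lin O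
          (embState (wire _) Z' φ) = _ :=
        CCX_apply_embState (ι := wire (k + n + n + a)) (o := Circuit.outWire a ⟨l, by omega⟩)
          (ctrl_notMem_range (k + n + n + a)) hr hbr Z' φ (e ⟨l, by omega⟩ = true)
          (fun S hS => hφ S hS ⟨l, by omega⟩)
      rw [h1]
      congr 1
      have hc : ctrl ∈ Z' ↔ ctrl ∈ Z := by
        rw [hZ']
        split_ifs with h
        · simp [Finset.mem_symmDiff, h, ctrl_notMem_partSupport]
        · simp [h]
      rw [partSupport_succ _ _ _ (by omega)]
      simp only [hc]
      by_cases h : ctrl ∈ Z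
      · simp only [h, true_and, if_true, hZ']
        split_ifs
        · rw [flipQubit, symmDiff_assoc]
        · rfl
      · simp [h, hZ']
  rw [copyOps, key n le_rfl, partSupport_full]

theorem query_disjoint (k n : ℕ) :
    Disjoint (block (0, 1 + k + n) n) (block (0, 1) k ∪ block (0, 1 + k) n) := by
  rw [Finset.disjoint_left]
  intro q h1 h2
  obtain ⟨i, hi, rfl⟩ := mem_block.1 h1
  rcases Finset.mem_union.1 h2 with h2 | h2 <;>
  · obtain ⟨j, hj, h⟩ := mem_block.1 h2
    have := congrArg Prod.snd h
    simp only at this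
    omega

/-- The basis state of the wires after an oracle query. -/
def queried (a : ℕ) (K : Bits k) (x e : Bits n) : Finset (Fin (k + n + n + a)) :=
  symmDiff (Circuit.input a K x) (Finset.univ.filter fun t => ∃ j, t = Circuit.outWire a j ∧ e j = true)

theorem outWire_mem_queried (K : Bits k) (x e : Bits n) (j : Fin n) :
    Circuit.outWire a j ∈ queried a K x e ↔ e j = true := by
  have h : Circuit.outWire a j ∉ Circuit.input a K x := notMem_input (by simp [Circuit.outWire])
  have inj : ∀ j' : Fin n, (Circuit.outWire a j : Fin (k + n + n + a)) = Circuit.outWire a j' ↔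
      j = j' := by
    intro j'
    simp [Circuit.outWire, Fin.ext_iff]
  simp [queried, Finset.mem_symmDiff, h, inj]

/-- The wires are laid out so that key, plaintext and ciphertext wires are the three blocks of the
query. The ciphertext wires are clear beforehand, so they receive the answer itself. -/
theorem query_embState (K : Bits k) (x : Bits n) (Z : Finset Qubit) :
    (queryOp k n).lin O (embState (wire _) Z (ket (Circuit.input a K x))) =
      embState (wire _) Z (ket (queried a K x (O K x))) := by
  classical
  set w := k + n + n + a with hw
  obtain ⟨S, hS1, hS2⟩ : ∃ S : Finset Qubit, (∀ t, wire w t ∈ S ↔ t ∈ Circuit.input a K x) ∧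
      SameOutside (wire w) S Z := by
    refine ⟨(Circuit.input a K x).map (wire w) ∪ Z.filter (· ∉ Set.range (wire w)), ?_, ?_⟩
    · intro t
      simp
    · intro q hq
      have : q ∉ (Circuit.input a K x).map (wire w) := by
        intro h
        obtain ⟨t, -, rfl⟩ := Finset.mem_map.1 h
        exact hq ⟨t, rfl⟩
      simp only [Finset.mem_union, this, Finset.mem_filter, hq, not_false_eq_true, and_true,
        false_or]
  rw [embState_of_iff hS1 hS2]
  have h1 : (queryOp k n).lin O (ket S) = ket (oraclePerm O (0, 1) (0, 1 + k) (0, 1 + k + n) S) :=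
    applyOracle_ket O (query_disjoint k n) S
  have hK : readBlock S (0, 1) k = K := by
    funext i
    have := hS1 ⟨i.val, by omega⟩
    rw [mem_input_key (by simp), wire_apply] at this
    simp [readBlock, this]
  have hx : readBlock S (0, 1 + k) n = x := by
    funext j
    have := hS1 ⟨k + j.val, by omega⟩
    rw [mem_input_plain rfl, wire_apply, ← add_assoc] at this
    simp [readBlock, this]
  rw [h1, oraclePerm, hK, hx]
  symm
  apply embState_of_iff
  · intro t
    rw [Finset.mem_symmDiff, queried, Finset.mem_symmDiff, hS1]
    have : wire w t ∈ blockSupport (0, 1 + k + n) (O K x) ↔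
        t ∈ Finset.univ.filter fun t : Fin w => ∃ j, t = Circuit.outWire a j ∧ O K x j = true := by
      rw [mem_blockSupport]
      simp only [Finset.mem_filter, Finset.mem_univ, true_and]
      refine exists_congr fun j => ?_
      rw [and_comm]
      refine and_congr_left fun _ => ?_
      simp only [wire_apply, Prod.mk.injEq, true_and, Circuit.outWire, Fin.ext_iff]
      omega
    rw [this]
  · intro q hq
    rw [Finset.mem_symmDiff, hS2 q hq]
    have : q ∉ blockSupport (0, 1 + k + n) (O K x) := by
      rw [mem_blockSupport]
      rintro ⟨j, -, rfl⟩
      refine hq ⟨Circuit.outWire a j, ?_⟩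
      simp [wire_apply, Circuit.outWire, add_assoc]
    simp [this]

theorem query_query (ψ : QState Qubit) :
    (queryOp k n).lin O ((queryOp k n).lin O ψ) = ψ :=
  applyOracle_applyOracle O _ _ _ ψ

theorem ctrl_notMem_blockSupport (w p : ℕ) (e : Bits n) :
    ctrl ∉ blockSupport (0, 1 + w + p) e := by
  rw [← partSupport_full]
  exact ctrl_notMem_partSupport w p e n

/-- The circuit and the oracle are both run whatever the control qubit is; only the copying is
controlled. The first copy fires if the control qubit is set, the second, between two flips of the
control qubit, if it is not. Each computation is undone after its copy, so the wires return to their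
initial state without entanglement. -/
theorem runOps_stage {E : BlockCipher k n} {C : Circuit k n a} (hC : C.Evaluates E)
    {v : ℕ → ℕ} {x : Bits n} (hv : ∀ j : Fin n, v j ≠ 0 ↔ x j = true) (p : ℕ) (K : Bits k)
    (Z : Finset Qubit) :
    runOps O (stageOps C v p) (embState (wire _) Z (ket (Circuit.input a K fun _ : Fin n => false))) =
      embState (wire _)
        (symmDiff Z (blockSupport (0, 1 + (k + n + n + a) + p)
          (if ctrl ∈ Z then E K x else O K x)))
        (ket (Circuit.input a K fun _ : Fin n => false)) := by
  have hX : ∀ (Z : Finset Qubit) (φ : QState (Fin (k + n + n + a))),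
      runOps O [.gate (.X ctrl)] (embState (wire _) Z φ) =
        embState (wire _) (flipQubit ctrl Z) φ := fun Z φ =>
    X_apply_embState_outside (ctrl_notMem_range _) Z φ
  have hq : ∀ Z : Finset Qubit,
      runOps O [queryOp k n] (embState (wire _) Z (ket (Circuit.input a K x))) =
        embState (wire _) Z (ket (queried a K x (O K x))) := query_embState K x
  have hq' : ∀ Z : Finset Qubit,
      runOps O [queryOp k n] (embState (wire _) Z (ket (queried a K x (O K x)))) =
        embState (wire _) Z (ket (Circuit.input a K x)) := by
    intro Z
    rw [← hq Z]
    exact query_query _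
  have hcopy := runOps_copy (O := O) (p := p) (hC K x)
  have hcopy' := runOps_copy (O := O) (p := p) (a := a) (e := O K x)
    (φ := ket (queried a K x (O K x))) (fun S hS j => by
      have : S = queried a K x (O K x) := by
        by_contra h; simp [ket, h] at hS
      rw [this, outWire_mem_queried])
  have hinv : ∀ Z : Finset Qubit,
      runOps O (circuitOps (C.gates.reverse.map Gate.inv)) (embState (wire _) Z
        (applyGates C.gates (ket (Circuit.input a K x)))) =
      embState (wire _) Z (ket (Circuit.input a K x)) := by
    intro Z
    rw [circuitOps, runOps_map_embState, applyGates_inverse]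
  have hcirc : ∀ (Z : Finset Qubit) (φ : QState (Fin (k + n + n + a))),
      runOps O (circuitOps C.gates) (embState (wire _) Z φ) =
        embState (wire _) Z (applyGates C.gates φ) :=
    runOps_map_embState O (wire _) C.gates
  simp only [stageOps, runOps_append]
  rw [runOps_plain hv, hcirc, hcopy, hinv, hX, hq, hcopy', hq', hX,
    runOps_plain_undo hv]
  congr 1
  set R := fun e : Bits n => blockSupport (0, 1 + (k + n + n + a) + p) e with hR
  have hcR : ∀ e, ctrl ∉ R e := fun e => ctrl_notMem_blockSupport _ _ _
  -- The result qubits differ from the control qubit, so copying does not disturb it and exactly one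
  -- of the two copies takes place.
  by_cases h : ctrl ∈ Z
  · have h1 : ctrl ∉ flipQubit ctrl (symmDiff Z (R (E K x))) := by
      simp [mem_flipQubit, Finset.mem_symmDiff, h, hcR]
    simp only [h, if_true]
    rw [if_neg h1, flipQubit_involutive]
  · have h1 : ctrl ∈ flipQubit ctrl Z := by simp [mem_flipQubit, h]
    simp only [h, if_false]
    rw [if_pos h1]
    simp only [flipQubit]
    rw [symmDiff_assoc Z, symmDiff_comm ({ctrl} : Finset Qubit), ← symmDiff_assoc, symmDiff_assoc,
      symmDiff_self, symmDiff_bot]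

end

/-! ## The distribution of a sample -/

/-- The qubits that are set in the result register when the blocks `f 0, …, f (r - 1)` have been
added to it. -/
def resultSet (w : ℕ) {n : ℕ} (f : ℕ → Bits n) (r : ℕ) : Finset Qubit :=
  (Finset.range r).biUnion fun i => blockSupport (0, 1 + w + i * n) (f i)

theorem mem_resultSet {w n r : ℕ} {f : ℕ → Bits n} {q : Qubit} :
    q ∈ resultSet w f r ↔ ∃ i < r, ∃ j : Fin n, f i j = true ∧ q = (0, 1 + w + i * n + j.val) := by
  simp [resultSet, mem_blockSupport]

theorem index_lt {n r i j : ℕ} (hi : i < r) (hj : j < n) : i * n + j < r * n := by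
  have : (i + 1) * n ≤ r * n := Nat.mul_le_mul_right n hi
  rw [Nat.succ_mul] at this
  omega

/-- Uniqueness of division with remainder. It separates the blocks of the result register and,
later, the entries of the matrix. -/
theorem index_unique {n i i' : ℕ} {j j' : ℕ} (hj : j < n) (hj' : j' < n)
    (h : i * n + j = i' * n + j') : i = i' ∧ j = j' := by
  have : i = i' := by
    rcases lt_trichotomy i i' with h' | h' | h'
    · have := index_lt h' hj; omega
    · exact h'
    · have := index_lt h' hj'; omega
  subst this
  exact ⟨rfl, by omega⟩

theorem resultSet_apply {w n r : ℕ} {f : ℕ → Bits n} {i : ℕ} (hi : i < r) (j : Fin n) :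
    ((0, 1 + w + i * n + j.val) : Qubit) ∈ resultSet w f r ↔ f i j = true := by
  rw [mem_resultSet]
  constructor
  · rintro ⟨i', -, j', hf, h⟩
    have h' := congrArg Prod.snd h
    simp only at h'
    obtain ⟨rfl, h2⟩ := index_unique (i := i) (i' := i') j.2 j'.2 (by omega)
    rwa [Fin.ext h2]
  · exact fun h => ⟨i, hi, j, h, rfl⟩

/-- The argument qubits: the control qubit and the key wires. -/
def argList (k : ℕ) : List Qubit := (List.range (k + 1)).map fun i => (0, i)

theorem mem_argList {k : ℕ} {q : Qubit} : q ∈ (argList k).toFinset ↔ ∃ i ≤ k, q = (0, i) := by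
  simp [argList, eq_comm]

theorem argList_nodup (k : ℕ) : (argList k).Nodup :=
  List.nodup_range.map fun _ _ h => (Prod.ext_iff.1 h).2

/-- The key that a set of argument qubits represents. -/
def keyOf (k : ℕ) (U : Finset Qubit) : Bits k := readBlock U (0, 1) k

/-- The period: the control qubit and the qubits of the secret key. -/
def period {k : ℕ} (s : Bits k) : Finset Qubit := insert ctrl (blockSupport (0, 1) s)

/-- All operations of one sample. -/
def sampleOps {k n a : ℕ} (C : Circuit k n a) (v : ℕ → ℕ) (r : ℕ) : List Op :=
  (argList k).map (Op.gate ∘ Gate.H) ++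
    (List.range r).flatMap (fun i => stageOps C (fun j => v (i * n + j)) (i * n)) ++
    (argList k).map (Op.gate ∘ Gate.H)

section
variable {k n r a : ℕ} {E : BlockCipher k n} {C : Circuit k n a} {s : Bits k} {m : ℕ → Bits n}
  {v : ℕ → ℕ}

/-- The function whose period is to be found. -/
def cipherPair (E : BlockCipher k n) (s : Bits k) (m : ℕ → Bits n) (U : Finset Qubit) (i : ℕ) :
    Bits n :=
  if ctrl ∈ U then E (keyOf k U) (m i) else relatedKeyOracle E s (keyOf k U) (m i)

/-- A set of argument qubits is a key on the key wires, zero on all other wires, and a control bit.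
Every stage restores the wires, so the stages can be run one after the other, each filling its own
block of the result register. -/
theorem runOps_stages (hC : C.Evaluates E)
    (hv : ∀ i < r, ∀ j : Fin n, v (i * n + j) ≠ 0 ↔ m i j = true) {U : Finset Qubit}
    (hU : U ⊆ (argList k).toFinset) :
    runOps (relatedKeyOracle E s)
      ((List.range r).flatMap fun i => stageOps C (fun j => v (i * n + j)) (i * n)) (ket U) =
      ket (U ∪ resultSet (k + n + n + a) (cipherPair E s m U) r) := by
  set w := k + n + n + a with hw
  have hin : ∀ t : Fin w, wire w t ∈ U ↔ t ∈ Circuit.input a (keyOf k U) fun _ : Fin n => false := by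
    intro t
    by_cases ht : t.val < k
    · rw [mem_input_key ht]
      simp [keyOf, readBlock, wire_apply]
    · constructor
      · intro h
        obtain ⟨i, hi, h'⟩ := mem_argList.1 (hU h)
        have := congrArg Prod.snd h'
        simp only [wire_apply] at this
        omega
      · intro h
        rcases mem_input.1 h with ⟨i, hi, -⟩ | ⟨j, -, h'⟩
        · omega
        · simp at h'
  have hres : ∀ q ∈ resultSet w (cipherPair E s m U) r, 1 + w ≤ q.2 := by
    intro q hq
    obtain ⟨i, -, j, -, rfl⟩ := mem_resultSet.1 hq
    simp only; omega
  -- The outer pattern matters only outside the wires, so `U` itself can serve as `Z`.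
  have hstart : embState (wire w) U (ket (Circuit.input a (keyOf k U) fun _ : Fin n => false)) = ket U :=
    embState_of_iff hin fun _ _ => Iff.rfl
  have key : ∀ l ≤ r, runOps (relatedKeyOracle E s)
      ((List.range l).flatMap fun i => stageOps C (fun j => v (i * n + j)) (i * n)) (ket U) =
      embState (wire w) (U ∪ resultSet w (cipherPair E s m U) l)
        (ket (Circuit.input a (keyOf k U) fun _ : Fin n => false)) := by
    intro l hl
    induction l with
    | zero => simp [runOps_nil, resultSet, hstart]
    | succ l ih =>
      rw [List.range_succ, List.flatMap_append, runOps_append, ih (by omega)]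
      simp only [List.flatMap_cons, List.flatMap_nil, List.append_nil]
      rw [runOps_stage hC (hv l (by omega))]
      congr 1
      have hctrl : ctrl ∈ U ∪ resultSet w (cipherPair E s m U) l ↔ ctrl ∈ U := by
        rw [Finset.mem_union, or_iff_left]
        intro h
        obtain ⟨i, -, j, -, h⟩ := mem_resultSet.1 h
        have := congrArg Prod.snd h
        simp only [ctrl] at this
        omega
      simp only [hctrl]
      have hval : (if ctrl ∈ U then E (keyOf k U) (m l)
          else relatedKeyOracle E s (keyOf k U) (m l)) = cipherPair E s m U l := rfl
      rw [hval]
      -- Block number `l` of the result register is still clear, so adding the new value is a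
      -- disjoint union.
      have hdis : Disjoint (U ∪ resultSet w (cipherPair E s m U) l)
          (blockSupport (0, 1 + w + l * n) (cipherPair E s m U l)) := by
        rw [Finset.disjoint_left]
        intro q h1 h2
        obtain ⟨j, -, rfl⟩ := mem_blockSupport.1 h2
        rcases Finset.mem_union.1 h1 with h1 | h1
        · obtain ⟨i, hi, h'⟩ := mem_argList.1 (hU h1)
          have := congrArg Prod.snd h'
          simp only at this
          omega
        · obtain ⟨i, hi, j', -, h'⟩ := mem_resultSet.1 h1
          have := congrArg Prod.snd h'
          simp only at this
          have := index_lt hi j'.2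
          omega
      rw [hdis.symmDiff_eq_sup]
      simp only [resultSet, Finset.range_add_one, Finset.biUnion_insert, Finset.sup_eq_union]
      rw [Finset.union_assoc, Finset.union_comm (blockSupport _ _)]
  rw [key r le_rfl]
  refine embState_of_iff (fun t => ?_) fun _ _ => Iff.rfl
  rw [Finset.mem_union, hin, or_iff_left]
  intro h
  have := hres _ h
  simp only [wire_apply] at this
  omega

theorem period_subset (s : Bits k) : period s ⊆ (argList k).toFinset := by
  intro q hq
  rcases Finset.mem_insert.1 hq with rfl | hq
  · exact mem_argList.2 ⟨0, Nat.zero_le k, rfl⟩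
  · obtain ⟨i, -, rfl⟩ := mem_blockSupport.1 hq
    exact mem_argList.2 ⟨1 + i.val, by omega, rfl⟩

theorem ctrl_mem_symmDiff_period (U : Finset Qubit) (s : Bits k) :
    ctrl ∈ symmDiff U (period s) ↔ ctrl ∉ U := by
  simp [Finset.mem_symmDiff, period]

theorem mem_period_key {s : Bits k} (i : Fin k) : ((0, 1 + i.val) : Qubit) ∈ period s ↔
    s i = true := by
  rw [period, Finset.mem_insert, mem_blockSupport]
  constructor
  · rintro (h | ⟨j, hj, h⟩)
    · have := congrArg Prod.snd h
      simp only [ctrl] at this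
      omega
    · have := congrArg Prod.snd h
      simp only at this
      rwa [Fin.ext (show i.val = j.val by omega)]
  · exact fun h => Or.inr ⟨i, h, rfl⟩

theorem keyOf_symmDiff_period (U : Finset Qubit) (s : Bits k) :
    keyOf k (symmDiff U (period s)) = xorBits s (keyOf k U) := by
  funext i
  simp only [keyOf, readBlock, xorBits, Finset.mem_symmDiff, mem_period_key]
  by_cases h : ((0, 1 + i.val) : Qubit) ∈ U <;> cases hs : s i <;> simp [h]

theorem xorBits_xorBits (x y : Bits k) : xorBits x (xorBits x y) = y := by
  funext i
  simp [xorBits]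

/-- Translation flips the control bit and replaces `K` by `s ⊕ K`. In one direction this gives
`E_{s⊕K}`, which is the oracle's answer to `K`; in the other the oracle's mask cancels and leaves
`E_K`. -/
theorem cipherPair_period (U : Finset Qubit) :
    cipherPair E s m (symmDiff U (period s)) = cipherPair E s m U := by
  funext i
  simp only [cipherPair, ctrl_mem_symmDiff_period, keyOf_symmDiff_period, relatedKeyOracle,
    xorBits_xorBits]
  by_cases h : ctrl ∈ U <;> simp [h]

theorem ext_arg {U V : Finset Qubit} (hU : U ⊆ (argList k).toFinset)
    (hV : V ⊆ (argList k).toFinset) (hc : ctrl ∈ U ↔ ctrl ∈ V) (hk : keyOf k U = keyOf k V) :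
    U = V := by
  have key : ∀ i ≤ k, ((0, i) : Qubit) ∈ U ↔ ((0, i) : Qubit) ∈ V := by
    intro i hi
    cases i with
    | zero => exact hc
    | succ i =>
      have := congrFun hk ⟨i, hi⟩
      simp only [keyOf, readBlock, decide_eq_decide] at this
      rwa [add_comm 1 i] at this
  ext q
  constructor
  · intro h
    obtain ⟨i, hi, rfl⟩ := mem_argList.1 (hU h)
    exact (key i hi).1 h
  · intro h
    obtain ⟨i, hi, rfl⟩ := mem_argList.1 (hV h)
    exact (key i hi).2 h

/-- For equal control bits the keys agree because the plaintexts determine the key, after cancelling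
`s` in the oracle case. For different control bits the period is added to one argument first. -/
theorem cipherPair_injective (hdet : ∀ K K', (∀ i < r, E K (m i) = E K' (m i)) → K = K')
    {U V : Finset Qubit} (hU : U ⊆ (argList k).toFinset) (hV : V ⊆ (argList k).toFinset)
    (h : ∀ i < r, cipherPair E s m U i = cipherPair E s m V i) :
    V = U ∨ V = symmDiff U (period s) := by
  have same : ∀ {U V : Finset Qubit}, U ⊆ (argList k).toFinset → V ⊆ (argList k).toFinset →
      (∀ i < r, cipherPair E s m U i = cipherPair E s m V i) → (ctrl ∈ U ↔ ctrl ∈ V) → V = U := by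
    intro U V hU hV h hc
    refine ext_arg hV hU hc.symm ?_
    by_cases hcU : ctrl ∈ U
    · have hcV := hc.1 hcU
      refine (hdet _ _ fun i hi => ?_).symm
      simpa [cipherPair, hcU, hcV] using h i hi
    · have hcV : ctrl ∉ V := fun h => hcU (hc.2 h)
      have : xorBits s (keyOf k U) = xorBits s (keyOf k V) := by
        refine hdet _ _ fun i hi => ?_
        simpa [cipherPair, hcU, hcV, relatedKeyOracle] using h i hi
      rw [← xorBits_xorBits s (keyOf k V), ← this, xorBits_xorBits]
  by_cases hc : ctrl ∈ U ↔ ctrl ∈ V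
  · exact Or.inl (same hU hV h hc)
  · right
    refine same ?_ hV ?_ ?_
    · exact (symmDiff_le_sup : symmDiff U (period s) ≤ _).trans (sup_le hU (period_subset s))
    · intro i hi
      rw [cipherPair_period, h i hi]
    · rw [ctrl_mem_symmDiff_period]
      tauto

/-- The state before the measurement: it lives on the first qubits, measured strings are
orthogonal to the period, and their distribution is invariant under shifts that are orthogonal to
the period. -/
theorem sample_state (hC : C.Evaluates E)
    (hv : ∀ i < r, ∀ j : Fin n, v (i * n + j) ≠ 0 ↔ m i j = true)
    (hdet : ∀ K K', (∀ i < r, E K (m i) = E K' (m i)) → K = K') :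
    (∀ S, runOps (relatedKeyOracle E s) (sampleOps C v r) (ket ∅) S ≠ 0 →
      (∀ q ∈ S, q.1 = 0 ∧ q.2 < 1 + (k + n + n + a) + r * n) ∧ Even (period s ∩ S).card) ∧
    ∀ e ⊆ (argList k).toFinset, Even (period s ∩ e).card → ∀ S,
      ‖runOps (relatedKeyOracle E s) (sampleOps C v r) (ket ∅) (symmDiff S e)‖ =
        ‖runOps (relatedKeyOracle E s) (sampleOps C v r) (ket ∅) S‖ := by
  set w := k + n + n + a with hw
  have hdis : ∀ U ⊆ (argList k).toFinset,
      Disjoint (resultSet w (cipherPair E s m U) r) (argList k).toFinset := by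
    intro U _
    rw [Finset.disjoint_left]
    intro q h1 h2
    obtain ⟨i, hi, j', -, rfl⟩ := mem_resultSet.1 h1
    obtain ⟨i, hi, h'⟩ := mem_argList.1 h2
    have := congrArg Prod.snd h'
    simp only at this
    omega
  have amp := period_amplitude (O := relatedKeyOracle E s) (argList_nodup k) hdis
    (fun U hU => runOps_stages (s := s) hC hv hU)
  constructor
  · intro S hS
    rw [sampleOps, amp] at hS
    have hsum := right_ne_zero_of_mul hS
    refine ⟨?_, period_orthogonal (period_subset s)
      (fun U _ => by rw [cipherPair_period]) hsum⟩
    obtain ⟨U, hU, hne⟩ := Finset.exists_ne_zero_of_sum_ne_zero hsum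
    have hF : resultSet w (cipherPair E s m U) r = S \ (argList k).toFinset := by
      by_contra h; simp [h] at hne
    intro q hq
    by_cases hqa : q ∈ (argList k).toFinset
    · obtain ⟨i, hi, rfl⟩ := mem_argList.1 hqa
      exact ⟨rfl, by simp only; omega⟩
    · have : q ∈ resultSet w (cipherPair E s m U) r := by
        rw [hF]; exact Finset.mem_sdiff.2 ⟨hq, hqa⟩
      obtain ⟨i, hi, j, -, rfl⟩ := mem_resultSet.1 this
      have := index_lt hi j.2
      exact ⟨rfl, by simp only; omega⟩
  · intro e he hev S
    rw [sampleOps, amp, amp, norm_mul _ (Finset.sum _ _), norm_mul _ (Finset.sum _ _),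
      period_shift (D := period s) he ?_ hev]
    -- Equal result sets mean equal blocks, bit by bit, so the fibres of the set-valued function are
    -- those of `cipherPair`.
    intro U hU V hV h
    refine cipherPair_injective hdet hU hV fun i hi => funext fun j => ?_
    have h1 := resultSet_apply (w := w) (f := cipherPair E s m U) hi j
    have h2 := resultSet_apply (w := w) (f := cipherPair E s m V) hi j
    rw [h, h2] at h1
    exact Bool.eq_iff_iff.2 h1.symm

end

/-! ## The program

Array `8` holds a measured string, array `9` a matrix over `ZMod 2` whose rows start at the places
listed in array `10`, and variable `11` the number of rows still to be eliminated. -/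

/-- The key length. -/
def keyLen : Expr := .get 0 (.lit 0)

/-- The block length. -/
def blockLen : Expr := .get 0 (.lit 1)

/-- The number of plaintexts. -/
def plainCount : Expr := .get 0 (.lit 2)

/-- The number of gates of the circuit. -/
def gateCount : Expr := .get 0 (.lit 4)

/-- The number of wires of the circuit. -/
def wireCount : Expr := .add (.add (.add keyLen blockLen) blockLen) (.get 0 (.lit 3))

/-- Exclusive or of bits. -/
def xorExpr (e f : Expr) : Expr := .add (.sub e f) (.sub f e)

/-- Conjunction of bits. -/
def andExpr (e f : Expr) : Expr := .sub e (.sub (.lit 1) f)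

/-- Hadamard gates on the argument qubits. -/
def hadamardCmd : Cmd := forLoop 13 (.add keyLen (.lit 1)) (.gate (.H (0, var 13)))

/-- Add the current plaintext to the plaintext wires. -/
def plainCmd : Cmd :=
  forLoop 13 blockLen (.ite (.get 5 (.add (var 15) (var 13)))
    (.gate (.X (0, .add (.lit 1) (.add keyLen (var 13))))) skip)

/-- The place of operand number `j` of gate number `i`. -/
def operandAddr (j : ℕ) (i : Expr) : QAddr := (0, .add (.lit 1) (.get (2 + j) i))

/-- Apply gate number `i` of the circuit, or its inverse. -/
def gateCmd (inverse : Bool) (i : Expr) : Cmd :=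
  .ite (.get 1 i)
    (.ite (.sub (.get 1 i) (.lit 1))
      (.ite (.sub (.get 1 i) (.lit 2))
        (.ite (.sub (.get 1 i) (.lit 3))
          (.ite (.sub (.get 1 i) (.lit 4))
            (.gate (.CCX (operandAddr 0 i) (operandAddr 1 i) (operandAddr 2 i)))
            (.gate (.CX (operandAddr 0 i) (operandAddr 1 i))))
          (.gate (if inverse then .T (operandAddr 0 i) else .Tinv (operandAddr 0 i))))
        (.gate (if inverse then .Tinv (operandAddr 0 i) else .T (operandAddr 0 i))))
      (.gate (.H (operandAddr 0 i))))
    (.gate (.X (operandAddr 0 i)))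

/-- Execute the circuit. -/
def circuitCmd : Cmd := forLoop 13 gateCount (gateCmd false (var 13))

/-- Execute the inverse of the circuit. -/
def inverseCmd : Cmd :=
  forLoop 13 gateCount (gateCmd true (.sub (.sub gateCount (.lit 1)) (var 13)))

/-- Copy the ciphertext wires to the result register if the control qubit is set. -/
def copyCmd : Cmd :=
  forLoop 13 blockLen (.gate (.CCX (0, .lit 0)
    (0, .add (.lit 1) (.add (.add keyLen blockLen) (var 13)))
    (0, .add (.add (.add (.lit 1) wireCount) (var 15)) (var 13))))

/-- Query the oracle on the wires of the circuit. -/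
def queryCmd : Cmd :=
  .query (0, .lit 1) (0, .add (.lit 1) keyLen) (0, .add (.add (.lit 1) keyLen) blockLen)

/-- Flip the control qubit. -/
def flipCmd : Cmd := .gate (.X (0, .lit 0))

/-- Evaluate the periodic function for one plaintext. -/
def stageCmd : Cmd :=
  .seq plainCmd (.seq circuitCmd (.seq copyCmd (.seq inverseCmd (.seq flipCmd (.seq queryCmd
    (.seq copyCmd (.seq queryCmd (.seq flipCmd plainCmd))))))))

/-- Prepare the state that is measured. -/
def sampleCmd : Cmd :=
  .seq hadamardCmd (.seq (setVar 15 (.lit 0)) (.seq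
    (forLoop 12 plainCount (.seq stageCmd (setVar 15 (.add (var 15) blockLen)))) hadamardCmd))

/-- Measure and reset qubit number `13`. -/
def measureQubit : Cmd :=
  .seq (.measure (0, var 13) 8 (var 13)) (.ite (.get 8 (var 13)) (.gate (.X (0, var 13))) skip)

/-- Measure and reset all the qubits in use. -/
def measureCmd : Cmd :=
  forLoop 13 (.add (.add (.lit 1) wireCount) (var 15)) measureQubit

/-- Compute the scalar product of the measured string and row `j`. -/
def dotCmd (j : Expr) : Cmd :=
  .seq (setVar 16 (.lit 0)) (forLoop 14 (.add keyLen (.lit 1)) (setVar 16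
    (xorExpr (var 16) (andExpr (.get 8 (var 14)) (.get 9 (.add (.get 10 j) (var 14)))))))

/-- Add the pivot row, multiplied by variable `16`, to row number `13`. -/
def addRowCmd : Cmd :=
  forLoop 14 (.add keyLen (.lit 1)) (.assign 9 (.add (.get 10 (var 13)) (var 14))
    (xorExpr (.get 9 (.add (.get 10 (var 13)) (var 14)))
      (andExpr (var 16) (.get 9 (.add (.get 10 (var 11)) (var 14))))))

/-- Eliminate the last row if the measured string is not orthogonal to it. -/
def eliminateCmd : Cmd :=
  .seq (dotCmd (var 11)) (.ite (var 16)
    (.seq (forLoop 13 (var 11) (.seq (dotCmd (var 13)) addRowCmd))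
      (setVar 11 (.sub (var 11) (.lit 1)))) skip)

/-- Initialize the matrix. -/
def initCmd : Cmd :=
  .seq (setVar 15 (.lit 0)) (.seq
    (forLoop 13 (.add keyLen (.lit 1)) (.seq (.assign 10 (var 13) (var 15))
      (.seq (.assign 9 (.add (var 15) (var 13)) (.lit 1))
        (setVar 15 (.add (var 15) (.add keyLen (.lit 1)))))))
    (setVar 11 keyLen))

/-- Write the output. -/
def outputCmd : Cmd :=
  forLoop 13 keyLen (.assign 7 (var 13) (.get 9 (.add (.lit 1) (var 13))))

/-- Take one sample and process it. -/
def roundCmd : Cmd := .seq sampleCmd (.seq measureCmd eliminateCmd)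

/-- The attack. -/
def attack : Cmd := .seq initCmd (.seq (.loop (var 11) roundCmd) outputCmd)

/-! ## Specifications of the quantum part -/

/-- The memory holds the input of the attack, with the plaintexts `v`. -/
structure HasInput {k n a : ℕ} (C : Circuit k n a) (v : ℕ → ℕ) (r : ℕ) (mem : Mem) : Prop where
  key : mem 0 0 = k
  block : mem 0 1 = n
  plains : mem 0 2 = r
  ancillas : mem 0 3 = a
  gates : mem 0 4 = C.gates.length
  code : ∀ i g, C.gates[i]? = some g →
    mem 1 i = g.opcode ∧ mem 2 i = g.operand 0 ∧ mem 3 i = g.operand 1 ∧ mem 4 i = g.operand 2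
  plain : mem 5 = v

section
variable {k n a r : ℕ} {C : Circuit k n a} {v : ℕ → ℕ} {mem : Mem}
  {O : Bits k → Bits n → Bits n}

theorem HasInput.agree (h : HasInput C v r mem) {A : List ℕ} {m : Mem} (hm : Agree A m mem)
    (hA : ∀ b < 6, b ∉ A) : HasInput C v r m := by
  have e : ∀ b < 6, m b = mem b := fun b hb => hm b (hA b hb)
  have e0 := e 0 (by norm_num)
  have e1 := e 1 (by norm_num)
  have e2 := e 2 (by norm_num)
  have e3 := e 3 (by norm_num)
  have e4 := e 4 (by norm_num)
  have e5 := e 5 (by norm_num)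
  constructor
  · rw [e0, h.key]
  · rw [e0, h.block]
  · rw [e0, h.plains]
  · rw [e0, h.ancillas]
  · rw [e0, h.gates]
  · rw [e1, e2, e3, e4]; exact h.code
  · rw [e5, h.plain]

theorem HasInput.eval_keyLen (h : HasInput C v r mem) : keyLen.eval mem = k := h.key
theorem HasInput.eval_blockLen (h : HasInput C v r mem) : blockLen.eval mem = n := h.block
theorem HasInput.eval_plainCount (h : HasInput C v r mem) : plainCount.eval mem = r := h.plains
theorem HasInput.eval_gateCount (h : HasInput C v r mem) :
    gateCount.eval mem = C.gates.length := h.gates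
theorem HasInput.eval_wireCount (h : HasInput C v r mem) :
    wireCount.eval mem = k + n + n + a := by
  simp [wireCount, Expr.eval, h.eval_keyLen, h.eval_blockLen, h.ancillas]

theorem eval_var (mem : Mem) (x : ℕ) : (var x).eval mem = mem x 0 := rfl

theorem Runs.ite_pos {e : Expr} {c d : Cmd} {ops : List Op} {T : ℕ} {Q : Mem → Prop}
    (he : e.eval mem ≠ 0) (h : Runs O c mem ops T Q) : Runs O (.ite e c d) mem ops (T + 1) Q :=
  Runs.ite (by rwa [if_pos he])

theorem Runs.ite_neg {e : Expr} {c d : Cmd} {ops : List Op} {T : ℕ} {Q : Mem → Prop}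
    (he : e.eval mem = 0) (h : Runs O d mem ops T Q) : Runs O (.ite e c d) mem ops (T + 1) Q :=
  Runs.ite (by rwa [if_neg (not_not.2 he)])

theorem Runs.gate' {g : Gate QAddr} {g' : Gate Qubit} {Q : Mem → Prop} (h : Q mem)
    (hg : g.map (QAddr.eval mem) = g') : Runs O (.gate g) mem [.gate g'] 1 Q :=
  hg ▸ Runs.gate h

/-- A loop whose body changes only the arrays in `A`. -/
theorem Runs.forLoop_agree {x : ℕ} {len : Expr} {c : Cmd} (A : List ℕ) (hx : x ∈ A)
    (ops : ℕ → List Op) (l T : ℕ) (hlen : ∀ m, Agree A m mem → len.eval m = l)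
    (hc : ∀ i < l, ∀ m, Agree A m mem → m x 0 = i →
      Runs O c m (ops i) T fun m' => m' x 0 = i ∧ Agree A m' mem) :
    Runs O (RelatedKey.forLoop x len c) mem ((List.range l).flatMap ops) (l * (T + 3) + 3)
      fun m => Agree A m mem :=
  Runs.forLoop (fun _ m => Agree A m mem) ops l T ((Agree.refl A mem).set hx)
    (fun _ _ m hm => hlen m hm)
    fun i hi m hm hv => (hc i hi m hm hv).mono le_rfl fun _ h => ⟨h.1, h.2.set hx⟩

theorem runs_hadamard (h : HasInput C v r mem) :
    Runs O hadamardCmd mem ((argList k).map (Op.gate ∘ Gate.H)) ((k + 1) * 4 + 3)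
      fun m => Agree [13] m mem := by
  have e : (argList k).map (Op.gate ∘ Gate.H) =
      (List.range (k + 1)).flatMap fun i => [Op.gate (.H (0, i))] := by
    rw [argList, List.map_map, List.map_eq_flatMap]
    rfl
  rw [e]
  refine Runs.forLoop_agree [13] (by simp) _ (k + 1) 1 (fun m hm => ?_) fun i hi m hm hv => ?_
  · have := h.agree hm (by decide)
    simp [Expr.eval, this.eval_keyLen]
  · exact Runs.gate' ⟨hv, hm⟩ (by simp [Gate.map, QAddr.eval, eval_var, hv])

theorem runs_plain (h : HasInput C v r mem) {p : ℕ} (hp : mem 15 0 = p) :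
    Runs O plainCmd mem (plainOps k n fun j => v (p + j)) (n * 5 + 3)
      fun m => Agree [13, 20] m mem := by
  refine Runs.forLoop_agree [13, 20] (by simp) _ n 2 (fun m hm => ?_) fun i hi m hm hv => ?_
  · exact (h.agree hm (by decide)).eval_blockLen
  · have h' := h.agree hm (by decide)
    have hp' : m 15 0 = p := by rw [hm 15 (by decide), hp]
    have he : (Expr.get 5 (.add (var 15) (var 13))).eval m = v (p + i) := by
      simp [Expr.eval, eval_var, hv, hp', h'.plain]
    by_cases hi : v (p + i) = 0
    · rw [if_neg (not_not.2 hi)]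
      refine Runs.ite_neg (by rw [he, hi]) (Runs.skip ⟨?_, hm.set (by simp)⟩)
      rw [Mem.set_array_ne _ _ _ (by decide), hv]
    · rw [if_pos hi]
      refine Runs.ite_pos (by rwa [he]) (Runs.gate' ⟨hv, hm⟩ ?_)
      simp [Gate.map, QAddr.eval, Expr.eval, eval_var, hv, h'.eval_keyLen]

/-- The opcode is identified by truncated subtractions: `opcode - j` is nonzero iff the opcode
exceeds `j`. The bound `6` covers at most five tests and the gate itself. -/
theorem runs_gate (h : HasInput C v r mem) {i : Expr} {g : Gate (Fin (k + n + n + a))}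
    (hg : C.gates[i.eval mem]? = some g) (inverse : Bool) {Q : Mem → Prop} (hQ : Q mem) :
    Runs O (gateCmd inverse i) mem
      [.gate ((if inverse then g.inv else g).map (wire _))] 6 Q := by
  obtain ⟨h1, h2, h3, h4⟩ := h.code _ _ hg
  have e0 : (operandAddr 0 i).eval mem = (0, 1 + g.operand 0) := by
    simp [operandAddr, QAddr.eval, Expr.eval, h2]
  have e1 : (operandAddr 1 i).eval mem = (0, 1 + g.operand 1) := by
    simp [operandAddr, QAddr.eval, Expr.eval, h3]
  have e2 : (operandAddr 2 i).eval mem = (0, 1 + g.operand 2) := by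
    simp [operandAddr, QAddr.eval, Expr.eval, h4]
  unfold gateCmd
  cases g with
  | X t =>
    refine (Runs.ite_neg (T := 1) (by simp [Expr.eval, h1, Gate.opcode])
      (Runs.gate' hQ ?_)).mono (by norm_num) fun _ h => h
    cases inverse <;> simp [Gate.map, e0, Gate.operand, Gate.operands, Gate.inv, wire_apply]
  | H t =>
    refine (Runs.ite_pos (T := 2) (by simp [Expr.eval, h1, Gate.opcode])
      (Runs.ite_neg (by simp [Expr.eval, h1, Gate.opcode])
      (Runs.gate' hQ ?_))).mono (by norm_num) fun _ h => h
    cases inverse <;> simp [Gate.map, e0, Gate.operand, Gate.operands, Gate.inv, wire_apply]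
  | T t =>
    refine (Runs.ite_pos (T := 3) (by simp [Expr.eval, h1, Gate.opcode])
      (Runs.ite_pos (by simp [Expr.eval, h1, Gate.opcode])
      (Runs.ite_neg (by simp [Expr.eval, h1, Gate.opcode])
      (Runs.gate' hQ ?_)))).mono (by norm_num) fun _ h => h
    cases inverse <;> simp [Gate.map, e0, Gate.operand, Gate.operands, Gate.inv, wire_apply]
  | Tinv t =>
    refine (Runs.ite_pos (T := 4) (by simp [Expr.eval, h1, Gate.opcode])
      (Runs.ite_pos (by simp [Expr.eval, h1, Gate.opcode])
      (Runs.ite_pos (by simp [Expr.eval, h1, Gate.opcode])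
      (Runs.ite_neg (by simp [Expr.eval, h1, Gate.opcode])
      (Runs.gate' hQ ?_))))).mono (by norm_num) fun _ h => h
    cases inverse <;> simp [Gate.map, e0, Gate.operand, Gate.operands, Gate.inv, wire_apply]
  | CX c t =>
    refine (Runs.ite_pos (T := 5) (by simp [Expr.eval, h1, Gate.opcode])
      (Runs.ite_pos (by simp [Expr.eval, h1, Gate.opcode])
      (Runs.ite_pos (by simp [Expr.eval, h1, Gate.opcode])
      (Runs.ite_pos (by simp [Expr.eval, h1, Gate.opcode])
      (Runs.ite_neg (by simp [Expr.eval, h1, Gate.opcode])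
      (Runs.gate' hQ ?_)))))).mono (by norm_num) fun _ h => h
    cases inverse <;> simp [Gate.map, e0, e1, Gate.operand, Gate.operands, Gate.inv, wire_apply]
  | CCX c d t =>
    refine (Runs.ite_pos (T := 5) (by simp [Expr.eval, h1, Gate.opcode])
      (Runs.ite_pos (by simp [Expr.eval, h1, Gate.opcode])
      (Runs.ite_pos (by simp [Expr.eval, h1, Gate.opcode])
      (Runs.ite_pos (by simp [Expr.eval, h1, Gate.opcode])
      (Runs.ite_pos (by simp [Expr.eval, h1, Gate.opcode])
      (Runs.gate' hQ ?_)))))).mono (by norm_num) fun _ h => h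
    cases inverse <;>
      simp [Gate.map, e0, e1, e2, Gate.operand, Gate.operands, Gate.inv, wire_apply]

/-- This turns the list of operations of a circuit into the indexed form produced by the rule for
counting loops. -/
theorem flatMap_getElem? {α β : Type} (l : List α) (f : α → β) :
    (List.range l.length).flatMap (fun i => (l[i]?).toList.map f) = l.map f := by
  induction l with
  | nil => rfl
  | cons x l ih =>
    rw [List.length_cons, List.range_succ_eq_map, List.flatMap_cons, List.flatMap_map]
    simpa using ih

theorem runs_circuit (h : HasInput C v r mem) :
    Runs O circuitCmd mem (circuitOps C.gates) (C.gates.length * 9 + 3)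
      fun m => Agree [13] m mem := by
  rw [circuitOps, ← flatMap_getElem?]
  refine Runs.forLoop_agree [13] (by simp) _ C.gates.length 6 (fun m hm => ?_)
    fun i hi m hm hv => ?_
  · exact (h.agree hm (by decide)).eval_gateCount
  · have hg : C.gates[(var 13).eval m]? = some C.gates[i] := by
      rw [eval_var, hv, List.getElem?_eq_getElem hi]
    have := runs_gate (O := O) (h.agree hm (by decide)) hg false
      (Q := fun m' => m' 13 0 = i ∧ Agree [13] m' mem) ⟨hv, hm⟩
    simpa [List.getElem?_eq_getElem hi] using this

theorem runs_inverse (h : HasInput C v r mem) :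
    Runs O inverseCmd mem (circuitOps (C.gates.reverse.map Gate.inv)) (C.gates.length * 9 + 3)
      fun m => Agree [13] m mem := by
  rw [circuitOps, List.map_map, ← flatMap_getElem?, List.length_reverse]
  refine Runs.forLoop_agree [13] (by simp) _ C.gates.length 6 (fun m hm => ?_)
    fun i hi m hm hv => ?_
  · exact (h.agree hm (by decide)).eval_gateCount
  · have h' := h.agree hm (by decide)
    -- Iteration `i` of the inverse circuit uses gate `G - 1 - i`, where `G` is the number of gates.
    -- The subtractions do not truncate because `i < G`.
    have hg : C.gates[(Expr.sub (.sub gateCount (.lit 1)) (var 13)).eval m]? =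
        some C.gates[C.gates.length - 1 - i] := by
      simp only [Expr.eval, eval_var, hv, h'.eval_gateCount]
      rw [List.getElem?_eq_getElem (by omega)]
    have := runs_gate (O := O) h' hg true
      (Q := fun m' => m' 13 0 = i ∧ Agree [13] m' mem) ⟨hv, hm⟩
    rw [List.getElem?_reverse hi, List.getElem?_eq_getElem (by omega)]
    simpa using this

theorem runs_copy (h : HasInput C v r mem) {p : ℕ} (hp : mem 15 0 = p) :
    Runs O copyCmd mem (copyOps k n (k + n + n + a) p) (n * 4 + 3)
      fun m => Agree [13] m mem := by
  refine Runs.forLoop_agree [13] (by simp) _ n 1 (fun m hm => ?_) fun i hi m hm hv => ?_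
  · exact (h.agree hm (by decide)).eval_blockLen
  · have h' := h.agree hm (by decide)
    have hp' : m 15 0 = p := by rw [hm 15 (by decide), hp]
    refine Runs.gate' ⟨hv, hm⟩ ?_
    simp [Gate.map, QAddr.eval, Expr.eval, eval_var, hv, h'.eval_keyLen, h'.eval_blockLen,
      h'.eval_wireCount, hp', ctrl]

theorem runs_query (h : HasInput C v r mem) {Q : Mem → Prop} (hQ : Q mem) :
    Runs O queryCmd mem [queryOp k n] 1 Q := by
  have := Runs.query (O := O) (L := (0, .lit 1)) (x := (0, .add (.lit 1) keyLen))
    (y := (0, .add (.add (.lit 1) keyLen) blockLen)) hQ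
  simp only [QAddr.eval, Expr.eval, h.eval_keyLen, h.eval_blockLen] at this
  exact this

theorem runs_flip {Q : Mem → Prop} (hQ : Q mem) :
    Runs O flipCmd mem [.gate (.X ctrl)] 1 Q :=
  Runs.gate' hQ rfl

/-- A bound for the time to evaluate the periodic function for one plaintext. -/
def stageTime (n G : ℕ) : ℕ := n * 18 + G * 18 + 40

/-- The same offset `p` in variable `15` locates the plaintext in array `5` and its block in the
result register, since both consist of consecutive blocks of length `n`. -/
theorem runs_stage (h : HasInput C v r mem) {p : ℕ} (hp : mem 15 0 = p) :
    Runs O stageCmd mem (stageOps C (fun j => v (p + j)) p) (stageTime n C.gates.length)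
      fun m => Agree [13, 20] m mem := by
  have hA : ∀ m, Agree [13, 20] m mem → HasInput C v r m ∧ m 15 0 = p := fun m hm =>
    ⟨h.agree hm (by decide), by rw [hm 15 (by decide), hp]⟩
  have tr : ∀ {m m'}, Agree [13, 20] m mem → Agree [13] m' m → Agree [13, 20] m' mem :=
    fun hm hm' => (hm'.mono (by simp)).trans hm
  refine (Runs.seq (T₂ := C.gates.length * 18 + n * 13 + 27)
    ((runs_plain h hp).mono le_rfl fun m₁ h₁ => ?_)).mono (by simp only [stageTime]; omega)
    fun _ h => h
  refine (Runs.seq (T₂ := C.gates.length * 9 + n * 13 + 23)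
    ((runs_circuit (hA _ h₁).1).mono le_rfl fun m₂ h₂' => ?_)).mono (by omega) fun _ h => h
  have h₂ := tr h₁ h₂'
  refine (Runs.seq (T₂ := C.gates.length * 9 + n * 9 + 19)
    ((runs_copy (hA _ h₂).1 (hA _ h₂).2).mono le_rfl fun m₃ h₃' => ?_)).mono (by omega)
    fun _ h => h
  have h₃ := tr h₂ h₃'
  refine (Runs.seq (T₂ := n * 9 + 15)
    ((runs_inverse (hA _ h₃).1).mono le_rfl fun m₄ h₄' => ?_)).mono (by omega) fun _ h => h
  have h₄ := tr h₃ h₄'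
  refine (Runs.seq (T₂ := n * 9 + 13) (runs_flip ?_)).mono (by omega) fun _ h => h
  refine (Runs.seq (T₂ := n * 9 + 11) (runs_query (hA _ h₄).1 ?_)).mono (by omega) fun _ h => h
  refine (Runs.seq (T₂ := n * 5 + 7)
    ((runs_copy (hA _ h₄).1 (hA _ h₄).2).mono le_rfl fun m₅ h₅' => ?_)).mono (by omega)
    fun _ h => h
  have h₅ := tr h₄ h₅'
  refine (Runs.seq (T₂ := n * 5 + 5) (runs_query (hA _ h₅).1 ?_)).mono (by omega) fun _ h => h
  refine (Runs.seq (T₂ := n * 5 + 3) (runs_flip ?_)).mono (by omega) fun _ h => h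
  exact (runs_plain (hA _ h₅).1 (hA _ h₅).2).mono le_rfl fun m hm => hm.trans h₅

/-- A bound for the time to prepare the state that is measured. -/
def sampleTime (k n r G : ℕ) : ℕ := r * (stageTime n G + 5) + k * 8 + 21

/-- The machine has no multiplication, so the offset `i * n` is accumulated in variable `15`. Its
final value `r * n` is recorded because the measurement loop uses it as the length of the result
register. -/
theorem runs_sample (h : HasInput C v r mem) :
    Runs O sampleCmd mem (sampleOps C v r) (sampleTime k n r C.gates.length)
      fun m => Agree [12, 13, 15, 20] m mem ∧ m 15 0 = r * n := by
  have hA : ∀ m, Agree [12, 13, 15, 20] m mem → HasInput C v r m := fun m hm =>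
    h.agree hm (by decide)
  -- The empty lists stand for the assignments, so that the list has the shape produced by
  -- `Runs.seq`.
  have e : sampleOps C v r = (argList k).map (Op.gate ∘ Gate.H) ++ ([] ++
      ((List.range r).flatMap (fun i => stageOps C (fun j => v (i * n + j)) (i * n) ++ []) ++
        (argList k).map (Op.gate ∘ Gate.H))) := by
    simp only [sampleOps, List.append_nil, List.nil_append, List.append_assoc]
  rw [e]
  refine (Runs.seq (T₂ := r * (stageTime n C.gates.length + 5) + k * 4 + 13)
    ((runs_hadamard h).mono le_rfl fun m₁ h₁' => ?_)).mono
    (by simp only [sampleTime]; omega) fun _ h => h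
  have h₁ : Agree [12, 13, 15, 20] m₁ mem := h₁'.mono (by simp)
  refine (Runs.seq (T₁ := 1) (T₂ := r * (stageTime n C.gates.length + 5) + k * 4 + 11)
    (Runs.assign ?_)).mono (by omega) fun _ h => h
  refine (Runs.seq (T₁ := r * (stageTime n C.gates.length + 2 + 3) + 3) (T₂ := (k + 1) * 4 + 3)
    ((Runs.forLoop (fun i m => Agree [12, 13, 15, 20] m mem ∧ m 15 0 = i * n) _ r
      (stageTime n C.gates.length + 2) ?_ ?_ ?_).mono le_rfl ?_)).mono
    (by rw [add_assoc (stageTime n _)]; omega) fun _ h => h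
  · refine ⟨(h₁.set (by simp)).set (by simp), ?_⟩
    simp [Mem.set, Expr.eval]
  · intro i hi m hm
    exact (hA m hm.1).eval_plainCount
  · intro i hi m hm hv
    refine (Runs.seq (T₂ := 1) ((runs_stage (hA m hm.1) hm.2).mono le_rfl fun m' hm' => ?_))
    refine Runs.assign ?_
    have h' : Agree [12, 13, 15, 20] m' mem := (hm'.mono (by simp)).trans hm.1
    have h15 : m' 15 0 = i * n := by rw [hm' 15 (by decide), hm.2]
    have h12 : m' 12 0 = i := by rw [hm' 12 (by decide), hv]
    refine ⟨?_, (h'.set (by simp)).set (by simp), ?_⟩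
    · simp [Mem.set, h12]
    · have := (hA m' h').eval_blockLen
      simp [Mem.set, Expr.eval, eval_var, h15, this, Nat.succ_mul]
  · intro m hm
    refine (runs_hadamard (hA m hm.1)).mono le_rfl fun m' hm' => ⟨?_, ?_⟩
    · exact (hm'.mono (by simp)).trans hm.1
    · rw [hm' 15 (by decide), hm.2]

end

/-! ## Specifications of the classical part -/

/-- The scalar product of the first `k + 1` entries. -/
def dot (k : ℕ) (y u : ℕ → ZMod 2) : ZMod 2 := ∑ i ∈ Finset.range (k + 1), y i * u i

/-- The matrix `u` is stored in the memory. -/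
structure HasRows (k : ℕ) (u : ℕ → ℕ → ZMod 2) (mem : Mem) : Prop where
  offset : ∀ j ≤ k, mem 10 j = j * (k + 1)
  entry : ∀ j ≤ k, ∀ i ≤ k, mem 9 (j * (k + 1) + i) = (u j i).val

theorem HasRows.agree {k : ℕ} {u : ℕ → ℕ → ZMod 2} {m mem : Mem} (h : HasRows k u mem)
    (h9 : m 9 = mem 9) (h10 : m 10 = mem 10) : HasRows k u m :=
  ⟨by rw [h10]; exact h.offset, by rw [h9]; exact h.entry⟩

/-- With truncated subtraction, `(x - y) + (y - x)` is the distance of two bits, which is their sum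
modulo two. -/
theorem eval_xorExpr {mem : Mem} {e f : Expr} {x y : ZMod 2} (he : e.eval mem = x.val)
    (hf : f.eval mem = y.val) : (xorExpr e f).eval mem = (x + y).val := by
  have : ∀ x y : ZMod 2, (x.val - y.val) + (y.val - x.val) = (x + y).val := by decide
  simp only [xorExpr, Expr.eval, he, hf, this]

theorem eval_andExpr {mem : Mem} {e f : Expr} {x y : ZMod 2} (he : e.eval mem = x.val)
    (hf : f.eval mem = y.val) : (andExpr e f).eval mem = (x * y).val := by
  have : ∀ x y : ZMod 2, x.val - (1 - y.val) = (x * y).val := by decide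
  simp only [andExpr, Expr.eval, he, hf, this]

section
variable {k n a r : ℕ} {C : Circuit k n a} {v : ℕ → ℕ} {mem : Mem}
  {O : Bits k → Bits n → Bits n} {u : ℕ → ℕ → ZMod 2} {y : ℕ → ZMod 2}

/-- A bound for the time to compute a scalar product. -/
def dotTime (k : ℕ) : ℕ := (k + 1) * 4 + 5

/-- The row index is an expression that is evaluated anew in every iteration; hence the hypothesis
`he` for all memories that differ only in the two working variables. -/
theorem runs_dot (h : HasInput C v r mem) (hu : HasRows k u mem)
    (hy : ∀ i ≤ k, mem 8 i = (y i).val) {e : Expr} {j : ℕ} (hj : j ≤ k)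
    (he : ∀ m, Agree [14, 16] m mem → e.eval m = j) :
    Runs O (dotCmd e) mem [] (dotTime k)
      fun m => Agree [14, 16] m mem ∧ m 16 0 = (dot k y (u j)).val := by
  rw [← List.nil_append ([] : List Op)]
  refine (Runs.seq (T₁ := 1) (T₂ := (k + 1) * (1 + 3) + 3) (Runs.assign ?_)).mono
    (by simp only [dotTime]; omega) fun _ h => h
  have hops : ([] : List Op) = (List.range (k + 1)).flatMap fun _ => [] := by simp
  rw [hops]
  refine Runs.forLoop (fun l m => Agree [14, 16] m mem ∧
    m 16 0 = (∑ i ∈ Finset.range l, y i * u j i).val) _ (k + 1) 1 ?_ ?_ ?_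
  · refine ⟨((Agree.refl _ mem).set (by simp)).set (by simp), ?_⟩
    simp [Mem.set, Expr.eval]
  · intro i hi m hm
    have := h.agree hm.1 (by decide)
    simp [Expr.eval, this.eval_keyLen]
  · intro i hi m hm hv
    refine Runs.assign ⟨?_, (hm.1.set (by simp)).set (by simp), ?_⟩
    · simp [Mem.set, hv]
    · have e8 : (Expr.get 8 (var 14)).eval m = (y i).val := by
        simp only [Expr.eval, eval_var, hv]
        rw [hm.1 8 (by decide), hy i (by omega)]
      have e9 : (Expr.get 9 (.add (.get 10 e) (var 14))).eval m = (u j i).val := by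
        simp only [Expr.eval, eval_var, hv, he m hm.1]
        rw [hm.1 9 (by decide), hm.1 10 (by decide), hu.offset j hj, hu.entry j hj i (by omega)]
      have := eval_xorExpr (e := var 16) hm.2 (eval_andExpr e8 e9)
      rw [Finset.sum_range_succ, ← this]
      simp [Mem.set, Expr.eval]

theorem row_index_ne {k j i j' i' : ℕ} (hi : i ≤ k) (hi' : i' ≤ k) (h : ¬(j = j' ∧ i = i')) :
    j * (k + 1) + i ≠ j' * (k + 1) + i' := fun e =>
  h (index_unique (Nat.lt_succ_of_le hi) (Nat.lt_succ_of_le hi') e)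

/-- The row can be updated in place: entry `i` is read before it is overwritten, and the pivot row
`d` is a different row and stays intact. -/
theorem runs_addRow (h : HasInput C v r mem) (hu : HasRows k u mem) {t : ZMod 2}
    (ht : mem 16 0 = t.val) {j d : ℕ} (hjd : j < d) (hd : d ≤ k) (hj : mem 13 0 = j)
    (hd' : mem 11 0 = d) :
    Runs O addRowCmd mem [] ((k + 1) * 4 + 3)
      fun m => Agree [9, 14] m mem ∧
        HasRows k (fun j' i => if j' = j then u j i + t * u d i else u j' i) m := by
  have hops : ([] : List Op) = (List.range (k + 1)).flatMap fun _ => [] := by simp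
  rw [hops]
  refine (Runs.forLoop (fun l m => Agree [9, 14] m mem ∧ HasRows k (fun j' i =>
    if j' = j ∧ i < l then u j i + t * u d i else u j' i) m) _ (k + 1) 1 ?_ ?_ ?_).mono le_rfl ?_
  · refine ⟨(Agree.refl _ mem).set (by simp), ?_⟩
    have : HasRows k u (mem.set 14 0 0) :=
      hu.agree (Mem.set_array_ne _ _ _ (by decide)) (Mem.set_array_ne _ _ _ (by decide))
    simpa using this
  · intro i hi m hm
    have := h.agree hm.1 (by decide)
    simp [Expr.eval, this.eval_keyLen]
  · intro i hi m hm hv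
    have e13 : m 13 0 = j := by rw [hm.1 13 (by decide), hj]
    have e11 : m 11 0 = d := by rw [hm.1 11 (by decide), hd']
    have e16 : (var 16).eval m = t.val := by rw [eval_var, hm.1 16 (by decide), ht]
    have idx : (Expr.add (.get 10 (var 13)) (var 14)).eval m = j * (k + 1) + i := by
      simp only [Expr.eval, eval_var, hv, e13, hm.2.offset j (by omega)]
    have e1 : (Expr.get 9 (.add (.get 10 (var 13)) (var 14))).eval m = (u j i).val := by
      have := hm.2.entry j (by omega) i (by omega)
      simp only [lt_irrefl, and_false, if_false] at this
      rw [← this, ← idx]; rfl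
    have e2 : (Expr.get 9 (.add (.get 10 (var 11)) (var 14))).eval m = (u d i).val := by
      have := hm.2.entry d hd i (by omega)
      rw [if_neg (fun h => by omega)] at this
      rw [← this]
      simp only [Expr.eval, eval_var, hv, e11, hm.2.offset d hd]
    refine Runs.assign ?_
    rw [idx, eval_xorExpr e1 (eval_andExpr e16 e2)]
    refine ⟨?_, (hm.1.set (by simp)).set (by simp), ?_, ?_⟩
    · simp [Mem.set, hv]
    · intro j' hj'
      rw [Mem.set_array_ne _ _ _ (by decide), Mem.set_array_ne _ _ _ (by decide),
        hm.2.offset j' hj']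
    · intro j' hj' i' hi'
      rw [Mem.set_array_ne _ _ _ (by decide)]
      by_cases hji : j' = j ∧ i' = i
      · obtain ⟨rfl, rfl⟩ := hji
        rw [Mem.set_same, if_pos ⟨rfl, Nat.lt_succ_self _⟩]
      · rw [Mem.set_index_ne _ _ (row_index_ne hi' (by omega) hji), hm.2.entry j' hj' i' hi']
        congr 1
        by_cases hj : j' = j
        · have : i' < i ↔ i' < i + 1 := by
            have : i' ≠ i := fun h => hji ⟨hj, h⟩
            omega
          simp only [hj, this]
        · simp [hj]
  · rintro m ⟨hm, hr⟩
    refine ⟨hm, hr.offset, fun j' hj' i hi => ?_⟩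
    rw [hr.entry j' hj' i hi]
    simp [Nat.lt_succ_of_le hi]

/-- The matrix after an elimination with the pivot row `d`. -/
def eliminate (k : ℕ) (y : ℕ → ZMod 2) (d : ℕ) (u : ℕ → ℕ → ZMod 2) (j i : ℕ) : ZMod 2 :=
  if j < d then u j i + dot k y (u j) * u d i else u j i

/-- A bound for the time of an elimination. -/
def eliminateTime (k : ℕ) : ℕ := dotTime k + k * (dotTime k + (k + 1) * 4 + 7) + 7

/-- Only rows above the pivot change, each by a multiple of the unchanged pivot row. The multiplier
of a row is computed from that row before its update, so the rows can be treated one at a time. -/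
theorem runs_eliminate (h : HasInput C v r mem) (hu : HasRows k u mem)
    (hy : ∀ i ≤ k, mem 8 i = (y i).val) {d : ℕ} (hd : d ≤ k) (hd' : mem 11 0 = d) :
    Runs O eliminateCmd mem [] (eliminateTime k) fun m =>
      Agree [9, 11, 13, 14, 16, 20] m mem ∧
        if dot k y (u d) = 1 then m 11 0 = d - 1 ∧ HasRows k (eliminate k y d u) m
        else m 11 0 = d ∧ HasRows k u m := by
  rw [← List.nil_append ([] : List Op)]
  refine (Runs.seq (T₂ := k * (dotTime k + ((k + 1) * 4 + 3) + 1 + 3) + 6)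
    ((runs_dot (e := var 11) h hu hy hd fun m hm => ?_).mono le_rfl fun m₁ h₁ => ?_)).mono ?_
    fun _ h => h
  · rw [eval_var, hm 11 (by decide), hd']
  · have A₁ : Agree [9, 11, 13, 14, 16, 20] m₁ mem := h₁.1.mono (by simp)
    have hu₁ : HasRows k u m₁ := hu.agree (h₁.1 9 (by decide)) (h₁.1 10 (by decide))
    have d₁ : m₁ 11 0 = d := by rw [h₁.1 11 (by decide), hd']
    by_cases hdot : dot k y (u d) = 1
    · simp only [hdot, if_true]
      refine (Runs.ite_pos (T := k * (dotTime k + ((k + 1) * 4 + 3) + 1 + 3) + 5) ?_ ?_).mono le_rfl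
        fun _ h => h
      · rw [eval_var, h₁.2, hdot]; decide
      · have hops : ([] : List Op) = ((List.range d).flatMap fun _ => [] ++ []) ++ [] := by simp
        rw [hops]
        refine (Runs.seq (T₁ := d * (dotTime k + ((k + 1) * 4 + 3) + 1 + 3) + 3) (T₂ := 1)
          ((Runs.forLoop (fun l m => Agree [9, 11, 13, 14, 16, 20] m mem ∧ m 11 0 = d ∧
            HasRows k (fun j i => if j < l then eliminate k y d u j i else u j i) m) _ d
            (dotTime k + ((k + 1) * 4 + 3) + 1) ?_ ?_ ?_).mono le_rfl ?_)).mono ?_ fun _ h => h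
        · refine ⟨A₁.set (by simp), ?_, ?_⟩
          · rw [Mem.set_array_ne _ _ _ (by decide), d₁]
          · simpa using hu₁.agree (Mem.set_array_ne _ 0 0 (by decide))
              (Mem.set_array_ne m₁ (b := 13) 0 0 (by decide))
        · intro i _ m hm
          exact hm.2.1
        · intro j hj m hm hv
          -- Row `j` has not been touched yet, so the scalar product computed now is the one with
          -- the original row.
          have hrow : ∀ i, (if j < j then eliminate k y d u j i else u j i) = u j i := fun i => by
            simp
          refine Runs.seq ((runs_dot (y := y) (j := j) (h.agree hm.1 (by decide)) hm.2.2 ?_ (by omega)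
            fun m' hm' => ?_).mono le_rfl fun m₂ h₂ => ?_)
          · intro i hi
            rw [hm.1 8 (by decide), hy i hi]
          · rw [eval_var, hm' 13 (by decide), hv]
          · simp only [hrow] at h₂
            have A₂ : Agree [9, 11, 13, 14, 16, 20] m₂ mem := (h₂.1.mono (by simp)).trans hm.1
            have d₂ : m₂ 11 0 = d := by rw [h₂.1 11 (by decide), hm.2.1]
            have v₂ : m₂ 13 0 = j := by rw [h₂.1 13 (by decide), hv]
            refine (runs_addRow (h.agree A₂ (by decide))
              (hm.2.2.agree (h₂.1 9 (by decide)) (h₂.1 10 (by decide))) h₂.2 hj hd v₂ d₂).mono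
              le_rfl fun m₃ h₃ => ⟨?_, ?_, ?_, ?_⟩
            · rw [h₃.1 13 (by decide), v₂]
            · exact ((h₃.1.mono (by simp)).trans A₂).set (by simp)
            · rw [Mem.set_array_ne _ _ _ (by decide), h₃.1 11 (by decide), d₂]
            · have := h₃.2.agree (m := m₃.set 13 0 (j + 1)) (Mem.set_array_ne _ _ _ (by decide))
                (Mem.set_array_ne _ _ _ (by decide))
              refine ⟨this.offset, fun j' hj' i hi => ?_⟩
              rw [this.entry j' hj' i hi]
              congr 1
              by_cases e : j' = j
              · subst e
                simp [eliminate, hj, not_lt_of_gt hj]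
              · have : j' < j ↔ j' < j + 1 := by omega
                simp only [e, if_false, this]
        · intro m hm
          refine Runs.assign ?_
          refine ⟨hm.1.set (by simp), ?_, ?_⟩
          · simp [Mem.set, Expr.eval, eval_var, hm.2.1]
          · have := hm.2.2.agree (m := m.set 11 ((Expr.lit 0).eval m)
              ((Expr.sub (var 11) (.lit 1)).eval m)) (Mem.set_array_ne _ _ _ (by decide))
              (Mem.set_array_ne _ _ _ (by decide))
            refine ⟨this.offset, fun j' hj' i hi => ?_⟩
            rw [this.entry j' hj' i hi]
            congr 1
            by_cases e : j' < d <;> simp [eliminate, e]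
        · have := Nat.mul_le_mul_right (dotTime k + ((k + 1) * 4 + 3) + 1 + 3) hd
          omega
    · simp only [hdot, if_false]
      refine (Runs.ite_neg (T := 1) ?_ (Runs.skip ⟨A₁.set (by simp), ?_, ?_⟩)).mono (by omega)
        fun _ h => h
      · have : ∀ x : ZMod 2, x ≠ 1 → x.val = 0 := by decide
        rw [eval_var, h₁.2, this _ hdot]
      · rw [Mem.set_array_ne _ _ _ (by decide), d₁]
      · exact hu₁.agree (Mem.set_array_ne _ _ _ (by decide)) (Mem.set_array_ne _ _ _ (by decide))
  · have : dotTime k + ((k + 1) * 4 + 3) + 1 + 3 = dotTime k + (k + 1) * 4 + 7 := by omega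
    rw [this]
    simp only [eliminateTime]
    omega

/-- A bound for the time of the initialization. -/
def initTime (k : ℕ) : ℕ := (k + 1) * 8 + 7

/-- Array `9` is zero initially, so only the diagonal has to be written. The invariant therefore
also records that the rows not yet reached are zero. The row offsets are tabulated because the
machine cannot multiply. -/
theorem runs_init (h : HasInput C v r mem) (h9 : ∀ i, mem 9 i = 0) :
    Runs O initCmd mem [] (initTime k) fun m =>
      HasInput C v r m ∧ m 11 0 = k ∧ HasRows k (fun j i => if j = i then 1 else 0) m := by
  rw [← List.nil_append ([] : List Op)]
  refine (Runs.seq (T₁ := 1) (T₂ := (k + 1) * (5 + 3) + 5) (Runs.assign ?_)).mono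
    (by simp only [initTime]; omega) fun _ h => h
  have hops : ([] : List Op) =
      ((List.range (k + 1)).flatMap fun _ => [] ++ ([] ++ [])) ++ [] := by simp
  rw [hops]
  refine (Runs.seq (T₁ := (k + 1) * (5 + 3) + 3) (T₂ := 1) ((Runs.forLoop
    (fun l m => Agree [9, 10, 13, 15] m mem ∧ m 15 0 = l * (k + 1) ∧
      (∀ j < l, m 10 j = j * (k + 1)) ∧ (∀ j, l ≤ j → ∀ i ≤ k, m 9 (j * (k + 1) + i) = 0) ∧
      ∀ j < l, ∀ i ≤ k, m 9 (j * (k + 1) + i) = if j = i then 1 else 0) _ (k + 1) 5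
      ?_ ?_ ?_).mono le_rfl ?_))
  · refine ⟨((Agree.refl _ mem).set (by simp)).set (by simp), ?_, ?_, ?_, ?_⟩
    · simp [Mem.set, Expr.eval]
    · intro j hj; omega
    · intro j _ i _; simp [Mem.set, h9]
    · intro j hj; omega
  · intro i hi m hm
    have := h.agree hm.1 (by decide)
    simp [Expr.eval, this.eval_keyLen]
  · rintro l hl m ⟨hA, h15, h10, hz, hr⟩ hv
    refine Runs.seq (T₁ := 1) (T₂ := 3) (Runs.assign ?_)
    refine Runs.seq (T₁ := 1) (T₂ := 1) (Runs.assign ?_)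
    refine Runs.assign ?_
    have hk : m 0 0 = k := (h.agree hA (by decide)).key
    refine ⟨?_, ?_, ?_, ?_, ?_, ?_⟩
    · simp [Mem.set, hv]
    · exact (((hA.set (by simp)).set (by simp)).set (by simp)).set (by simp)
    · simp [Mem.set, Expr.eval, var, keyLen, h15, hk, Nat.succ_mul]
    · intro j hj
      rw [Mem.set_array_ne _ _ _ (by decide), Mem.set_array_ne _ _ _ (by decide),
        Mem.set_array_ne _ _ _ (by decide)]
      simp only [eval_var, hv, h15]
      by_cases e : j = l
      · rw [e, Mem.set_same]
      · rw [Mem.set_index_ne _ _ e, h10 j (by omega)]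
    · intro j hj i hi
      rw [Mem.set_array_ne _ _ _ (by decide), Mem.set_array_ne _ _ _ (by decide)]
      have e : (Expr.add (var 15) (var 13)).eval (m.set 10 ((var 13).eval m) ((var 15).eval m)) =
          l * (k + 1) + l := by
        simp [Mem.set, Expr.eval, var, h15, hv]
      rw [e, Mem.set_index_ne _ _ (row_index_ne hi (by omega) (by omega)),
        Mem.set_array_ne _ _ _ (by decide), hz j (by omega) i hi]
    · intro j hj i hi
      rw [Mem.set_array_ne _ _ _ (by decide), Mem.set_array_ne _ _ _ (by decide)]
      have e : (Expr.add (var 15) (var 13)).eval (m.set 10 ((var 13).eval m) ((var 15).eval m)) =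
          l * (k + 1) + l := by
        simp [Mem.set, Expr.eval, var, h15, hv]
      rw [e]
      by_cases e' : j = l ∧ i = l
      · obtain ⟨rfl, rfl⟩ := e'
        rw [Mem.set_same]; simp [Expr.eval]
      · rw [Mem.set_index_ne _ _ (row_index_ne hi (by omega) e'),
          Mem.set_array_ne _ _ _ (by decide)]
        by_cases hjl : j = l
        · rw [hz j (by omega) i hi, if_neg (by omega)]
        · exact hr j (by omega) i hi
  · rintro m ⟨hA, h15, h10, hz, hr⟩
    have h' := h.agree hA (by decide)
    refine Runs.assign ?_
    refine ⟨?_, ?_, ?_, ?_⟩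
    · exact h'.agree ((Agree.refl [11] m).set (by simp)) (by decide)
    · simp [Mem.set, h'.eval_keyLen, Expr.eval]
    · intro j hj
      rw [Mem.set_array_ne _ _ _ (by decide), h10 j (by omega)]
    · intro j hj i hi
      rw [Mem.set_array_ne _ _ _ (by decide), hr j (by omega) i hi]
      split_ifs <;> rfl

/-- Column `0` belongs to the control qubit; the key bits start at column `1`. -/
theorem runs_output (h : HasInput C v r mem) (hu : HasRows k u mem) :
    Runs O outputCmd mem [] (k * 4 + 3) fun m => ∀ i < k, m 7 i = (u 0 (1 + i)).val := by
  have hops : ([] : List Op) = (List.range k).flatMap fun _ => [] := by simp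
  rw [hops]
  refine (Runs.forLoop (fun l m => Agree [7, 13] m mem ∧ ∀ i < l, m 7 i = (u 0 (1 + i)).val) _ k 1
    ?_ ?_ ?_).mono le_rfl fun m hm => hm.2
  · exact ⟨(Agree.refl _ mem).set (by simp), fun i hi => by omega⟩
  · intro i hi m hm
    exact (h.agree hm.1 (by decide)).eval_keyLen
  · intro i hi m hm hv
    refine Runs.assign ⟨?_, (hm.1.set (by simp)).set (by simp), ?_⟩
    · simp [Mem.set, hv]
    · intro i' hi'
      rw [Mem.set_array_ne _ _ _ (by decide)]
      simp only [eval_var, hv, Expr.eval]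
      by_cases e : i' = i
      · subst e
        have := hu.entry 0 (Nat.zero_le k) (1 + i') (by omega)
        rw [zero_mul, zero_add] at this
        rw [Mem.set_same, hm.1 9 (by decide), this]
      · rw [Mem.set_index_ne _ _ e, hm.2 i' (by omega)]

end

/-! ## Measurement of all qubits -/

section
variable {k n : ℕ} {O : Bits k → Bits n → Bits n} {s : Bits k}

theorem Runs.le {c : Cmd} {mem m' : Mem} {ops : List Op} {T : ℕ} (h : Runs O c mem ops T (· = m'))
    (N : ℕ) (cs : List Cmd) (ψ : QState Qubit) :
    penalizedTime O s N ⟨c :: cs, mem, ψ⟩ ≤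
      T * weight ψ + penalizedTime O s N ⟨cs, m', runOps O ops ψ⟩ := by
  obtain ⟨m, rfl, h⟩ := h
  exact h s N cs ψ

/-- After outcome `1` the qubit is reset, and its value survives only in the record `P`. Pairing the
basis states that differ in `q` shows that the weighted cost of the complete strings does not
change. -/
theorem tsum_measure (q : Qubit) (ψ : QState Qubit) (G : Finset Qubit → ℝ≥0∞) (P : Finset Qubit) :
    ∑' S, ‖project q false ψ S‖ₑ ^ 2 * G (S ∪ P) +
      ∑' S, ‖(Gate.X q).apply (project q true ψ) S‖ₑ ^ 2 * G (S ∪ insert q P) =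
    ∑' S, ‖ψ S‖ₑ ^ 2 * G (S ∪ P) := by
  rw [tsum_pair q fun S => ‖ψ S‖ₑ ^ 2 * G (S ∪ P), ← ENNReal.tsum_add]
  refine tsum_congr fun S => ?_
  by_cases h : q ∈ S
  · simp [project, Gate.apply, h, flipQubit_of_mem]
  · simp [project, Gate.apply, h, flipQubit_of_notMem, Finset.union_insert, Finset.insert_union]

/-- `G S` bounds the later cost, per unit of probability, once the string `S` has been measured.
Qubits below `i` have been measured and reset, and `P` is the set of those with outcome `1`; the
remaining state is supported on the qubits from `i` to `l - 1`. At the end only a multiple of `ket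
∅` remains, so every round restarts from a clean quantum memory. A qubit costs seven steps: the loop
test, two sequence unfoldings, the measurement, two steps for the conditional reset and the
increment. -/
theorem penalizedTime_measure_loop {len : Expr} {l : ℕ} {mem₀ : Mem} {G : Finset Qubit → ℝ≥0∞}
    {cs : List Cmd} {N : ℕ} (hlen : ∀ m, Agree [8, 13, 20] m mem₀ → len.eval m = l)
    (hG : ∀ S m (c : ℂ), Agree [8, 13, 20] m mem₀ →
      (∀ i < l, m 8 i = if ((0, i) : Qubit) ∈ S then 1 else 0) →
      penalizedTime O s N ⟨cs, m, c • ket ∅⟩ ≤ ‖c‖ₑ ^ 2 * G S)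
    (j i : ℕ) (hij : i + j = l) (mem : Mem) (ψ : QState Qubit) (P : Finset Qubit)
    (hmem : Agree [8, 13, 20] mem mem₀) (hv : mem 13 0 = i)
    (hP : ∀ i' < i, mem 8 i' = if ((0, i') : Qubit) ∈ P then 1 else 0)
    (hP' : ∀ q ∈ P, q.2 < i)
    (hψ : ∀ S, ψ S ≠ 0 → ∀ q ∈ S, q.1 = 0 ∧ i ≤ q.2 ∧ q.2 < l) :
    penalizedTime O s N ⟨countLoop 13 len measureQubit :: cs, mem, ψ⟩ ≤
      (j * 7 + 1 : ℕ) * weight ψ + ∑' S, ‖ψ S‖ₑ ^ 2 * G (S ∪ P) := by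
  induction j generalizing i mem ψ P with
  | zero =>
    obtain rfl : i = l := by omega
    have he : (Expr.sub len (var 13)).eval mem = 0 := by
      simp [Expr.eval, hlen mem hmem, eval_var, hv]
    refine (Runs.le (Runs.loop_exit (Q := (· = mem)) he rfl) N cs ψ).trans ?_
    have hket : ψ = ψ ∅ • ket ∅ := by
      funext S
      by_cases hS : S = ∅
      · simp [hS, ket]
      · have : ψ S = 0 := by
          by_contra h
          obtain ⟨q, hq⟩ := Finset.nonempty_iff_ne_empty.2 hS
          have := hψ S h q hq
          omega
        simp [this, ket, hS]
    refine add_le_add (by simp) ?_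
    rw [runOps_nil]
    refine le_trans ?_ (ENNReal.le_tsum (∅ : Finset Qubit))
    rw [Finset.empty_union]
    conv_lhs => rw [hket]
    exact hG P mem _ hmem hP
  | succ j ih =>
    have hne : (Expr.sub len (var 13)).eval mem ≠ 0 := by
      simp only [Expr.eval, hlen mem hmem, eval_var, hv]; omega
    set q : Qubit := (0, i) with hq
    set inc : Cmd := .assign 13 (.lit 0) (.add (var 13) (.lit 1)) with hinc
    set L := countLoop 13 len measureQubit with hL
    set reset : Cmd := .ite (.get 8 (var 13)) (.gate (.X (0, var 13))) skip with hreset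
    have s1 := penalizedTime_le_of_step (O := O) (s := s) (c := ⟨L :: cs, mem, ψ⟩)
      (d := ⟨.seq measureQubit inc :: L :: cs, mem, ψ⟩) (by simp)
      (by simp [step, hL, countLoop, hne, hinc]) N
    have s2 := penalizedTime_le_of_step (O := O) (s := s)
      (c := ⟨.seq measureQubit inc :: L :: cs, mem, ψ⟩)
      (d := ⟨measureQubit :: inc :: L :: cs, mem, ψ⟩) (by simp) rfl N
    have s3 := penalizedTime_le_of_step (O := O) (s := s)
      (c := ⟨measureQubit :: inc :: L :: cs, mem, ψ⟩)
      (d := ⟨.measure (0, var 13) 8 (var 13) :: reset :: inc :: L :: cs, mem, ψ⟩) (by simp) rfl N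
    have s4 := penalizedTime_le_of_step_pair (O := O) (s := s)
      (c := ⟨.measure (0, var 13) 8 (var 13) :: reset :: inc :: L :: cs, mem, ψ⟩)
      (d := ⟨reset :: inc :: L :: cs, mem.set 8 i 0, project q false ψ⟩)
      (d' := ⟨reset :: inc :: L :: cs, mem.set 8 i 1, project q true ψ⟩) (by simp)
      (by simp [step, eval_var, hv, QAddr.eval, hq]) N
    have h8 : ∀ b, (Expr.get 8 (var 13)).eval (mem.set 8 i b) = b := by
      intro b; simp [Expr.eval, eval_var, Mem.set, hv]
    have s5 : penalizedTime O s N ⟨reset :: inc :: L :: cs, mem.set 8 i 0, project q false ψ⟩ ≤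
        2 * weight (project q false ψ) + penalizedTime O s N
          ⟨inc :: L :: cs, (mem.set 8 i 0).set 20 0 0, project q false ψ⟩ :=
      Runs.le (Runs.ite_neg (T := 1) (h8 0) (Runs.skip rfl)) N _ _
    have s5' : penalizedTime O s N ⟨reset :: inc :: L :: cs, mem.set 8 i 1, project q true ψ⟩ ≤
        2 * weight (project q true ψ) + penalizedTime O s N
          ⟨inc :: L :: cs, mem.set 8 i 1, (Gate.X q).apply (project q true ψ)⟩ :=
      Runs.le (Runs.ite_pos (T := 1) (by rw [h8 1]; norm_num)
        (Runs.gate' (g := .X (0, var 13)) (g' := .X q) (Q := (· = mem.set 8 i 1)) rfl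
          (by simp [Gate.map, QAddr.eval, eval_var, Mem.set, hv, hq]))) N _ _
    have hstep : ∀ m φ, m 13 0 = i → penalizedTime O s N ⟨inc :: L :: cs, m, φ⟩ ≤
        weight φ + penalizedTime O s N ⟨L :: cs, m.set 13 0 (i + 1), φ⟩ := by
      intro m φ hm
      refine penalizedTime_le_of_step (by simp) ?_ N
      simp [step, hinc, Expr.eval, eval_var, hm]
    have i0 := ih (i + 1) (by omega) (((mem.set 8 i 0).set 20 0 0).set 13 0 (i + 1))
      (project q false ψ) P (((hmem.set (by simp)).set (by simp)).set (by simp))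
      (Mem.set_same _ _ _ _) ?_ (fun p hp => (hP' p hp).trans (Nat.lt_succ_self i)) ?_
    have i1 := ih (i + 1) (by omega) ((mem.set 8 i 1).set 13 0 (i + 1))
      ((Gate.X q).apply (project q true ψ)) (insert q P) ((hmem.set (by simp)).set (by simp))
      (Mem.set_same _ _ _ _) ?_ ?_ ?_
    · have s6 := hstep ((mem.set 8 i 0).set 20 0 0) (project q false ψ) (by simp [Mem.set, hv])
      have s6' := hstep (mem.set 8 i 1) ((Gate.X q).apply (project q true ψ))
        (by simp [Mem.set, hv])
      rw [Gate.weight_apply] at i1 s6'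
      refine s1.trans ((add_le_add_right (s2.trans (add_le_add_right (s3.trans
        (add_le_add_right (s4.trans (add_le_add_right (add_le_add
          (s5.trans (add_le_add_right (s6.trans (add_le_add_right i0 _)) _))
          (s5'.trans (add_le_add_right (s6'.trans (add_le_add_right i1 _)) _))) _)) _)) _)) _).trans ?_)
      simp only
      rw [← tsum_measure q ψ G P, ← weight_project q ψ]
      push_cast
      apply le_of_eq
      ring
    · intro i' hi'
      by_cases e : i' = i
      · subst e
        simp [Mem.set, ← hq]
      · have := hP i' (by omega)
        have e' : ((0, i') : Qubit) ≠ q := fun h => e (Prod.ext_iff.1 h).2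
        simp [Mem.set, e, e', this]
    · intro p hp
      rcases Finset.mem_insert.1 hp with rfl | hp
      · exact Nat.lt_succ_self i
      · exact (hP' p hp).trans (Nat.lt_succ_self i)
    · intro S hS p hp
      have hqS : q ∈ flipQubit q S := by
        by_contra h; simp [Gate.apply, project, h] at hS
      have hS' : ψ (flipQubit q S) ≠ 0 := by
        intro h; simp [Gate.apply, project, h] at hS
      have hq' : q ∉ S := by simpa [mem_flipQubit] using hqS
      have hpq : p ≠ q := fun h => hq' (h ▸ hp)
      obtain ⟨h1, h2, h3⟩ := hψ _ hS' p (by simp [mem_flipQubit, hpq, hp])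
      refine ⟨h1, ?_, h3⟩
      rcases Nat.lt_or_ge i p.2 with h | h
      · exact h
      · exact absurd (Prod.ext h1 (by simp [hq]; omega)) hpq
    · intro i' hi'
      by_cases e : i' = i
      · subst e
        have : q ∉ P := fun h => lt_irrefl _ (hP' q h)
        simp [Mem.set, ← hq, this]
      · have := hP i' (by omega)
        simp [Mem.set, e, this]
    · intro S hS p hp
      have hqS : q ∉ S := by
        intro h; simp [project, h] at hS
      have hS' : ψ S ≠ 0 := by
        intro h; simp [project, h] at hS
      obtain ⟨h1, h2, h3⟩ := hψ S hS' p hp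
      refine ⟨h1, ?_, h3⟩
      rcases Nat.lt_or_ge i p.2 with h | h
      · exact h
      · exact absurd (by rwa [show q = p from Prod.ext h1.symm (by simp [hq]; omega)]) hqS

end

/-! ## Linear algebra of the elimination -/

/-- The bits of a basis state. -/
def bitOf (S : Finset Qubit) (i : ℕ) : ZMod 2 := if ((0, i) : Qubit) ∈ S then 1 else 0

theorem bitOf_symmDiff (S T : Finset Qubit) (i : ℕ) :
    bitOf (symmDiff S T) i = bitOf S i + bitOf T i := by
  have : (1 : ZMod 2) + 1 = 0 := by decide
  by_cases hS : ((0, i) : Qubit) ∈ S <;> by_cases hT : ((0, i) : Qubit) ∈ T <;>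
    simp [bitOf, Finset.mem_symmDiff, hS, hT, this]

theorem bitOf_singleton (d i : ℕ) : bitOf {(0, d)} i = if i = d then 1 else 0 := by
  simp [bitOf]

theorem val_bitOf (S : Finset Qubit) (i : ℕ) :
    (bitOf S i).val = if ((0, i) : Qubit) ∈ S then 1 else 0 := by
  rw [bitOf]
  split_ifs <;> rfl

/-- A scalar product modulo two is the parity of an intersection. This carries the orthogonality of
the samples over to the linear algebra. -/
theorem dot_bitOf {k : ℕ} (S D : Finset Qubit) (hD : D ⊆ (argList k).toFinset) :
    dot k (bitOf S) (bitOf D) = ((D ∩ S).card : ZMod 2) := by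
  have h : D ∩ S = ((Finset.range (k + 1)).filter fun i =>
      ((0, i) : Qubit) ∈ S ∧ ((0, i) : Qubit) ∈ D).image fun i => ((0, i) : Qubit) := by
    ext q
    simp only [Finset.mem_inter, Finset.mem_image, Finset.mem_filter, Finset.mem_range]
    constructor
    · rintro ⟨h1, h2⟩
      obtain ⟨i, hi, rfl⟩ := mem_argList.1 (hD h1)
      exact ⟨i, ⟨by omega, h2, h1⟩, rfl⟩
    · rintro ⟨i, ⟨-, h1, h2⟩, rfl⟩
      exact ⟨h2, h1⟩
  rw [h, Finset.card_image_of_injective _ (fun i j h => (Prod.ext_iff.1 h).2), dot,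
    ← Finset.sum_boole]
  refine Finset.sum_congr rfl fun i _ => ?_
  by_cases hS : ((0, i) : Qubit) ∈ S <;> by_cases hT : ((0, i) : Qubit) ∈ D <;>
    simp [bitOf, hS, hT]

/-- The invariant of the main loop. -/
structure LoopInvariant {k n a : ℕ} (C : Circuit k n a) (v : ℕ → ℕ) (r : ℕ) (s : Bits k)
    (u : ℕ → ℕ → ZMod 2) (d : ℕ) (mem : Mem) : Prop where
  input : HasInput C v r mem
  rows : HasRows k u mem
  count : mem 11 0 = d
  le : d ≤ k
  diag : ∀ j ≤ k, u j j = 1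
  lower : ∀ j ≤ k, ∀ i < j, u j i = 0
  span : ∀ i ≤ k, bitOf (period s) i = ∑ j ∈ Finset.range (d + 1), bitOf (period s) j * u j i

section
variable {k n a r : ℕ} {C : Circuit k n a} {v : ℕ → ℕ} {s : Bits k} {u : ℕ → ℕ → ZMod 2} {d : ℕ}
  {mem : Mem} {E : BlockCipher k n}

theorem ctrl_mem_period (s : Bits k) : ((0, 0) : Qubit) ∈ period s := Finset.mem_insert_self _ _

/-- Pairing `p = ∑ p_j u_j` with `y` gives `0 = ∑ p_j (y·u_j)`. As `y·u_{d+1} = 1`, the last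
coefficient is `p_{d+1} = ∑ p_j (y·u_j)` over `j ≤ d`. Substituting it distributes the pivot row
over the other rows and leaves their coefficients unchanged. -/
theorem span_eliminate {y : ℕ → ZMod 2}
    (hspan : ∀ i ≤ k, bitOf (period s) i =
      ∑ j ∈ Finset.range (d + 1 + 1), bitOf (period s) j * u j i)
    (hy : dot k y (bitOf (period s)) = 0) (hd : dot k y (u (d + 1)) = 1) (i : ℕ) (hi : i ≤ k) :
    bitOf (period s) i =
      ∑ j ∈ Finset.range (d + 1), bitOf (period s) j * eliminate k y (d + 1) u j i := by
  set b := bitOf (period s) with hb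
  have h1 : b (d + 1) = ∑ j ∈ Finset.range (d + 1), b j * dot k y (u j) := by
    have h2 : dot k y b = ∑ j ∈ Finset.range (d + 1 + 1), b j * dot k y (u j) := by
      simp only [dot, Finset.mul_sum]
      rw [Finset.sum_comm]
      refine Finset.sum_congr rfl fun i hi => ?_
      rw [hspan i (Nat.lt_succ_iff.1 (Finset.mem_range.1 hi)), Finset.mul_sum]
      exact Finset.sum_congr rfl fun j _ => by ring
    rw [hy, Finset.sum_range_succ, hd, mul_one] at h2
    have : ∀ x z : ZMod 2, 0 = x + z → z = x := by decide
    exact this _ _ h2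
  rw [hspan i hi, Finset.sum_range_succ, h1, Finset.sum_mul, ← Finset.sum_add_distrib]
  refine Finset.sum_congr rfl fun j hj => ?_
  rw [eliminate, if_pos (Finset.mem_range.1 hj)]
  ring

/-- The unitriangular shape survives because the pivot row vanishes to the left of its diagonal
entry, hence at every column that matters for a row above it. -/
theorem LoopInvariant.eliminate {y : ℕ → ZMod 2} (h : LoopInvariant C v r s u (d + 1) mem)
    (hy : dot k y (bitOf (period s)) = 0) (hd : dot k y (u (d + 1)) = 1) {m : Mem}
    (hinput : HasInput C v r m) (hcount : m 11 0 = d)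
    (hrows : HasRows k (eliminate k y (d + 1) u) m) :
    LoopInvariant C v r s (RelatedKey.eliminate k y (d + 1) u) d m where
  input := hinput
  rows := hrows
  count := hcount
  le := (Nat.le_succ d).trans h.le
  diag j hj := by
    unfold RelatedKey.eliminate
    split_ifs with hjd
    · rw [h.lower (d + 1) h.le j hjd, h.diag j hj, mul_zero, add_zero]
    · exact h.diag j hj
  lower j hj i hi := by
    unfold RelatedKey.eliminate
    split_ifs with hjd
    · rw [h.lower (d + 1) h.le i (hi.trans hjd), h.lower j hj i hi, mul_zero, add_zero]
    · exact h.lower j hj i hi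
  span := span_eliminate h.span hy hd

/-- A shift of the measured strings that is orthogonal to the period, but not to row `d`. -/
def shift (s : Bits k) (d : ℕ) : Finset Qubit :=
  symmDiff {(0, d)} (if ((0, d) : Qubit) ∈ period s then {(0, 0)} else ∅)

theorem bitOf_shift (s : Bits k) (d i : ℕ) :
    bitOf (shift s d) i =
      (if i = d then 1 else 0) + bitOf (period s) d * (if i = 0 then 1 else 0) := by
  rw [shift, bitOf_symmDiff, bitOf_singleton]
  by_cases h : ((0, d) : Qubit) ∈ period s
  · simp [h, bitOf]
  · simp [h, bitOf]

theorem dot_shift (s : Bits k) {d : ℕ} (hd : d ≤ k) (u : ℕ → ZMod 2) :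
    dot k (bitOf (shift s d)) u = u d + bitOf (period s) d * u 0 := by
  simp only [dot, bitOf_shift, add_mul, Finset.sum_add_distrib, mul_assoc, ite_mul, one_mul,
    zero_mul, mul_ite, mul_zero]
  rw [Finset.sum_ite_eq', Finset.sum_ite_eq', if_pos (by simp; omega), if_pos (by simp)]

theorem shift_subset (s : Bits k) {d : ℕ} (hd : d ≤ k) : shift s d ⊆ (argList k).toFinset := by
  refine (symmDiff_le_sup : shift s d ≤ _).trans (sup_le ?_ ?_)
  · intro q hq
    rw [Finset.mem_singleton] at hq
    exact mem_argList.2 ⟨d, hd, hq⟩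
  · intro q hq
    refine mem_argList.2 ⟨0, Nat.zero_le k, ?_⟩
    split_ifs at hq
    · exact Finset.mem_singleton.1 hq
    · simp at hq

/-- The product is `p_d + p_d p_0`, and `p_0 = 1`. -/
theorem shift_orthogonal (s : Bits k) {d : ℕ} (hd : d ≤ k) :
    Even (period s ∩ shift s d).card := by
  rw [← ZMod.natCast_eq_zero_iff_even, ← dot_bitOf _ _ (period_subset s), dot_shift s hd]
  have h0 : bitOf (period s) 0 = 1 := if_pos (ctrl_mem_period s)
  rw [h0, mul_one]
  generalize bitOf (period s) d = x
  revert x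
  decide

/-- Row `d + 1` has entry `1` on the diagonal and `0` at column `0`, so the correction at column `0`
that makes the shift orthogonal to the period is invisible to it. Success and failure of a round are
thus exchanged by the shift. -/
theorem dot_symmDiff_shift (h : LoopInvariant C v r s u (d + 1) mem) (S : Finset Qubit) :
    dot k (bitOf (symmDiff S (shift s (d + 1)))) (u (d + 1)) =
      dot k (bitOf S) (u (d + 1)) + 1 := by
  have h1 := dot_shift s h.le (u (d + 1))
  rw [h.diag _ h.le, h.lower _ h.le 0 (Nat.succ_pos d), mul_zero, add_zero] at h1
  rw [← h1]
  simp only [dot, bitOf_symmDiff, add_mul, Finset.sum_add_distrib]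

/-! ## The main loop -/

/-- Averaging the sum with its image under `σ` replaces `g S` by the mean of `g S` and `g (σ S)`,
which is the constant `c`. -/
theorem tsum_half {w g : Finset Qubit → ℝ≥0∞} {σ : Finset Qubit → Finset Qubit}
    (hσ : Function.Involutive σ) (hw : ∀ S, w (σ S) = w S) {c : ℝ≥0∞}
    (hg : ∀ S, g S + g (σ S) = 2 * c) : ∑' S, w S * g S = (∑' S, w S) * c := by
  have h1 : ∑' S, w S * g (σ S) = ∑' S, w S * g S := by
    rw [← hσ.toPerm.tsum_eq fun S => w S * g S]
    exact tsum_congr fun S => by simp [hw]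
  have h2 : 2 * ∑' S, w S * g S = 2 * ((∑' S, w S) * c) := by
    rw [two_mul]
    nth_rw 2 [← h1]
    rw [← ENNReal.tsum_add, mul_left_comm, ← ENNReal.tsum_mul_right]
    exact tsum_congr fun S => by rw [← mul_add, hg]
  exact (ENNReal.mul_right_inj (by norm_num) (by norm_num)).1 h2

/-- A bound for the time of one round. -/
def roundTime (k n r a G : ℕ) : ℕ :=
  sampleTime k n r G + (1 + (k + n + n + a) + r * n) * 7 + eliminateTime k + 6

/-- A bound for the time to write the output. -/
def outputTime (k : ℕ) : ℕ := k * 4 + 4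

/-- With one row left the span condition reads `p = p_0 u_0 = u_0`, so the row is the period and its
entries after the first are the key. -/
theorem output_bound (h : LoopInvariant C v r s u 0 mem) (N : ℕ) (ψ : QState Qubit) :
    penalizedTime (relatedKeyOracle E s) s N ⟨[.loop (var 11) roundCmd, outputCmd], mem, ψ⟩ ≤
      outputTime k * weight ψ := by
  have h1 : Runs (relatedKeyOracle E s) (.loop (var 11) roundCmd) mem [] 1 (· = mem) :=
    Runs.loop_exit (by rw [eval_var, h.count]) rfl
  refine (Runs.le h1 N _ ψ).trans ?_
  obtain ⟨m, hm, hrun⟩ := runs_output (O := relatedKeyOracle E s) h.input h.rows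
  refine (add_le_add_right (hrun s N [] _) _).trans ?_
  rw [penalizedTime_of_haltedWith, runOps_nil]
  · simp only [outputTime]
    push_cast
    apply le_of_eq
    ring
  · refine ⟨rfl, fun i => ?_⟩
    have := h.span (1 + i.val) (by omega)
    have h0 : bitOf (period s) 0 = 1 := if_pos (ctrl_mem_period s)
    rw [zero_add, Finset.sum_range_one, h0, one_mul] at this
    simp only
    rw [hm i i.2, ← this, val_bitOf]
    simp only [mem_period_key]
    cases s i <;> rfl

/-- Let `B` be the cost of a round and `F` that of the output. With `d + 1` rows to eliminate, a
round leads with equal probability to `d` or again to `d + 1`. The claimed bound reproduces itself: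
`B + ((2d B + F) + (2(d+1) B + F)) / 2 = 2(d+1) B + F`. Staying at `d + 1` is no circularity, as the
induction is on the truncation `N`. -/
theorem loop_bound {m : ℕ → Bits n} (hC : C.Evaluates E)
    (hv : ∀ i < r, ∀ j : Fin n, v (i * n + j) ≠ 0 ↔ m i j = true)
    (hdet : ∀ K K', (∀ i < r, E K (m i) = E K' (m i)) → K = K') (N : ℕ)
    (h : LoopInvariant C v r s u d mem) (c : ℂ) :
    penalizedTime (relatedKeyOracle E s) s N
        ⟨[.loop (var 11) roundCmd, outputCmd], mem, c • ket ∅⟩ ≤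
      ‖c‖ₑ ^ 2 * (2 * d * roundTime k n r a C.gates.length + outputTime k : ℕ) := by
  have hw : weight (c • ket (∅ : Finset Qubit)) = ‖c‖ₑ ^ 2 := by
    rw [weight_smul, weight_ket, mul_one]
  induction N generalizing u d mem c with
  | zero => exact zero_le
  | succ N ih =>
  cases d with
  | zero =>
    refine (output_bound h (N + 1) _).trans ?_
    rw [hw, mul_comm]
    simp
  | succ d =>
    set O := relatedKeyOracle E s with hO
    set B := roundTime k n r a C.gates.length with hB
    set w := k + n + n + a with hwires
    set rest : List Cmd := [.loop (var 11) roundCmd, outputCmd] with hrest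
    obtain ⟨m₁, ⟨hA₁, h15⟩, hrun⟩ := runs_sample (O := O) h.input
    have inp₁ : HasInput C v r m₁ := h.input.agree hA₁ (by decide)
    set φ := runOps O (sampleOps C v r) (ket ∅) with hφ
    obtain ⟨hsupp, hshift⟩ := sample_state (s := s) hC hv hdet
    have hψ : runOps O (sampleOps C v r) (c • ket ∅) = c • φ := map_smul _ _ _
    set F : ℕ := outputTime k
    set g : Finset Qubit → ℝ≥0∞ := fun S => (eliminateTime k +
      (if dot k (bitOf S) (u (d + 1)) = 1 then 2 * d * B + F else 2 * (d + 1) * B + F) : ℕ) with hg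
    classical
    -- Strings that are not orthogonal to the period would break the span condition. They get the
    -- trivial bound `⊤`, which is harmless because their amplitude is zero.
    set G : Finset Qubit → ℝ≥0∞ := fun S => if Even (period s ∩ S).card then g S else ⊤ with hGdef
    have hG : ∀ S m₂ (c' : ℂ), Agree [8, 13, 20] m₂ m₁ →
        (∀ i < 1 + w + r * n, m₂ 8 i = if ((0, i) : Qubit) ∈ S then 1 else 0) →
        penalizedTime O s N ⟨eliminateCmd :: rest, m₂, c' • ket ∅⟩ ≤ ‖c'‖ₑ ^ 2 * G S := by
      intro S m₂ c' hA₂ hy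
      -- For amplitude zero the right side is zero even where `G S = ⊤`; the left side then vanishes
      -- too.
      by_cases hc : c' = 0
      · rw [penalizedTime_zero_state N (by simp [hc])]
        exact zero_le
      by_cases hev : Even (period s ∩ S).card
      · simp only [hGdef, hev, if_true]
        have hA : Agree [8, 12, 13, 15, 20] m₂ mem :=
          (hA₂.mono (by simp)).trans (hA₁.mono (by simp))
        have hrows : HasRows k u m₂ := h.rows.agree (hA 9 (by decide)) (hA 10 (by decide))
        have hcount : m₂ 11 0 = d + 1 := by rw [hA 11 (by decide), h.count]
        obtain ⟨m₃, ⟨hA₃, h₃⟩, hrun₃⟩ := runs_eliminate (O := O) (y := bitOf S)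
          (h.input.agree hA (by decide)) hrows (fun i hi => by
            rw [hy i (by omega), val_bitOf]) h.le hcount
        have inp₃ : HasInput C v r m₃ :=
          (h.input.agree hA (by decide)).agree hA₃ (by decide)
        refine (hrun₃ s N rest _).trans ?_
        rw [runOps_nil, weight_smul, weight_ket, mul_one]
        by_cases hdot : dot k (bitOf S) (u (d + 1)) = 1
        · rw [if_pos hdot, Nat.add_sub_cancel] at h₃
          have hdot0 : dot k (bitOf S) (bitOf (period s)) = 0 := by
            rw [dot_bitOf _ _ (period_subset s), ZMod.natCast_eq_zero_iff_even]
            exact hev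
          refine (add_le_add_right (ih (h.eliminate hdot0 hdot inp₃ h₃.1 h₃.2) c' (by
            rw [weight_smul, weight_ket, mul_one])) _).trans ?_
          simp only [hg, hdot, if_true]
          push_cast
          apply le_of_eq
          ring
        · rw [if_neg hdot] at h₃
          refine (add_le_add_right (ih (u := u) (d := d + 1) (mem := m₃)
            ⟨inp₃, h₃.2, h₃.1, h.le, h.diag, h.lower, h.span⟩ c' (by
            rw [weight_smul, weight_ket, mul_one])) _).trans ?_
          simp only [hg, hdot, if_false]
          push_cast
          apply le_of_eq
          ring
      · simp only [hGdef, hev, if_false]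
        rw [ENNReal.mul_top (by simp [hc])]
        exact le_top
    have hmeasure := penalizedTime_measure_loop (O := O) (s := s)
      (len := .add (.add (.lit 1) wireCount) (var 15)) (l := 1 + w + r * n) (mem₀ := m₁) (G := G)
      (cs := eliminateCmd :: rest) (N := N) (fun m hm => by
        have h15' : m 15 0 = r * n := by rw [hm 15 (by decide), h15]
        simp only [Expr.eval, (inp₁.agree hm (by decide)).eval_wireCount, eval_var, h15']
        rfl) hG (1 + w + r * n) 0 (by omega) (m₁.set 13 0 0) (c • φ) ∅
      ((Agree.refl _ m₁).set (by simp)) (Mem.set_same _ _ _ _) (fun i hi => by omega)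
      (by simp) (fun S hS q hq => by
        have : φ S ≠ 0 := fun h => hS (by simp [h])
        have := (hsupp S this).1 q hq
        exact ⟨this.1, Nat.zero_le _, this.2⟩)
    have hφ1 : ∑' S, ‖φ S‖ₑ ^ 2 = 1 := by
      have := weight_runOps O (sampleOps C v r) (ket ∅)
      rwa [weight_ket] at this
    -- The coefficient `2 * d + 1` is the mean of `2 * d` after a success and `2 * (d + 1)` after a
    -- failure.
    have hsum : ∑' S, ‖(c • φ) S‖ₑ ^ 2 * G (S ∪ ∅) =
        ‖c‖ₑ ^ 2 * (eliminateTime k + ((2 * d + 1) * B + F) : ℕ) := by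
      have h1 : ∀ S, ‖(c • φ) S‖ₑ ^ 2 * G (S ∪ ∅) = ‖c‖ₑ ^ 2 * (‖φ S‖ₑ ^ 2 * g S) := by
        intro S
        rw [Finset.union_empty, Pi.smul_apply, smul_eq_mul, enorm_mul, mul_pow, mul_assoc]
        by_cases h0 : φ S = 0
        · simp [h0]
        · simp only [hGdef, (hsupp S h0).2, if_true]
      rw [tsum_congr h1, ENNReal.tsum_mul_left]
      congr 1
      rw [tsum_half (σ := fun S => symmDiff S (shift s (d + 1)))
        (c := (eliminateTime k + ((2 * d + 1) * B + F) : ℕ)), hφ1, one_mul]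
      · intro S
        simp
      · intro S
        have := hshift _ (shift_subset s h.le) (shift_orthogonal s h.le) S
        rw [← ofReal_norm, ← ofReal_norm, this]
      · intro S
        simp only [hg, dot_symmDiff_shift h]
        have key : ∀ x : ZMod 2, (x = 1 ∧ x + 1 ≠ 1) ∨ (x ≠ 1 ∧ x + 1 = 1) := by decide
        rcases key (dot k (bitOf S) (u (d + 1))) with ⟨e1, e2⟩ | ⟨e1, e2⟩
        · rw [if_pos e1, if_neg e2]
          push_cast
          ring
        · rw [if_neg e1, if_pos e2]
          push_cast
          ring
    rw [hsum, weight_smul, show weight φ = 1 from hφ1, mul_one] at hmeasure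
    -- The loop test is the one step at which the truncation drops from `N + 1` to `N`, which is
    -- what the induction hypothesis needs. All later steps of the round keep `N`.
    rw [penalizedTime_succ (by simp [hrest])]
    have hstep : step O ⟨rest, mem, c • ket ∅⟩ = [⟨roundCmd :: rest, mem, c • ket ∅⟩] := by
      simp [step, hrest, eval_var, h.count]
    rw [hstep]
    simp only [List.map_cons, List.map_nil, List.sum_cons, List.sum_nil, add_zero]
    have t1 := penalizedTime_le_of_step (O := O) (s := s)
      (c := ⟨roundCmd :: rest, mem, c • ket ∅⟩)
      (d := ⟨sampleCmd :: .seq measureCmd eliminateCmd :: rest, mem, c • ket ∅⟩) (by simp) rfl N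
    have t2 := hrun s N (.seq measureCmd eliminateCmd :: rest) (c • ket ∅)
    rw [hψ] at t2
    have t3 := penalizedTime_le_of_step (O := O) (s := s)
      (c := ⟨.seq measureCmd eliminateCmd :: rest, m₁, c • φ⟩)
      (d := ⟨measureCmd :: eliminateCmd :: rest, m₁, c • φ⟩) (by simp) rfl N
    have t4 := penalizedTime_le_of_step (O := O) (s := s)
      (c := ⟨measureCmd :: eliminateCmd :: rest, m₁, c • φ⟩)
      (d := ⟨.assign 13 (.lit 0) (.lit 0) ::
        countLoop 13 (.add (.add (.lit 1) wireCount) (var 15)) measureQubit ::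
        eliminateCmd :: rest, m₁, c • φ⟩) (by simp) rfl N
    have t5 := penalizedTime_le_of_step (O := O) (s := s)
      (c := ⟨.assign 13 (.lit 0) (.lit 0) ::
        countLoop 13 (.add (.add (.lit 1) wireCount) (var 15)) measureQubit ::
        eliminateCmd :: rest, m₁, c • φ⟩)
      (d := ⟨countLoop 13 (.add (.add (.lit 1) wireCount) (var 15)) measureQubit ::
        eliminateCmd :: rest, m₁.set 13 0 0, c • φ⟩) (by simp) rfl N
    have hwφ : weight (c • φ) = ‖c‖ₑ ^ 2 := by
      rw [weight_smul, show weight φ = 1 from hφ1, mul_one]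
    simp only [hw, hwφ] at t1 t2 t3 t4 t5
    rw [hw]
    refine (add_le_add_right (t1.trans (add_le_add_right (t2.trans (add_le_add_right (t3.trans
      (add_le_add_right (t4.trans (add_le_add_right (t5.trans (add_le_add_right hmeasure _)) _))
        _)) _)) _)) _).trans ?_
    -- The summand `6` collects the loop test, three sequence unfoldings, the initialization of the
    -- measurement counter and the exit from the measurement loop.
    have hBval : (B : ℝ≥0∞) = (sampleTime k n r C.gates.length +
      (1 + w + r * n) * 7 + eliminateTime k + 6 : ℕ) := rfl
    push_cast at hBval ⊢
    apply le_of_eq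
    rw [hBval]
    ring

end

/-! ## The attack -/

theorem getD_blockList {r n : ℕ} (m : Fin r → Bits n) (i : Fin r) (j : Fin n) :
    (blockList m).getD (i * n + j) 0 = (m i j).toNat := by
  have hlt : i.val * n + j.val < r * n := by
    calc i.val * n + j.val < i.val * n + n := Nat.add_lt_add_left j.2 _
      _ = (i.val + 1) * n := by ring
      _ ≤ r * n := Nat.mul_le_mul_right _ i.2
  have hdiv : ∀ (i : Fin r) (j : Fin n) (h : i.val * n + j.val < r * n),
      (⟨i.val * n + j.val, h⟩ : Fin (r * n)).divNat = i := fun i j h => Fin.ext <| by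
    change (i.val * n + j.val) / n = i.val
    rw [add_comm, Nat.add_mul_div_right _ _ j.pos,
      Nat.div_eq_of_lt j.2, zero_add]
  have hmod : ∀ (i : Fin r) (j : Fin n) (h : i.val * n + j.val < r * n),
      (⟨i.val * n + j.val, h⟩ : Fin (r * n)).modNat = j := fun i j h => Fin.ext <| by
    change (i.val * n + j.val) % n = j.val
    rw [add_comm, Nat.add_mul_mod_self_right, Nat.mod_eq_of_lt j.2]
  have h : blockList m =
      List.ofFn fun x : Fin (r * n) => (m x.divNat x.modNat).toNat := by
    rw [List.ofFn_mul, blockList]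
    simp only [hdiv, hmod]
  rw [h, List.getD_eq_getElem?_getD, List.getElem?_ofFn, dif_pos hlt, Option.getD_some, hdiv, hmod]

section
variable {k n r a : ℕ} (C : Circuit k n a) (m c : Fin r → Bits n)

theorem hasInput_inputMem :
    HasInput C (fun i => (blockList m).getD i 0) r (inputMem C m c) where
  key := rfl
  block := rfl
  plains := rfl
  ancillas := rfl
  gates := rfl
  code i g h := by
    simp [inputMem, List.getD_eq_getElem?_getD, h]
  plain := rfl

theorem LoopInvariant.initial {C : Circuit k n a} {v : ℕ → ℕ} {mem : Mem} (s : Bits k)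
    (hinput : HasInput C v r mem) (hcount : mem 11 0 = k)
    (hrows : HasRows k (fun j i => if j = i then 1 else 0) mem) :
    LoopInvariant C v r s (fun j i => if j = i then 1 else 0) k mem where
  input := hinput
  rows := hrows
  count := hcount
  le := le_rfl
  diag j _ := if_pos rfl
  lower j _ i hi := if_neg hi.ne'
  span i hi := by
    simp only [mul_ite, mul_one, mul_zero]
    rw [Finset.sum_ite_eq', if_pos (Finset.mem_range.2 (by omega))]

/-- A bound for the expected time of the attack. -/
def attackTime (k n r a G : ℕ) : ℕ :=
  initTime k + 2 + (2 * k * roundTime k n r a G + outputTime k)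

variable {C m}

/-- The bound is uniform in the truncation `N`, as both `expectedTime_le` and `probOutput_eq_one`
require. -/
theorem attack_bound {E : BlockCipher k n} (hC : C.Evaluates E) (hm : DeterminesKey E m)
    (s : Bits k) (N : ℕ) :
    penalizedTime (relatedKeyOracle E s) s N (start attack C m c) ≤
      (attackTime k n r a C.gates.length : ℕ) := by
  set O := relatedKeyOracle E s
  -- The plaintexts are extended to all indices by an arbitrary default; only indices below `r` are
  -- ever used.
  set plain : ℕ → Bits n := fun i => if h : i < r then m ⟨i, h⟩ else fun _ => false with hplain
  have hp : ∀ (i : ℕ) (h : i < r), plain i = m ⟨i, h⟩ := fun i h => dif_pos h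
  have hv : ∀ i < r, ∀ j : Fin n,
      (blockList m).getD (i * n + j) 0 ≠ 0 ↔ plain i j = true := by
    intro i hi j
    rw [hp i hi, getD_blockList m ⟨i, hi⟩ j]
    cases m ⟨i, hi⟩ j <;> simp
  have hdet : ∀ K K', (∀ i < r, E K (plain i) = E K' (plain i)) → K = K' := by
    intro K K' h
    refine (hm K').unique (fun i => ?_) fun i => rfl
    rw [← hp i i.2]
    exact h i i.2
  obtain ⟨m₁, ⟨hinput, hcount, hrows⟩, hrun⟩ :=
    runs_init (O := O) (hasInput_inputMem C m c) fun i => rfl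
  have hloop := loop_bound hC hv hdet N (LoopInvariant.initial s hinput hcount hrows) 1
  rw [one_smul, enorm_one, one_pow, one_mul] at hloop
  have t1 := penalizedTime_le_of_step (O := O) (s := s) (c := start attack C m c)
    (d := ⟨[initCmd, .seq (.loop (var 11) roundCmd) outputCmd], inputMem C m c, ket ∅⟩)
    (by simp [start]) rfl N
  have t2 := hrun s N [.seq (.loop (var 11) roundCmd) outputCmd] (ket ∅)
  have t3 := penalizedTime_le_of_step (O := O) (s := s)
    (c := ⟨[.seq (.loop (var 11) roundCmd) outputCmd], m₁, ket ∅⟩)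
    (d := ⟨[.loop (var 11) roundCmd, outputCmd], m₁, ket ∅⟩) (by simp) rfl N
  rw [runOps_nil] at t2
  simp only [start, weight_ket] at t1 t2 t3
  refine (t1.trans (add_le_add_right (t2.trans (add_le_add_right
    (t3.trans (add_le_add_right hloop _)) _)) _)).trans (le_of_eq ?_)
  rw [attackTime]
  push_cast
  ring

/-- The time is a polynomial of degree three, with leading contributions such as `k * r * (n + G)`
from sampling and `k * k * k` from elimination. After replacing all parameters by `z`, the constant
`1000` dominates all coefficients. -/
theorem attackTime_le {G z : ℕ} (hk : k ≤ z) (hn : n ≤ z) (hr : r ≤ z) (ha : a ≤ z)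
    (hG : G ≤ z) : attackTime k n r a G ≤ 1000 * (z + 1) ^ 3 := by
  have h : attackTime k n r a G ≤ attackTime z z z z z := by
    unfold attackTime initTime roundTime sampleTime stageTime eliminateTime dotTime outputTime
    gcongr
  refine h.trans ?_
  unfold attackTime initTime roundTime sampleTime stageTime eliminateTime dotTime outputTime
  nlinarith [Nat.zero_le (z ^ 2), Nat.zero_le (z ^ 3)]

end

end

end RelatedKey

/-! ### The main theorem -/

theorem mainTheorem2 :
    ∃ A : Cmd, ∀ q : Polynomial ℕ, ∃ p : Polynomial ℕ,
      ∀ (k n r a : ℕ) (E : BlockCipher k n) (C : Circuit k n a) (m : Fin r → Bits n),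
        0 < n → k ⌈/⌉ n < r → r ≤ q.eval k → C.size ≤ q.eval k →
        C.Evaluates E → DeterminesKey E m →
        ∀ s : Bits k,
          probOutput (relatedKeyOracle E s) (start A C m fun i => E s (m i)) s = 1 ∧
          expectedTime (relatedKeyOracle E s) (start A C m fun i => E s (m i)) ≤
            (p.eval k : ℕ) := by
  -- All of `k`, `n`, `a` and the number of gates are bounded by the size of the circuit, and `r` is
  -- bounded separately, so `attackTime_le` applies with `z = q.eval k`.
  refine ⟨attack, fun q => ⟨1000 * (q + 1) ^ 3, ?_⟩⟩
  intro k n r a E C m _ _ hr hsize hC hm s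
  have bound := attack_bound (fun i => E s (m i)) hC hm s
  refine ⟨probOutput_eq_one (weight_ket _) (ENNReal.natCast_ne_top _) bound,
    (expectedTime_le bound).trans ?_⟩
  rw [Circuit.size] at hsize
  have := attackTime_le (k := k) (n := n) (r := r) (a := a) (G := C.gates.length)
    (z := q.eval k) (by omega) (by omega) hr (by omega) (by omega)
  rw [Nat.cast_le]
  simpa using this
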